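/- Notation. A finite quantum space is a pair $(B,\psi)$ of a finite-dimensional $C^*$-algebra $B$ and a faithful state $\psi$ on $B$ with $mm^*=\delta^2\,\mathrm{id}$ for some $\delta>0$, where $m:B\otimes B\to B$ is the multiplication and $m^*$ its adjoint for the inner product $\langle x,y\rangle=\psi(x^*y)$. A directed quantum graph $\mathcal G=(B,\psi,A)$ is a finite quantum space with a linear map $A:B\to B$ such that $m(A\otimes A)m^*=\delta^2A$. A quantum Cuntz–Krieger $\mathcal G$-family in a $C^*$-algebra $D$ with multiplication $\mu_D$ is a linear map $s:B\to D$ with $$\mu_D(\mathrm{id}\otimes\mu_D)(s\otimes s^*\otimes s)(\mathrm{id}\otimes m^*)m^*=s,\qquad \mu_D(s^*\otimes s)m^*=\mu_D(s\otimes s^*)m^*A,$$ where $s^*(b)=s(b^*)^*$; $\mathbb{F}\mathcal{O}(\mathcal G)$ is the universal (not necessarily unital) $C^*$-algebra generated by such a family $S:B\to\mathbb{F}\mathcal{O}(\mathcal G)$. The quantum automorphism group $G^+(\mathcal G)$ is the universal compact quantum group with an action $\beta:B\to B\otimes C(G^+(\mathcal G))$ such that $(\psi\otimes\mathrm{id})\beta=\psi(\cdot)1$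 and $\beta A=(A\otimes\mathrm{id})\beta$. For directed quantum graphs $\mathcal G_i=(B_i,\psi_i,A_i)$, $\mathcal G_j=(B_j,\psi_j,A_j)$, the $C^*$-algebra $C(G^+(\mathcal G_j,\mathcal G_i))$ is the universal unital $C^*$-algebra generated by the coefficients $u_{nm}$ of a unital $*$-homomorphism $\beta_{ji}:B_i\to B_j\otimes C(G^+(\mathcal G_j,\mathcal G_i))$, $\beta_{ji}(e_m)=\sum_n f_n\otimes u_{nm}$ ($(e_m)$, $(f_n)$ orthonormal bases of $B_i$, $B_j$), such that $(\psi_j\otimes\mathrm{id})\beta_{ji}=\psi_i(\cdot)1$, $(A_j\otimes\mathrm{id})\beta_{ji}=\beta_{ji}A_i$ and the matrix $u=(u_{nm})$ is unitary. Tensor products of $C^*$-algebras are minimal. **Theorem.** Let $\mathcal G_1,\mathcal G_2$ be directed quantum graphs (for instance, quantum isomorphic ones), with universal families $S_i:B_i\to\mathbb{F}\mathcal{O}(\mathcal G_i)$. (1) For all $1\le i,j\le 2$ there is a $*$-homomorphism $$\hat\beta_{ji}:\mathbb{F}\mathcal{O}(\mathcal G_i)\to\mathbb{F}\mathcal{O}(\mathcal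 G_j)\otimes C(G^+(\mathcal G_j,\mathcal G_i))\quad\text{with}\quad \hat\beta_{ji}(S_i(b))=(S_j\otimes\mathrm{id})\beta_{ji}(b)\quad(b\in B_i).$$ (2) For every $i$, the algebra $C(G^+(\mathcal G_i,\mathcal G_i))$ with a suitable comultiplication $\Delta$ and the map $\beta_{ii}$ is the quantum automorphism group $G^+(\mathcal G_i)$ with its canonical action on $B_i$, and there is an action $\hat\beta:\mathbb{F}\mathcal{O}(\mathcal G_i)\to\mathbb{F}\mathcal{O}(\mathcal G_i)\otimes C(G^+(\mathcal G_i))$ of this compact quantum group (coassociativity and density condition included) with $\hat\beta(S_i(b))=(S_i\otimes\mathrm{id})\beta_{ii}(b)$ for all $b\in B_i$. -/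

import Mathlib

open scoped TensorProduct ComplexOrder

universe u v w

noncomputable section

/-- A C*-seminorm on a (not necessarily unital) complex *-algebra `P`: a submultiplicative seminorm
with the C*-identity.  (The inequality `p a ^ 2 ≤ p (star a * a)` gives `p (star a) = p a`
and equality.) -/
structure CStarSeminorm (P : Type u) [NonUnitalRing P] [StarRing P] [Module ℂ P]
    extends Seminorm ℂ P where
  mul_le' : ∀ a b, toFun (a * b) ≤ toFun a * toFun b
  le_star_mul_self' : ∀ a, toFun a * toFun a ≤ toFun (star a * a)

namespace CStarSeminorm

section Basic

variable {P : Type u} [NonUnitalRing P] [StarRing P] [Module ℂ P]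

instance : FunLike (CStarSeminorm P) P ℝ where
  coe p := p.toFun
  coe_injective p q h := by
    rcases p with ⟨p, _, _⟩
    rcases q with ⟨q, _, _⟩
    have : p = q := DFunLike.coe_injective h
    subst this
    rfl

variable (p : CStarSeminorm P)

theorem add_le (a b : P) : p (a + b) ≤ p a + p b := map_add_le_add p.toSeminorm a b
theorem smul_eq (c : ℂ) (a : P) : p (c • a) = ‖c‖ * p a := map_smul_eq_mul p.toSeminorm c a
theorem mul_le (a b : P) : p (a * b) ≤ p a * p b := p.mul_le' a b
theorem le_star_mul_self (a : P) : p a * p a ≤ p (star a * a) := p.le_star_mul_self' a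
theorem zero_eq : p 0 = 0 := map_zero p.toSeminorm
theorem neg_eq (a : P) : p (-a) = p a := map_neg_eq_map p.toSeminorm a
theorem nonneg (a : P) : 0 ≤ p a := apply_nonneg p.toSeminorm a

theorem le_star (a : P) : p a ≤ p (star a) := by
  rcases (p.nonneg a).eq_or_lt with h | h
  · rw [← h]; exact p.nonneg _
  · have h1 := (p.le_star_mul_self a).trans (p.mul_le (star a) a)
    exact le_of_mul_le_mul_right h1 h

theorem star_eq (a : P) : p (star a) = p a :=
  le_antisymm (by simpa using p.le_star (star a)) (p.le_star a)

/-- The algebra `P` regarded as a seminormed algebra with seminorm `p`. -/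
def Space (_p : CStarSeminorm P) : Type u := P

instance : NonUnitalRing p.Space := inferInstanceAs (NonUnitalRing P)

instance : Module ℂ p.Space := inferInstanceAs (Module ℂ P)

instance : StarRing p.Space := inferInstanceAs (StarRing P)

instance : NonUnitalSeminormedRing p.Space where
  norm a := p a
  dist a b := p (-(show P from a) + (show P from b))
  dist_self a := by
    rw [neg_add_cancel, p.zero_eq]
  dist_comm a b := by
    rw [← p.neg_eq, neg_add_rev, neg_neg]
  dist_triangle a b c := by
    refine le_trans (le_of_eq ?_) (p.add_le _ _)
    congr 1
    abel
  dist_eq a b := rfl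
  norm_mul_le a b := p.mul_le a b

instance : NormedSpace ℂ p.Space where
  __ := (inferInstance : Module ℂ p.Space)
  norm_smul_le c a := (p.smul_eq c a).le

instance : NormedStarGroup p.Space where
  norm_star_le a := (p.star_eq a).le

/-- The Hausdorff completion of `P` with respect to the C*-seminorm `p`: quotient by the null
ideal of `p`, then complete. It is a C*-algebra. -/
def Completion : Type u := UniformSpace.Completion p.Space

instance : NormedAddCommGroup p.Completion :=
  inferInstanceAs (NormedAddCommGroup (UniformSpace.Completion p.Space))
instance : NormedSpace ℂ p.Completion :=
  inferInstanceAs (NormedSpace ℂ (UniformSpace.Completion p.Space))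
instance : CompleteSpace p.Completion :=
  inferInstanceAs (CompleteSpace (UniformSpace.Completion p.Space))

/-- The canonical linear map from `P` to its completion. -/
def coe : P →ₗ[ℂ] p.Completion :=
  (UniformSpace.Completion.toComplₗᵢ (𝕜 := ℂ) (E := p.Space)).toLinearMap

theorem norm_coe (a : P) : ‖p.coe a‖ = p a :=
  UniformSpace.Completion.norm_coe (E := p.Space) a

theorem continuous_coe : Continuous (fun a : p.Space => p.coe a) :=
  UniformSpace.Completion.continuous_coe p.Space

theorem isDenseInducing_coe : IsDenseInducing (fun a : p.Space => p.coe a) :=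
  UniformSpace.Completion.isDenseInducing_coe

theorem denseRange_coe : DenseRange p.coe :=
  UniformSpace.Completion.denseRange_coe (α := p.Space)

theorem induction_on {C : p.Completion → Prop} (x : p.Completion)
    (hc : IsClosed {x | C x}) (h : ∀ a : P, C (p.coe a)) : C x :=
  UniformSpace.Completion.induction_on (α := p.Space) x hc h

instance : Mul p.Completion where
  mul := Function.curry <| (p.isDenseInducing_coe.prodMap p.isDenseInducing_coe).extend
    (fun z => p.coe ((z.1 * z.2 : p.Space) : P))

theorem coe_mul (a b : P) : p.coe (a * b) = p.coe a * p.coe b :=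
  ((p.isDenseInducing_coe.prodMap p.isDenseInducing_coe).extend_eq
    ((p.continuous_coe).comp (continuous_mul (M := p.Space))) (a, b)).symm

instance : ContinuousMul p.Completion where
  continuous_mul := by
    let i : p.Space →+ p.Completion := p.coe.toAddMonoidHom
    let m := (AddMonoidHom.mul : p.Space →+ p.Space →+ p.Space).compr₂ i
    have : Continuous fun z : p.Space × p.Space => m z.1 z.2 :=
      p.continuous_coe.comp (continuous_mul (M := p.Space))
    have di : IsDenseInducing i := p.isDenseInducing_coe
    exact (di.extend_Z_bilin di this :)

instance : Star p.Completion where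
  star := UniformSpace.Completion.map (star : p.Space → p.Space)

theorem coe_star (a : P) : p.coe (star a) = star (p.coe a) :=
  (UniformSpace.Completion.map_coe (α := p.Space) (β := p.Space)
    (starNormedAddGroupHom.uniformContinuous) a).symm

instance : ContinuousStar p.Completion where
  continuous_star := UniformSpace.Completion.continuous_map

theorem induction_on₂ {C : p.Completion → p.Completion → Prop} (x y : p.Completion)
    (hc : IsClosed {z : p.Completion × p.Completion | C z.1 z.2})
    (h : ∀ a b : P, C (p.coe a) (p.coe b)) : C x y :=
  UniformSpace.Completion.induction_on₂ (α := p.Space) (β := p.Space) x y hc h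

theorem induction_on₃ {C : p.Completion → p.Completion → p.Completion → Prop}
    (x y z : p.Completion)
    (hc : IsClosed {w : p.Completion × p.Completion × p.Completion | C w.1 w.2.1 w.2.2})
    (h : ∀ a b c : P, C (p.coe a) (p.coe b) (p.coe c)) : C x y z :=
  UniformSpace.Completion.induction_on₃ (α := p.Space) (β := p.Space) (γ := p.Space) x y z hc h

instance : NonUnitalNormedRing p.Completion where
  __ := (inferInstance : NormedAddCommGroup p.Completion)
  __ := (inferInstance : Mul p.Completion)
  left_distrib a b c := by
    induction a, b, c using p.induction_on₃ with
    | hc => exact isClosed_eq (by fun_prop) (by fun_prop)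
    | h a b c =>
      rw [← map_add, ← p.coe_mul, mul_add, map_add, p.coe_mul, p.coe_mul]
  right_distrib a b c := by
    induction a, b, c using p.induction_on₃ with
    | hc => exact isClosed_eq (by fun_prop) (by fun_prop)
    | h a b c =>
      rw [← map_add, ← p.coe_mul, add_mul, map_add, p.coe_mul, p.coe_mul]
  zero_mul a := by
    induction a using p.induction_on with
    | hc => exact isClosed_eq (by fun_prop) (by fun_prop)
    | h a =>
      rw [← map_zero p.coe, ← p.coe_mul, zero_mul]
  mul_zero a := by
    induction a using p.induction_on with
    | hc => exact isClosed_eq (by fun_prop) (by fun_prop)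
    | h a =>
      rw [← map_zero p.coe, ← p.coe_mul, mul_zero]
  mul_assoc a b c := by
    induction a, b, c using p.induction_on₃ with
    | hc => exact isClosed_eq (by fun_prop) (by fun_prop)
    | h a b c =>
      simp only [← p.coe_mul, mul_assoc]
  norm_mul_le a b := by
    induction a, b using p.induction_on₂ with
    | hc => exact isClosed_le (by fun_prop) (by fun_prop)
    | h a b =>
      simpa only [← p.coe_mul, p.norm_coe] using p.mul_le a b

instance : StarRing p.Completion where
  star_involutive a := by
    induction a using p.induction_on with
    | hc => exact isClosed_eq (by fun_prop) (by fun_prop)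
    | h a =>
      rw [← p.coe_star, ← p.coe_star, star_star]
  star_mul a b := by
    induction a, b using p.induction_on₂ with
    | hc => exact isClosed_eq (by fun_prop) (by fun_prop)
    | h a b =>
      simp only [← p.coe_mul, ← p.coe_star, star_mul]
  star_add a b := by
    induction a, b using p.induction_on₂ with
    | hc => exact isClosed_eq (by fun_prop) (by fun_prop)
    | h a b =>
      simp only [← map_add, ← p.coe_star, star_add]

instance : CStarRing p.Completion where
  norm_mul_self_le a := by
    induction a using p.induction_on with
    | hc => exact isClosed_le (by fun_prop) (by fun_prop)
    | h a => simpa only [← p.coe_mul, ← p.coe_star, p.norm_coe] using p.le_star_mul_self a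

instance [IsScalarTower ℂ P P] : IsScalarTower ℂ p.Completion p.Completion where
  smul_assoc c a b := by
    simp only [smul_eq_mul]
    induction a, b using p.induction_on₂ with
    | hc =>
      have h1 : Continuous fun z : p.Completion × p.Completion => (c • z.1) * z.2 := (continuous_fst.const_smul c).mul continuous_snd
      have h2 : Continuous fun z : p.Completion × p.Completion => c • (z.1 * z.2) := (continuous_fst.mul continuous_snd).const_smul c
      exact isClosed_eq h1 h2
    | h a b => rw [← map_smul, ← p.coe_mul, smul_mul_assoc, map_smul, p.coe_mul]

instance [SMulCommClass ℂ P P] : SMulCommClass ℂ p.Completion p.Completion where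
  smul_comm c a b := by
    simp only [smul_eq_mul]
    induction a, b using p.induction_on₂ with
    | hc =>
      have h1 : Continuous fun z : p.Completion × p.Completion => c • (z.1 * z.2) := (continuous_fst.mul continuous_snd).const_smul c
      have h2 : Continuous fun z : p.Completion × p.Completion => z.1 * (c • z.2) := continuous_fst.mul (continuous_snd.const_smul c)
      exact isClosed_eq h1 h2
    | h a b => rw [← map_smul, ← p.coe_mul, ← p.coe_mul, mul_smul_comm, map_smul]

instance [StarModule ℂ P] : StarModule ℂ p.Completion where
  star_smul c a := by
    induction a using p.induction_on with
    | hc =>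
      have h1 : Continuous fun z : p.Completion => star (c • z) := (continuous_id.const_smul c).star
      have h2 : Continuous fun z : p.Completion => star c • star z := continuous_id.star.const_smul (star c)
      exact isClosed_eq h1 h2
    | h a => rw [← map_smul, ← p.coe_star, ← p.coe_star, star_smul, map_smul]

/-- A linear map that is bounded with respect to a C*-seminorm extends to the completion. -/
def extendL {E : Type v} [NormedAddCommGroup E] [NormedSpace ℂ E] [CompleteSpace E]
    (f : P →ₗ[ℂ] E) (K : ℝ) (h : ∀ a, ‖f a‖ ≤ K * p a) : p.Completion →L[ℂ] E :=
  ContinuousLinearMap.fromCompletion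
    ((show p.Space →ₗ[ℂ] E from f).mkContinuous K h)

theorem extendL_coe {E : Type v} [NormedAddCommGroup E] [NormedSpace ℂ E] [CompleteSpace E]
    (f : P →ₗ[ℂ] E) (K : ℝ) (h : ∀ a, ‖f a‖ ≤ K * p a) (a : P) :
    p.extendL f K h (p.coe a) = f a :=
  ContinuousLinearMap.fromCompletion_apply_coe
    ((show p.Space →ₗ[ℂ] E from f).mkContinuous K h) a

instance [IsScalarTower ℂ P P] [SMulCommClass ℂ P P] [StarModule ℂ P] :
    NonUnitalCStarAlgebra p.Completion where
  smul_assoc := smul_assoc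
  smul_comm := smul_comm
  star_smul := star_smul

/-- The canonical *-homomorphism from `P` to its completion. -/
def coeHom : P →⋆ₙₐ[ℂ] p.Completion where
  __ := p.coe
  map_zero' := map_zero p.coe
  map_mul' := p.coe_mul
  map_star' := p.coe_star

/-- A *-homomorphism to a C*-algebra that is dominated by a C*-seminorm extends to the
completion. -/
def lift {E : Type v} [NonUnitalCStarAlgebra E] (f : P →⋆ₙₐ[ℂ] E) (h : ∀ a, ‖f a‖ ≤ p a) :
    p.Completion →⋆ₙₐ[ℂ] E where
  toFun := p.extendL (f : P →ₗ[ℂ] E) 1 (fun a => by simpa using h a)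
  map_smul' c a := map_smul _ c a
  map_zero' := map_zero _
  map_add' := map_add _
  map_mul' a b := by
    induction a, b using p.induction_on₂ with
    | hc => exact isClosed_eq (by fun_prop) (by fun_prop)
    | h a b => rw [← p.coe_mul, extendL_coe, extendL_coe, extendL_coe]; exact map_mul f a b
  map_star' a := by
    induction a using p.induction_on with
    | hc => exact isClosed_eq (by fun_prop) (by fun_prop)
    | h a => rw [← p.coe_star, extendL_coe, extendL_coe]; exact map_star f a

theorem lift_coe {E : Type v} [NonUnitalCStarAlgebra E] (f : P →⋆ₙₐ[ℂ] E)
    (h : ∀ a, ‖f a‖ ≤ p a) (a : P) : p.lift f h (p.coe a) = f a :=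
  p.extendL_coe (f : P →ₗ[ℂ] E) 1 _ a

end Basic

section Unital

variable {P : Type u} [Ring P] [StarRing P] [Algebra ℂ P] (p : CStarSeminorm P)

instance : NormedRing p.Completion where
  __ := (inferInstance : NonUnitalNormedRing p.Completion)
  one := p.coe 1
  one_mul a := by
    change p.coe 1 * a = a
    induction a using p.induction_on with
    | hc => exact isClosed_eq (by fun_prop) (by fun_prop)
    | h a => rw [← p.coe_mul, one_mul]
  mul_one a := by
    change a * p.coe 1 = a
    induction a using p.induction_on with
    | hc => exact isClosed_eq (by fun_prop) (by fun_prop)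
    | h a => rw [← p.coe_mul, mul_one]

theorem coe_one : p.coe 1 = 1 := rfl

instance : Algebra ℂ p.Completion :=
  Algebra.ofModule (fun c a b => smul_mul_assoc c a b) (fun c a b => mul_smul_comm c a b)

instance [StarModule ℂ P] : CStarAlgebra p.Completion where
  norm_smul_le := norm_smul_le

end Unital
end CStarSeminorm

/-- The pointwise supremum of a pointwise bounded family of C*-seminorms is a C*-seminorm. -/
def CStarSeminorm.iSup {P : Type u} [NonUnitalRing P] [StarRing P] [Module ℂ P] {I : Sort w}
    (p : I → CStarSeminorm P) (h : ∀ a, BddAbove (Set.range fun i => p i a)) :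
    CStarSeminorm P where
  __ := Seminorm.of (fun a => ⨆ i, p i a)
    (fun a b => Real.iSup_le (fun i => ((p i).add_le a b).trans
        (add_le_add (le_ciSup (h a) i) (le_ciSup (h b) i)))
      (add_nonneg (Real.iSup_nonneg fun i => (p i).nonneg a)
        (Real.iSup_nonneg fun i => (p i).nonneg b)))
    (fun c a => by
      simp only [CStarSeminorm.smul_eq]
      exact (Real.mul_iSup_of_nonneg (norm_nonneg c) _).symm)
  mul_le' a b := Real.iSup_le (fun i => ((p i).mul_le a b).trans
      (mul_le_mul (le_ciSup (h a) i) (le_ciSup (h b) i) ((p i).nonneg b)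
        (Real.iSup_nonneg fun i => (p i).nonneg a)))
    (mul_nonneg (Real.iSup_nonneg fun i => (p i).nonneg a)
      (Real.iSup_nonneg fun i => (p i).nonneg b))
  le_star_mul_self' a := by
    have h0 : 0 ≤ ⨆ i, p i (star a * a) := Real.iSup_nonneg fun i => (p i).nonneg _
    have h1 : (⨆ i, p i a) ≤ √(⨆ i, p i (star a * a)) := by
      refine Real.iSup_le (fun i => ?_) (Real.sqrt_nonneg _)
      refine Real.le_sqrt_of_sq_le ?_
      rw [sq]
      exact ((p i).le_star_mul_self a).trans (le_ciSup (h (star a * a)) i)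
    have h2 : 0 ≤ ⨆ i, p i a := Real.iSup_nonneg fun i => (p i).nonneg a
    calc (⨆ i, p i a) * (⨆ i, p i a)
        ≤ √(⨆ i, p i (star a * a)) * √(⨆ i, p i (star a * a)) :=
          mul_le_mul h1 h1 h2 (Real.sqrt_nonneg _)
      _ = ⨆ i, p i (star a * a) := Real.mul_self_sqrt h0

/-- The free unital complex *-algebra on a set `X` of generators: the free algebra on two copies
of `X`, the second copy consisting of the adjoints of the generators. -/
def FreeStarAlgebra (X : Type u) : Type u := FreeAlgebra ℂ (X ⊕ X)

namespace FreeStarAlgebra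

variable {X : Type u}

instance : Ring (FreeStarAlgebra X) := inferInstanceAs (Ring (FreeAlgebra ℂ (X ⊕ X)))
instance : Algebra ℂ (FreeStarAlgebra X) := inferInstanceAs (Algebra ℂ (FreeAlgebra ℂ (X ⊕ X)))

/-- The generators of the free *-algebra. -/
def gen (x : X) : FreeStarAlgebra X := FreeAlgebra.ι ℂ (Sum.inl x)

/-- The adjoints of the generators of the free *-algebra. -/
def genStar (x : X) : FreeStarAlgebra X := FreeAlgebra.ι ℂ (Sum.inr x)

theorem induction {C : FreeStarAlgebra X → Prop} (hc : ∀ c : ℂ, C (algebraMap ℂ _ c))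
    (hg : ∀ x, C (gen x)) (hs : ∀ x, C (genStar x)) (hm : ∀ a b, C a → C b → C (a * b))
    (ha : ∀ a b, C a → C b → C (a + b)) (a : FreeStarAlgebra X) : C a :=
  FreeAlgebra.induction ℂ (X ⊕ X) (motive := C) hc
    (fun x => by rcases x with x | x; exacts [hg x, hs x]) hm ha a

/-- The opposite of the free algebra with the conjugate complex algebra structure. -/
def ConjOp (X : Type u) : Type u := (FreeStarAlgebra X)ᵐᵒᵖ

instance : Ring (ConjOp X) := inferInstanceAs (Ring (FreeStarAlgebra X)ᵐᵒᵖ)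
instance : Algebra ℂ (ConjOp X) :=
  ((algebraMap ℂ (FreeStarAlgebra X)ᵐᵒᵖ).comp (starRingEnd ℂ)).toAlgebra'
    fun c x => Algebra.commutes (starRingEnd ℂ c) (show (FreeStarAlgebra X)ᵐᵒᵖ from x)

/-- The adjoint operation on the free *-algebra: the conjugate linear, antimultiplicative map
interchanging the generators with their adjoints. -/
def starHom (X : Type u) : FreeStarAlgebra X →+* (FreeStarAlgebra X)ᵐᵒᵖ :=
  (FreeAlgebra.lift ℂ (A := ConjOp X)
    fun x : X ⊕ X => show (FreeStarAlgebra X)ᵐᵒᵖ from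
      MulOpposite.op (FreeAlgebra.ι ℂ x.swap)).toRingHom

theorem starHom_gen (x : X) : starHom X (gen x) = MulOpposite.op (genStar x) :=
  FreeAlgebra.lift_ι_apply (A := ConjOp X) _ _

theorem starHom_genStar (x : X) : starHom X (genStar x) = MulOpposite.op (gen x) :=
  FreeAlgebra.lift_ι_apply (A := ConjOp X) _ _

theorem starHom_algebraMap (c : ℂ) :
    starHom X (algebraMap ℂ _ c) = MulOpposite.op (algebraMap ℂ _ (star c)) :=
  (FreeAlgebra.lift ℂ (A := ConjOp X) _).commutes c

instance : StarRing (FreeStarAlgebra X) where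
  star a := (starHom X a).unop
  star_involutive a := by
    induction a using induction with
    | hc c => simp [starHom_algebraMap]
    | hg x => simp [starHom_gen, starHom_genStar]
    | hs x => simp [starHom_gen, starHom_genStar]
    | hm a b ha hb => simp only [map_mul, MulOpposite.unop_mul]; exact congrArg₂ (· * ·) ha hb
    | ha a b ha hb => simp only [map_add, MulOpposite.unop_add]; exact congrArg₂ (· + ·) ha hb
  star_mul a b := by simp
  star_add a b := by simp

theorem star_gen (x : X) : star (gen x) = genStar x :=
  congrArg MulOpposite.unop (starHom_gen x)

instance : StarModule ℂ (FreeStarAlgebra X) where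
  star_smul c a := by
    have h : star (algebraMap ℂ (FreeStarAlgebra X) c) = algebraMap ℂ _ (star c) :=
      congrArg MulOpposite.unop (starHom_algebraMap c)
    rw [Algebra.smul_def, star_mul, h, Algebra.smul_def, Algebra.commutes]

end FreeStarAlgebra

/-- Relations for families `(s x)`, `x : X`, of elements of unital C*-algebras, such that the
norms of the members of such families are uniformly bounded. -/
structure CStarRelations (X : Type u) where
  Holds : ∀ (D : Type u) [CStarAlgebra D], (X → D) → Prop
  bounded : ∀ x, ∃ K : ℝ, ∀ (D : Type u) [CStarAlgebra D] (s : X → D), Holds D s → ‖s x‖ ≤ K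

namespace CStarRelations

variable {X : Type u} (R : CStarRelations X)

/-- The C*-seminorms `p` on the free *-algebra such that the generators satisfy the relations in
the C*-completion with respect to `p`. -/
def Admissible : Type u :=
  {p : CStarSeminorm (FreeStarAlgebra X) //
    R.Holds p.Completion fun x => p.coe (FreeStarAlgebra.gen x)}

theorem bddAbove (a : FreeStarAlgebra X) : BddAbove (Set.range fun p : R.Admissible => p.1 a) := by
  suffices h : ∃ K : ℝ, 0 ≤ K ∧ ∀ p : R.Admissible, p.1 a ≤ K by
    obtain ⟨K, -, hK⟩ := h
    exact ⟨K, by rintro _ ⟨p, rfl⟩; exact hK p⟩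
  have gen (x : X) : ∃ K : ℝ, 0 ≤ K ∧ ∀ p : R.Admissible, p.1 (FreeStarAlgebra.gen x) ≤ K := by
    obtain ⟨K, hK⟩ := R.bounded x
    refine ⟨|K|, abs_nonneg K, fun p => ?_⟩
    rw [← p.1.norm_coe]
    exact (hK _ _ p.2).trans (le_abs_self K)
  induction a using FreeStarAlgebra.induction with
  | hc c =>
    refine ⟨‖c‖, norm_nonneg c, fun p => ?_⟩
    have h1 : p.1 1 ≤ 1 := by
      have h := p.1.le_star_mul_self 1
      rw [star_one, mul_one] at h
      by_contra! h'
      nlinarith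
    rw [Algebra.algebraMap_eq_smul_one, p.1.smul_eq]
    exact mul_le_of_le_one_right (norm_nonneg c) h1
  | hg x => exact gen x
  | hs x => simpa only [← FreeStarAlgebra.star_gen, CStarSeminorm.star_eq] using gen x
  | hm a b ha hb =>
    obtain ⟨K, hK, ha⟩ := ha
    obtain ⟨M, hM, hb⟩ := hb
    exact ⟨K * M, mul_nonneg hK hM, fun p => (p.1.mul_le a b).trans
      (mul_le_mul (ha p) (hb p) (p.1.nonneg b) hK)⟩
  | ha a b ha hb =>
    obtain ⟨K, hK, ha⟩ := ha
    obtain ⟨M, hM, hb⟩ := hb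
    exact ⟨K + M, add_nonneg hK hM, fun p => (p.1.add_le a b).trans (add_le_add (ha p) (hb p))⟩

/-- The largest C*-seminorm on the free *-algebra compatible with the relations. -/
def seminorm : CStarSeminorm (FreeStarAlgebra X) :=
  CStarSeminorm.iSup (fun p : R.Admissible => p.1) R.bddAbove

/-- The universal unital C*-algebra generated by a family satisfying the relations. -/
def Universal : Type u := R.seminorm.Completion

instance : CStarAlgebra R.Universal := inferInstanceAs (CStarAlgebra R.seminorm.Completion)

/-- The generators of the universal unital C*-algebra. -/
def gen (x : X) : R.Universal := R.seminorm.coe (FreeStarAlgebra.gen x)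

end CStarRelations

section MinTensor

variable {A A' B B' : Type u} [NonUnitalCStarAlgebra A] [NonUnitalCStarAlgebra A']
  [NonUnitalCStarAlgebra B] [NonUnitalCStarAlgebra B']

/-- The *-ring structure on the algebraic tensor product of two *-algebras. -/
instance TensorProduct.instStarRingNonUnital : StarRing (A ⊗[ℂ] B) where
  star_mul x y :=
    x.induction_on (by simp) (fun _ _ ↦
      y.induction_on (by simp)
        fun _ _ ↦ by simp
      fun _ _ h₁ h₂ ↦ by simp [add_mul, mul_add, h₁, h₂])
    fun _ _ h₁ h₂ ↦ by simp [add_mul, mul_add, h₁, h₂]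
  star_add := by simp


/-- A pair of representations of the C*-algebras `A` and `B` on Hilbert spaces. -/
structure RepPair (A B : Type u) [NonUnitalCStarAlgebra A] [NonUnitalCStarAlgebra B] where
  H : Type u
  K : Type u
  [normedH : NormedAddCommGroup H]
  [innerH : InnerProductSpace ℂ H]
  [completeH : CompleteSpace H]
  [normedK : NormedAddCommGroup K]
  [innerK : InnerProductSpace ℂ K]
  [completeK : CompleteSpace K]
  left : A →⋆ₙₐ[ℂ] (H →L[ℂ] H)
  right : B →⋆ₙₐ[ℂ] (K →L[ℂ] K)

namespace RepPair

attribute [instance] normedH innerH completeH normedK innerK completeK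

/-- The operator `(π ⊗ ρ)(t)` on the (algebraic) tensor product of the Hilbert spaces of the
representations `π` and `ρ`, for `t` in the algebraic tensor product. -/
def op (r : RepPair A B) : A ⊗[ℂ] B →ₗ[ℂ] (r.H ⊗[ℂ] r.K →L[ℂ] r.H ⊗[ℂ] r.K) :=
  TensorProduct.lift <| LinearMap.mk₂ ℂ (fun a b => TensorProduct.mapL (r.left a) (r.right b))
    (fun a a' b => by rw [map_add, TensorProduct.mapL_add_left])
    (fun c a b => by rw [map_smul, TensorProduct.mapL_smul_left])
    (fun a b b' => by rw [map_add, TensorProduct.mapL_add_right])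
    (fun c a b => by rw [map_smul, TensorProduct.mapL_smul_right])

theorem op_tmul (r : RepPair A B) (a : A) (b : B) :
    r.op (a ⊗ₜ b) = TensorProduct.mapL (r.left a) (r.right b) := rfl

theorem op_mul (r : RepPair A B) (s t : A ⊗[ℂ] B) : r.op (s * t) = r.op s * r.op t := by
  induction s using TensorProduct.induction_on with
  | zero => simp
  | add s s' hs hs' => rw [add_mul, map_add, map_add, add_mul, hs, hs']
  | tmul a b =>
    induction t using TensorProduct.induction_on with
    | zero => simp
    | add t t' ht ht' => rw [mul_add, map_add, map_add, mul_add, ht, ht']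
    | tmul a' b' =>
      rw [Algebra.TensorProduct.tmul_mul_tmul, op_tmul, op_tmul, op_tmul, map_mul, map_mul,
        TensorProduct.mapL_mul]

theorem inner_op_star (r : RepPair A B) (t : A ⊗[ℂ] B) (v w : r.H ⊗[ℂ] r.K) :
    inner ℂ (r.op (star t) v) w = inner ℂ v (r.op t w) := by
  induction t using TensorProduct.induction_on with
  | zero => simp
  | add s t hs ht => rw [star_add, map_add, map_add, add_apply,
      add_apply, inner_add_left, inner_add_right, hs, ht]
  | tmul a b =>
    induction v using TensorProduct.induction_on with
    | zero => simp
    | add v v' hv hv' => rw [map_add, inner_add_left, inner_add_left, hv, hv']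
    | tmul h k =>
      induction w using TensorProduct.induction_on with
      | zero => simp
      | add w w' hw hw' => rw [map_add, inner_add_right, inner_add_right, hw, hw']
      | tmul h' k' =>
        rw [TensorProduct.star_tmul, op_tmul, op_tmul, TensorProduct.mapL_tmul,
          TensorProduct.mapL_tmul, TensorProduct.inner_tmul, TensorProduct.inner_tmul,
          map_star, map_star, ContinuousLinearMap.star_eq_adjoint,
          ContinuousLinearMap.star_eq_adjoint, ContinuousLinearMap.adjoint_inner_left,
          ContinuousLinearMap.adjoint_inner_left]

/-- The C*-seminorm `t ↦ ‖(π ⊗ ρ)(t)‖`. -/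
def seminorm (r : RepPair A B) : CStarSeminorm (A ⊗[ℂ] B) where
  __ := Seminorm.ofSMulLE (fun t => ‖r.op t‖) (by rw [map_zero]; exact ContinuousLinearMap.opNorm_zero)
    (fun s t => by rw [map_add]; exact norm_add_le (r.op s) (r.op t))
    (fun c t => by rw [map_smul]; exact ContinuousLinearMap.opNorm_smul_le c (r.op t))
  mul_le' s t := by
    change ‖r.op (s * t)‖ ≤ ‖r.op s‖ * ‖r.op t‖
    rw [op_mul]
    exact norm_mul_le (r.op s) (r.op t)
  le_star_mul_self' t := by
    change ‖r.op t‖ * ‖r.op t‖ ≤ ‖r.op (star t * t)‖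
    have h : ‖r.op t‖ ≤ √‖r.op (star t * t)‖ := by
      refine ContinuousLinearMap.opNorm_le_bound _ (Real.sqrt_nonneg _) fun v => ?_
      refine le_of_sq_le_sq ?_ (by positivity)
      rw [mul_pow, Real.sq_sqrt (norm_nonneg (r.op (star t * t))), ← inner_self_eq_norm_sq (𝕜 := ℂ),
        ← inner_op_star, ← mul_apply_eq_comp, ← op_mul]
      calc RCLike.re (inner ℂ (r.op (star t * t) v) v)
          ≤ ‖r.op (star t * t) v‖ * ‖v‖ := re_inner_le_norm (𝕜 := ℂ) (r.op (star t * t) v) v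
        _ ≤ (‖r.op (star t * t)‖ * ‖v‖) * ‖v‖ := by
          gcongr
          exact ContinuousLinearMap.le_opNorm _ _
        _ = ‖r.op (star t * t)‖ * ‖v‖ ^ 2 := by ring
    calc ‖r.op t‖ * ‖r.op t‖ ≤ √‖r.op (star t * t)‖ * √‖r.op (star t * t)‖ :=
          mul_le_mul h h (norm_nonneg (r.op t)) (Real.sqrt_nonneg _)
      _ = _ := Real.mul_self_sqrt (norm_nonneg (r.op (star t * t)))

theorem seminorm_apply (r : RepPair A B) (t : A ⊗[ℂ] B) : r.seminorm t = ‖r.op t‖ := rfl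

theorem bddAbove (t : A ⊗[ℂ] B) : BddAbove (Set.range fun r : RepPair A B => r.seminorm t) := by
  induction t using TensorProduct.induction_on with
  | zero => exact ⟨0, by rintro _ ⟨r, rfl⟩; exact r.seminorm.zero_eq.le⟩
  | tmul a b =>
    refine ⟨‖a‖ * ‖b‖, ?_⟩
    rintro _ ⟨r, rfl⟩
    exact (TensorProduct.norm_mapL_le _ _).trans
      (mul_le_mul (NonUnitalStarAlgHom.norm_apply_le r.left a)
        (NonUnitalStarAlgHom.norm_apply_le r.right b) (norm_nonneg _) (norm_nonneg _))
  | add s t hs ht =>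
    obtain ⟨K, hK⟩ := hs
    obtain ⟨M, hM⟩ := ht
    refine ⟨K + M, ?_⟩
    rintro _ ⟨r, rfl⟩
    exact (r.seminorm.add_le s t).trans (add_le_add (hK ⟨r, rfl⟩) (hM ⟨r, rfl⟩))

end RepPair

/-- The minimal (spatial) C*-norm on the algebraic tensor product:
`‖t‖ = sup ‖(π ⊗ ρ)(t)‖` over all representations `π` of `A` and `ρ` of `B`. -/
def minSeminorm (A B : Type u) [NonUnitalCStarAlgebra A] [NonUnitalCStarAlgebra B] :
    CStarSeminorm (A ⊗[ℂ] B) :=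
  CStarSeminorm.iSup (fun r : RepPair A B => r.seminorm) RepPair.bddAbove

/-- The minimal tensor product of two C*-algebras. -/
def MinTensor (A B : Type u) [NonUnitalCStarAlgebra A] [NonUnitalCStarAlgebra B] : Type u :=
  (minSeminorm A B).Completion

instance : NonUnitalCStarAlgebra (MinTensor A B) :=
  inferInstanceAs (NonUnitalCStarAlgebra (minSeminorm A B).Completion)

namespace MinTensor

/-- The canonical *-homomorphism from the algebraic to the minimal tensor product. -/
def incl (A B : Type u) [NonUnitalCStarAlgebra A] [NonUnitalCStarAlgebra B] :
    A ⊗[ℂ] B →⋆ₙₐ[ℂ] MinTensor A B :=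
  (minSeminorm A B).coeHom

theorem norm_op_le (r : RepPair A B) (t : A ⊗[ℂ] B) : ‖r.op t‖ ≤ minSeminorm A B t :=
  le_ciSup (RepPair.bddAbove t) r

theorem minSeminorm_le (t : A ⊗[ℂ] B) {K : ℝ} (hK : 0 ≤ K)
    (h : ∀ r : RepPair A B, ‖r.op t‖ ≤ K) : minSeminorm A B t ≤ K :=
  Real.iSup_le h hK

/-- The tensor product of two *-homomorphisms on algebraic tensor products. -/
def mapAlg (f : A →⋆ₙₐ[ℂ] A') (g : B →⋆ₙₐ[ℂ] B') : A ⊗[ℂ] B →⋆ₙₐ[ℂ] A' ⊗[ℂ] B' where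
  __ := TensorProduct.map (f : A →ₗ[ℂ] A') (g : B →ₗ[ℂ] B')
  map_zero' := map_zero (TensorProduct.map (f : A →ₗ[ℂ] A') (g : B →ₗ[ℂ] B'))
  map_mul' s t := by
    change TensorProduct.map (f : A →ₗ[ℂ] A') (g : B →ₗ[ℂ] B') (s * t) =
      TensorProduct.map (f : A →ₗ[ℂ] A') (g : B →ₗ[ℂ] B') s *
        TensorProduct.map (f : A →ₗ[ℂ] A') (g : B →ₗ[ℂ] B') t
    induction s using TensorProduct.induction_on with
    | zero => simp
    | add s s' hs hs' => rw [add_mul, map_add, map_add, add_mul, hs, hs']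
    | tmul a b =>
      induction t using TensorProduct.induction_on with
      | zero => simp
      | add t t' ht ht' => rw [mul_add, map_add, map_add, mul_add, ht, ht']
      | tmul a' b' => simp
  map_star' t := by
    change TensorProduct.map (f : A →ₗ[ℂ] A') (g : B →ₗ[ℂ] B') (star t) =
      star (TensorProduct.map (f : A →ₗ[ℂ] A') (g : B →ₗ[ℂ] B') t)
    induction t using TensorProduct.induction_on with
    | zero => simp
    | add t t' ht ht' => rw [star_add, map_add, map_add, star_add, ht, ht']
    | tmul a b => simp [map_star]

/-- The pull back of a pair of representations along *-homomorphisms. -/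
def _root_.RepPair.comp (r : RepPair A' B') (f : A →⋆ₙₐ[ℂ] A') (g : B →⋆ₙₐ[ℂ] B') :
    RepPair A B where
  H := r.H
  K := r.K
  left := r.left.comp f
  right := r.right.comp g

theorem op_mapAlg (r : RepPair A' B') (f : A →⋆ₙₐ[ℂ] A') (g : B →⋆ₙₐ[ℂ] B') (t : A ⊗[ℂ] B) :
    r.op (mapAlg f g t) = (r.comp f g).op t := by
  induction t using TensorProduct.induction_on with
  | zero => rw [map_zero, map_zero, map_zero]; rfl
  | add t t' ht ht' => rw [map_add, map_add, ht, ht', map_add]; rfl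
  | tmul a b => rfl

/-- The tensor product `f ⊗ g` of two *-homomorphisms on minimal tensor products. -/
def map (f : A →⋆ₙₐ[ℂ] A') (g : B →⋆ₙₐ[ℂ] B') : MinTensor A B →⋆ₙₐ[ℂ] MinTensor A' B' :=
  (minSeminorm A B).lift ((incl A' B').comp (mapAlg f g)) fun t => by
    change ‖(minSeminorm A' B').coe (mapAlg f g t)‖ ≤ _
    rw [CStarSeminorm.norm_coe]
    refine minSeminorm_le _ (CStarSeminorm.nonneg _ _) fun r => ?_
    rw [op_mapAlg]
    exact norm_op_le _ t

/-- Left multiplication by `1 ⊗ b` on the minimal tensor product `A ⊗ B`. -/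
def mulLeftRight (b : B) : MinTensor A B →L[ℂ] MinTensor A B :=
  (minSeminorm A B).extendL
    ((incl A B : A ⊗[ℂ] B →ₗ[ℂ] MinTensor A B) ∘ₗ
      TensorProduct.map LinearMap.id (LinearMap.mulLeft ℂ b)) ‖b‖ fun t => by
    change ‖(minSeminorm A B).coe (TensorProduct.map LinearMap.id (LinearMap.mulLeft ℂ b) t)‖ ≤ _
    rw [CStarSeminorm.norm_coe]
    refine minSeminorm_le _ (mul_nonneg (norm_nonneg b) (CStarSeminorm.nonneg _ _)) fun r => ?_
    have h : r.op (TensorProduct.map LinearMap.id (LinearMap.mulLeft ℂ b) t) =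
        TensorProduct.mapL (ContinuousLinearMap.id ℂ r.H) (r.right b) * r.op t := by
      induction t using TensorProduct.induction_on with
      | zero => simp
      | add t t' ht ht' => rw [map_add, map_add, ht, ht', map_add, mul_add]
      | tmul a c =>
        rw [TensorProduct.map_tmul, RepPair.op_tmul, RepPair.op_tmul, ← TensorProduct.mapL_mul]
        simp only [LinearMap.id_apply, LinearMap.mulLeft_apply, map_mul]
        rfl
    rw [h]
    refine (norm_mul_le (TensorProduct.mapL (ContinuousLinearMap.id ℂ r.H) (r.right b))
      (r.op t)).trans ?_
    refine mul_le_mul ?_ (norm_op_le r t) (norm_nonneg (r.op t)) (norm_nonneg b)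
    refine (TensorProduct.norm_mapL_le _ _).trans ?_
    refine (mul_le_mul ContinuousLinearMap.norm_id_le
      (NonUnitalStarAlgHom.norm_apply_le r.right b) (norm_nonneg _) zero_le_one).trans ?_
    rw [one_mul]

end MinTensor
end MinTensor

section QuantumSpace

/-- A faithful state on a unital C*-algebra. -/
structure FaithfulState (B : Type u) [CStarAlgebra B] where
  toLin : B →ₗ[ℂ] ℂ
  nonneg : ∀ b, 0 ≤ toLin (star b * b)
  map_one : toLin 1 = 1
  faithful : ∀ b, toLin (star b * b) = 0 → b = 0

namespace FaithfulState

variable {B : Type u} [CStarAlgebra B] (ψ : FaithfulState B)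

theorem conj_apply (b c : B) : starRingEnd ℂ (ψ.toLin (star b * c)) = ψ.toLin (star c * b) := by
  have im (a : B) : (ψ.toLin (star a * a)).im = 0 := (Complex.nonneg_iff.mp (ψ.nonneg a)).2.symm
  have h1 := im (b + c)
  have h2 := im (b + Complex.I • c)
  have hb := im b
  have hc := im c
  simp only [star_add, star_smul, add_mul, mul_add, smul_mul_assoc, mul_smul_comm, map_add,
    map_smul, smul_eq_mul, Complex.add_im, Complex.mul_im, Complex.mul_re, Complex.I_re,
    Complex.I_im, RCLike.star_def, Complex.conj_I, Complex.neg_re, Complex.neg_im] at h1 h2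
  rw [hb, hc] at h1 h2
  apply Complex.ext
  · rw [Complex.conj_re]; linarith
  · rw [Complex.conj_im]; linarith

/-- The Hilbert space `L²(B, ψ)`: the vector space `B` with inner product `⟪x, y⟫ = ψ(x* y)`. -/
def L2 (_ψ : FaithfulState B) : Type u := B

instance : AddCommGroup ψ.L2 := inferInstanceAs (AddCommGroup B)
instance : Module ℂ ψ.L2 := inferInstanceAs (Module ℂ B)
instance [FiniteDimensional ℂ B] : FiniteDimensional ℂ ψ.L2 :=
  inferInstanceAs (FiniteDimensional ℂ B)

/-- The identity map `B → L²(B, ψ)`. -/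
def toL2 : B ≃ₗ[ℂ] ψ.L2 := LinearEquiv.refl ℂ B

/-- The inner product `⟪x, y⟫ = ψ(x* y)`. -/
@[reducible]
def core : InnerProductSpace.Core ℂ ψ.L2 where
  inner x y := ψ.toLin (star (ψ.toL2.symm x) * ψ.toL2.symm y)
  conj_inner_symm x y := ψ.conj_apply _ _
  re_inner_nonneg x := (Complex.nonneg_iff.mp (ψ.nonneg (ψ.toL2.symm x))).1
  add_left x y z := by rw [map_add, star_add, add_mul, map_add]
  smul_left x y c := by
    rw [map_smul, star_smul, smul_mul_assoc, map_smul, smul_eq_mul, RCLike.star_def]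
  definite x h := ψ.toL2.symm.map_eq_zero_iff.mp (ψ.faithful _ h)

instance : NormedAddCommGroup ψ.L2 := ψ.core.toNormedAddCommGroup
instance : InnerProductSpace ℂ ψ.L2 := InnerProductSpace.ofCore ψ.core.toCore

theorem inner_toL2 (x y : B) : inner ℂ (ψ.toL2 x) (ψ.toL2 y) = ψ.toLin (star x * y) := rfl

/-- The multiplication of `B` as an operator `L²(B) ⊗ L²(B) → L²(B)`. -/
def mulL2 : ψ.L2 ⊗[ℂ] ψ.L2 →ₗ[ℂ] ψ.L2 :=
  ψ.toL2.toLinearMap ∘ₗ LinearMap.mul' ℂ B ∘ₗ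
    TensorProduct.map ψ.toL2.symm.toLinearMap ψ.toL2.symm.toLinearMap

variable [FiniteDimensional ℂ B]

/-- The Hilbert space adjoint `m* : B → B ⊗ B` of the multiplication map. -/
def comul : B →ₗ[ℂ] B ⊗[ℂ] B :=
  TensorProduct.map ψ.toL2.symm.toLinearMap ψ.toL2.symm.toLinearMap ∘ₗ
    LinearMap.adjoint ψ.mulL2 ∘ₗ ψ.toL2.toLinearMap

/-- An orthonormal basis of `L²(B, ψ)`. -/
def onb : OrthonormalBasis (Fin (Module.finrank ℂ ψ.L2)) ℂ ψ.L2 := stdOrthonormalBasis ℂ ψ.L2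

/-- The elements of `B` forming the orthonormal basis. -/
def e (k : Fin (Module.finrank ℂ ψ.L2)) : B := ψ.toL2.symm (ψ.onb k)

theorem sum_e (b : B) : ∑ k, ψ.toLin (star (ψ.e k) * b) • ψ.e k = b := by
  have h := congrArg ψ.toL2.symm (ψ.onb.sum_repr' (ψ.toL2 b))
  simp only [map_sum, map_smul, LinearEquiv.symm_apply_apply] at h
  exact h

theorem comul_mul (x y : B) :
    ψ.comul (x * y) = ∑ k, (x * ψ.e k) ⊗ₜ[ℂ] (star (ψ.e k) * y) := by
  let T := TensorProduct.congr ψ.toL2 ψ.toL2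
  apply T.injective
  have h1 : T (ψ.comul (x * y)) = LinearMap.adjoint ψ.mulL2 (ψ.toL2 (x * y)) := by
    change T (T.symm _) = _
    rw [LinearEquiv.apply_symm_apply]
    rfl
  rw [h1]
  refine ext_inner_right ℂ fun z => ?_
  rw [LinearMap.adjoint_inner_left]
  induction z using TensorProduct.induction_on with
  | zero => simp
  | add z z' h h' => rw [map_add, inner_add_right, inner_add_right, h, h']
  | tmul c d =>
    obtain ⟨c, rfl⟩ := ψ.toL2.surjective c
    obtain ⟨d, rfl⟩ := ψ.toL2.surjective d
    have h2 : T (∑ k, (x * ψ.e k) ⊗ₜ[ℂ] (star (ψ.e k) * y)) =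
        ∑ k, ψ.toL2 (x * ψ.e k) ⊗ₜ[ℂ] ψ.toL2 (star (ψ.e k) * y) := by
      rw [map_sum]; rfl
    have h3 : ψ.mulL2 (ψ.toL2 c ⊗ₜ ψ.toL2 d) = ψ.toL2 (c * d) := rfl
    rw [h2, h3, inner_toL2, sum_inner]
    simp only [TensorProduct.inner_tmul, inner_toL2, star_mul, star_star]
    have h4 := ψ.sum_e (star x * c)
    calc ψ.toLin (star y * star x * (c * d))
        = ψ.toLin (star y * (star x * c) * d) := by simp only [mul_assoc]
      _ = ψ.toLin (star y * (∑ k, ψ.toLin (star (ψ.e k) * (star x * c)) • ψ.e k) * d) := by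
          rw [h4]
      _ = _ := by
          simp only [Finset.mul_sum, Finset.sum_mul, map_sum, mul_smul_comm, smul_mul_assoc,
            map_smul, smul_eq_mul, mul_assoc]

end FaithfulState

/-- `ψ` is a `δ`-form if `m m* = δ² id`. -/
def IsDeltaForm {B : Type u} [CStarAlgebra B] [FiniteDimensional ℂ B] (ψ : FaithfulState B)
    (δ : ℝ) : Prop :=
  LinearMap.mul' ℂ B ∘ₗ ψ.comul = ((δ : ℂ) ^ 2) • LinearMap.id

/-- A directed quantum graph `(B, ψ, A)`: a finite-dimensional C*-algebra `B`, a `δ`-form `ψ` on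
`B`, and a linear map `A` on `L²(B, ψ)` (that is, on `B`) with `m (A ⊗ A) m* = δ² A`. -/
structure DirectedQuantumGraph where
  B : Type u
  [cstar : CStarAlgebra B]
  [finite : FiniteDimensional ℂ B]
  ψ : FaithfulState B
  δ : ℝ
  δ_pos : 0 < δ
  isDeltaForm : IsDeltaForm ψ δ
  A : B →ₗ[ℂ] B
  adjacency : LinearMap.mul' ℂ B ∘ₗ TensorProduct.map A A ∘ₗ ψ.comul = ((δ : ℂ) ^ 2) • A

attribute [instance] DirectedQuantumGraph.cstar DirectedQuantumGraph.finite

end QuantumSpace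

section Linear

variable {B : Type u} [CStarAlgebra B] [FiniteDimensional ℂ B] (ψ : FaithfulState B)

/-- The linear `E`-valued map on `B` with prescribed values on the orthonormal basis `ψ.e`. -/
def FaithfulState.linExt {E : Type v} [AddCommGroup E] [Module ℂ E]
    (t : Fin (Module.finrank ℂ ψ.L2) → E) : B →ₗ[ℂ] E :=
  ∑ k, (ψ.toLin ∘ₗ LinearMap.mulLeft ℂ (star (ψ.e k))).smulRight (t k)

theorem FaithfulState.linExt_apply {E : Type v} [AddCommGroup E] [Module ℂ E]
    (t : Fin (Module.finrank ℂ ψ.L2) → E) (b : B) :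
    ψ.linExt t b = ∑ k, ψ.toLin (star (ψ.e k) * b) • t k := by
  simp [linExt]

theorem FaithfulState.linExt_e {E : Type v} [AddCommGroup E] [Module ℂ E]
    (t : Fin (Module.finrank ℂ ψ.L2) → E) (k : Fin (Module.finrank ℂ ψ.L2)) :
    ψ.linExt t (ψ.e k) = t k := by
  have h (l : Fin (Module.finrank ℂ ψ.L2)) :
      ψ.toLin (star (ψ.e l) * ψ.e k) = if l = k then 1 else 0 :=
    orthonormal_iff_ite.mp ψ.onb.orthonormal l k
  simp [linExt_apply, h]

end Linear

/-- The linear map `s*(b) = s(b*)*`. -/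
def conjMap {B D : Type u} [NonUnitalCStarAlgebra B] [NonUnitalCStarAlgebra D] (s : B →ₗ[ℂ] D) :
    B →ₗ[ℂ] D where
  toFun b := star (s (star b))
  map_add' := by simp
  map_smul' := by simp

/-- A quantum Cuntz-Krieger family for the directed quantum graph `𝒢` in a C*-algebra `D`:
`μ (id ⊗ μ) (s ⊗ s* ⊗ s) (id ⊗ m*) m* = s` and `μ (s* ⊗ s) m* = μ (s ⊗ s*) m* A`, where `μ` is the
multiplication of `D`. -/
structure IsCKFamily (𝒢 : DirectedQuantumGraph.{u}) {D : Type u} [NonUnitalCStarAlgebra D]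
    (s : 𝒢.B →ₗ[ℂ] D) : Prop where
  partialIsometry :
    LinearMap.mul' ℂ D ∘ₗ TensorProduct.map LinearMap.id (LinearMap.mul' ℂ D) ∘ₗ
      TensorProduct.map s (TensorProduct.map (conjMap s) s) ∘ₗ
      TensorProduct.map LinearMap.id 𝒢.ψ.comul ∘ₗ 𝒢.ψ.comul = s
  cuntzKrieger :
    LinearMap.mul' ℂ D ∘ₗ TensorProduct.map (conjMap s) s ∘ₗ 𝒢.ψ.comul =
      LinearMap.mul' ℂ D ∘ₗ TensorProduct.map s (conjMap s) ∘ₗ 𝒢.ψ.comul ∘ₗ 𝒢.A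

/-- A partial isometry in a C*-algebra has norm at most one. -/
theorem norm_le_one_of_partialIsometry {D : Type u} [NonUnitalCStarAlgebra D] (z : D)
    (h : z * (star z * z) = z) : ‖z‖ ≤ 1 := by
  have h1 : ‖star z * z‖ = ‖z‖ * ‖z‖ := CStarRing.norm_star_mul_self
  have h2 : (star z * z) * (star z * z) = star z * z := by rw [mul_assoc, h]
  have h3 : ‖(star z * z) * (star z * z)‖ = ‖star z * z‖ * ‖star z * z‖ :=
    (IsSelfAdjoint.star_mul_self z).norm_mul_self.trans (sq _)
  rw [h2, h1] at h3
  have h4 := norm_nonneg z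
  by_contra! h5
  have h6 : 1 < ‖z‖ * ‖z‖ := by nlinarith
  nlinarith

theorem IsCKFamily.norm_le {𝒢 : DirectedQuantumGraph.{u}} {D : Type u} [NonUnitalCStarAlgebra D]
    {s : 𝒢.B →ₗ[ℂ] D} (hs : IsCKFamily 𝒢 s) (a b : Fin (Module.finrank ℂ 𝒢.ψ.L2)) :
    ‖s (star (𝒢.ψ.e a) * 𝒢.ψ.e b)‖ ≤ 1 := by
  let _ : PartialOrder D := CStarAlgebra.spectralOrder D
  let _ : StarOrderedRing D := CStarAlgebra.spectralOrderedRing D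
  let Z : CStarMatrix (Fin (Module.finrank ℂ 𝒢.ψ.L2)) (Fin (Module.finrank ℂ 𝒢.ψ.L2)) D :=
    CStarMatrix.ofMatrix fun a b => s (star (𝒢.ψ.e a) * 𝒢.ψ.e b)
  have hZ (a b) : Z a b = s (star (𝒢.ψ.e a) * 𝒢.ψ.e b) := rfl
  have h : Z * (star Z * Z) = Z := by
    ext a b
    have h1 := LinearMap.congr_fun hs.partialIsometry (star (𝒢.ψ.e a) * 𝒢.ψ.e b)
    simp only [LinearMap.comp_apply, FaithfulState.comul_mul, map_sum, TensorProduct.map_tmul,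
      LinearMap.id_apply, LinearMap.mul'_apply] at h1
    simp only [CStarMatrix.mul_apply, CStarMatrix.star_apply, hZ, ← h1]
    refine Finset.sum_congr rfl fun k _ => ?_
    refine congrArg _ (Finset.sum_congr rfl fun l _ => ?_)
    change _ = star (s (star (star (𝒢.ψ.e k) * 𝒢.ψ.e l))) * _
    rw [star_mul, star_star]
  exact (CStarMatrix.norm_entry_le_norm (M := Z) (i := a) (j := b)).trans
    (norm_le_one_of_partialIsometry Z h)

namespace DirectedQuantumGraph

variable (𝒢 : DirectedQuantumGraph.{u})

/-- The quantum Cuntz-Krieger relations, for the values `t k = s (e k)` of a linear map `s` on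
an orthonormal basis. -/
def ckRelations : CStarRelations (ULift.{u} (Fin (Module.finrank ℂ 𝒢.ψ.L2))) where
  Holds D _ t := IsCKFamily 𝒢 (𝒢.ψ.linExt fun k => t ⟨k⟩)
  bounded k := by
    obtain ⟨k⟩ := k
    refine ⟨∑ a, ∑ b, ‖𝒢.ψ.toLin (star (𝒢.ψ.e a) * 1)‖ * ‖𝒢.ψ.toLin (star (𝒢.ψ.e b) * 𝒢.ψ.e k)‖,
      fun D _ t h => ?_⟩
    have h1 : 𝒢.ψ.e k = ∑ a, ∑ b, (starRingEnd ℂ (𝒢.ψ.toLin (star (𝒢.ψ.e a) * 1)) *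
        𝒢.ψ.toLin (star (𝒢.ψ.e b) * 𝒢.ψ.e k)) • (star (𝒢.ψ.e a) * 𝒢.ψ.e b) := by
      have h2 := congrArg star (𝒢.ψ.sum_e 1)
      have h3 := 𝒢.ψ.sum_e (𝒢.ψ.e k)
      rw [star_one, star_sum] at h2
      calc 𝒢.ψ.e k = 1 * 𝒢.ψ.e k := (one_mul _).symm
        _ = (∑ a, star (𝒢.ψ.toLin (star (𝒢.ψ.e a) * 1) • 𝒢.ψ.e a)) *
            ∑ b, 𝒢.ψ.toLin (star (𝒢.ψ.e b) * 𝒢.ψ.e k) • 𝒢.ψ.e b := by rw [h2, h3]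
        _ = _ := by
          simp only [Finset.sum_mul_sum, star_smul, smul_mul_smul_comm, RCLike.star_def]
    have h4 : t ⟨k⟩ = 𝒢.ψ.linExt (fun k => t ⟨k⟩) (𝒢.ψ.e k) := 
      (𝒢.ψ.linExt_e (fun k => t ⟨k⟩) k).symm
    have h5 := congrArg (𝒢.ψ.linExt fun k => t ⟨k⟩) h1
    simp only [map_sum, map_smul] at h5
    rw [h4, h5]
    refine (norm_sum_le _ _).trans (Finset.sum_le_sum fun a _ => ?_)
    refine (norm_sum_le _ _).trans (Finset.sum_le_sum fun b _ => ?_)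
    refine (norm_smul_le _ _).trans ?_
    rw [norm_mul, RCLike.norm_conj]
    refine mul_le_of_le_one_right ?_ (h.norm_le a b)
    positivity

/-- The universal quantum Cuntz-Krieger family in a unital C*-algebra. -/
def unitalS : 𝒢.B →ₗ[ℂ] 𝒢.ckRelations.Universal := 𝒢.ψ.linExt fun k => 𝒢.ckRelations.gen ⟨k⟩

/-- The C*-subalgebra generated by the universal quantum Cuntz-Krieger family in a unital
C*-algebra. -/
def foSubalgebra : NonUnitalStarSubalgebra ℂ 𝒢.ckRelations.Universal :=
  (NonUnitalStarAlgebra.adjoin ℂ (Set.range 𝒢.unitalS)).topologicalClosure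

/-- The quantum Cuntz-Krieger algebra: the universal (not necessarily unital) C*-algebra generated
by a quantum Cuntz-Krieger `𝒢`-family `S`.  It is obtained as the closed *-subalgebra generated by
the universal family in a unital C*-algebra; every family in a C*-algebra `D` is a family in the
unitization of `D`, so that the subalgebra is universal for families in arbitrary C*-algebras. -/
def FO : Type u := 𝒢.foSubalgebra

instance : NonUnitalCStarAlgebra 𝒢.FO :=
  NonUnitalStarSubalgebra.nonUnitalCStarAlgebra 
    (S := NonUnitalStarSubalgebra ℂ 𝒢.ckRelations.Universal) 𝒢.foSubalgebra
    (h_closed := NonUnitalStarSubalgebra.isClosed_topologicalClosure _)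

/-- The universal quantum Cuntz-Krieger family `S : B → FO(𝒢)`. -/
def S : 𝒢.B →ₗ[ℂ] 𝒢.FO where
  toFun b := ⟨𝒢.unitalS b, NonUnitalStarSubalgebra.le_topologicalClosure _
    (NonUnitalStarAlgebra.subset_adjoin ℂ _ ⟨b, rfl⟩)⟩
  map_add' b c := Subtype.ext (map_add 𝒢.unitalS b c)
  map_smul' c b := Subtype.ext (map_smul 𝒢.unitalS c b)

end DirectedQuantumGraph

section Linking

variable (𝒢' 𝒢 : DirectedQuantumGraph.{u})

/-- The linear map `β : B → B' ⊗ D` with `β (e m) = ∑ n, f n ⊗ u (n, m)`, for the orthonormal bases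
`e` of `L²(B)` and `f` of `L²(B')`. -/
def coaction {D : Type u} [CStarAlgebra D]
    (u : Fin (Module.finrank ℂ 𝒢'.ψ.L2) → Fin (Module.finrank ℂ 𝒢.ψ.L2) → D) :
    𝒢.B →ₗ[ℂ] 𝒢'.B ⊗[ℂ] D :=
  𝒢.ψ.linExt fun m => ∑ n, 𝒢'.ψ.e n ⊗ₜ[ℂ] u n m

/-- The map `φ ⊗ id : B ⊗ D → D` for a linear functional `φ`. -/
def sliceLeft {B D : Type u} [CStarAlgebra B] [CStarAlgebra D] (φ : B →ₗ[ℂ] ℂ) : B ⊗[ℂ] D →ₗ[ℂ] D :=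
  (TensorProduct.lid ℂ D).toLinearMap ∘ₗ TensorProduct.map φ LinearMap.id

/-- The defining relations of the linking algebra `O(G⁺(𝒢', 𝒢))` for the matrix `u` of coefficients
of `β : B → B' ⊗ D`: the map `β` is a unital *-homomorphism with `(ψ' ⊗ id) β = ψ(·) 1` and
`(A' ⊗ id) β = β A`, and the matrix `u` is unitary.  (Unitarity of `u` amounts to compatibility of
`β` with the adjoints `m*` of the multiplications of `B` and `B'`.) -/
structure IsLinking {D : Type u} [CStarAlgebra D]
    (u : Fin (Module.finrank ℂ 𝒢'.ψ.L2) → Fin (Module.finrank ℂ 𝒢.ψ.L2) → D) : Prop where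
  map_one : coaction 𝒢' 𝒢 u 1 = 1 ⊗ₜ 1
  map_mul : ∀ b c, coaction 𝒢' 𝒢 u (b * c) = coaction 𝒢' 𝒢 u b * coaction 𝒢' 𝒢 u c
  map_star : ∀ b, coaction 𝒢' 𝒢 u (star b) = star (coaction 𝒢' 𝒢 u b)
  state : ∀ b, sliceLeft 𝒢'.ψ.toLin (coaction 𝒢' 𝒢 u b) = 𝒢.ψ.toLin b • (1 : D)
  adjacency : ∀ b, TensorProduct.map 𝒢'.A LinearMap.id (coaction 𝒢' 𝒢 u b) =
    coaction 𝒢' 𝒢 u (𝒢.A b)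
  star_mul_self : ∀ m m', ∑ n, star (u n m) * u n m' = if m = m' then 1 else 0
  mul_star_self : ∀ n n', ∑ m, u n m * star (u n' m) = if n = n' then 1 else 0

theorem IsLinking.norm_le {D : Type u} [CStarAlgebra D]
    {u : Fin (Module.finrank ℂ 𝒢'.ψ.L2) → Fin (Module.finrank ℂ 𝒢.ψ.L2) → D}
    (h : IsLinking 𝒢' 𝒢 u) (n : Fin (Module.finrank ℂ 𝒢'.ψ.L2))
    (m : Fin (Module.finrank ℂ 𝒢.ψ.L2)) : ‖u n m‖ ≤ 1 := by
  let _ : PartialOrder D := CStarAlgebra.spectralOrder D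
  let _ : StarOrderedRing D := CStarAlgebra.spectralOrderedRing D
  have h1 : star (u n m) * u n m ≤ 1 := by
    have h2 := h.star_mul_self m m
    rw [if_pos rfl] at h2
    rw [← h2]
    exact Finset.single_le_sum (f := fun n => star (u n m) * u n m)
      (fun k _ => _root_.star_mul_self_nonneg (u k m)) (Finset.mem_univ n)
  have h3 := CStarAlgebra.norm_le_norm_of_nonneg_of_le (_root_.star_mul_self_nonneg (u n m)) h1
  have h4 : ‖(1 : D)‖ ≤ 1 := by
    refine norm_le_one_of_partialIsometry 1 ?_
    rw [star_one, mul_one, mul_one]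
  rw [CStarRing.norm_star_mul_self] at h3
  have h5 := norm_nonneg (u n m)
  by_contra! h6
  nlinarith

/-- The defining relations of `C(G⁺(𝒢', 𝒢))`. -/
def linkRelations : CStarRelations
    (ULift.{u} (Fin (Module.finrank ℂ 𝒢'.ψ.L2) × Fin (Module.finrank ℂ 𝒢.ψ.L2))) where
  Holds _ _ t := IsLinking 𝒢' 𝒢 fun n m => t ⟨(n, m)⟩
  bounded x := ⟨1, fun _ _ _ h => h.norm_le 𝒢' 𝒢 x.down.1 x.down.2⟩

/-- The C*-algebra `C(G⁺(𝒢', 𝒢))`, the universal enveloping C*-algebra of the linking algebra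
`O(G⁺(𝒢', 𝒢))`, that is, the universal unital C*-algebra generated by the coefficients of a unital
*-homomorphism `β : B → B' ⊗ C(G⁺(𝒢', 𝒢))` satisfying the relations of `IsLinking`.  For `𝒢' = 𝒢`
it is the algebra `C(G⁺(𝒢))` of the quantum automorphism group of `𝒢`. -/
abbrev CLink : Type u := (linkRelations 𝒢' 𝒢).Universal

/-- The canonical map `β : B → B' ⊗ C(G⁺(𝒢', 𝒢))`. -/
def linkingMap : 𝒢.B →ₗ[ℂ] 𝒢'.B ⊗[ℂ] CLink 𝒢' 𝒢 :=
  coaction 𝒢' 𝒢 fun n m => (linkRelations 𝒢' 𝒢).gen ⟨(n, m)⟩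

end Linking

section QuantumGroup

open MinTensor

/-- The graph of the canonical isomorphism `(A ⊗ B) ⊗ C ≃ A ⊗ (B ⊗ C)` of minimal tensor products,
that is, the closure of the graph of the associativity isomorphism of algebraic tensor products. -/
def assocGraph (A B C : Type u) [NonUnitalCStarAlgebra A] [NonUnitalCStarAlgebra B]
    [NonUnitalCStarAlgebra C] :
    Set (MinTensor (MinTensor A B) C × MinTensor A (MinTensor B C)) :=
  closure (Set.range fun t : (A ⊗[ℂ] B) ⊗[ℂ] C =>
    (incl (MinTensor A B) C
        (TensorProduct.map (incl A B : A ⊗[ℂ] B →ₗ[ℂ] MinTensor A B) LinearMap.id t),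
      incl A (MinTensor B C)
        (TensorProduct.map LinearMap.id (incl B C : B ⊗[ℂ] C →ₗ[ℂ] MinTensor B C)
          (TensorProduct.assoc ℂ A B C t))))

/-- A compact quantum group structure on the unital C*-algebra `C`: a unital *-homomorphism
`Δ : C → C ⊗ C` (minimal tensor product) with `(Δ ⊗ id) Δ = (id ⊗ Δ) Δ` such that both
`Δ(C) (C ⊗ 1)` and `Δ(C) (1 ⊗ C)` span dense subspaces of `C ⊗ C`. -/
structure IsCompactQuantumGroup {C : Type u} [CStarAlgebra C] (Δ : C →⋆ₙₐ[ℂ] MinTensor C C) :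
    Prop where
  map_one : Δ 1 = incl C C (1 ⊗ₜ 1)
  coassoc : ∀ c, (map Δ (NonUnitalStarAlgHom.id ℂ C) (Δ c),
    map (NonUnitalStarAlgHom.id ℂ C) Δ (Δ c)) ∈ assocGraph C C C
  dense_left : closure (Submodule.span ℂ (Set.range fun x : C × C =>
    Δ x.1 * incl C C (x.2 ⊗ₜ 1)) : Set (MinTensor C C)) = Set.univ
  dense_right : closure (Submodule.span ℂ (Set.range fun x : C × C =>
    Δ x.1 * incl C C (1 ⊗ₜ x.2)) : Set (MinTensor C C)) = Set.univ

/-- An action of the compact quantum group `(C, Δ)` on the C*-algebra `E`: a *-homomorphism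
`α : E → E ⊗ C` with `(α ⊗ id) α = (id ⊗ Δ) α` such that `(1 ⊗ C) α(E)` spans a dense subspace of
`E ⊗ C`. -/
structure IsAction {C E : Type u} [CStarAlgebra C] [NonUnitalCStarAlgebra E]
    (Δ : C →⋆ₙₐ[ℂ] MinTensor C C) (α : E →⋆ₙₐ[ℂ] MinTensor E C) : Prop where
  coaction : ∀ x, (map α (NonUnitalStarAlgHom.id ℂ C) (α x),
    map (NonUnitalStarAlgHom.id ℂ E) Δ (α x)) ∈ assocGraph E C C
  dense : closure (Submodule.span ℂ (Set.range fun x : C × E =>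
    mulLeftRight x.1 (α x.2)) : Set (MinTensor E C)) = Set.univ

/-- An action `β : B → B ⊗ C` of the compact quantum group `(C, Δ)` on the finite-dimensional
C*-algebra `B` of a directed quantum graph `𝒢 = (B, ψ, A)` that preserves `ψ` and is compatible
with `A`.  Since `B` is finite-dimensional, the algebraic tensor product `B ⊗ C` is already
complete, and it is used here. -/
structure IsGraphAction (𝒢 : DirectedQuantumGraph.{u}) {C : Type u} [CStarAlgebra C]
    (Δ : C →⋆ₙₐ[ℂ] MinTensor C C) (β : 𝒢.B →⋆ₙₐ[ℂ] 𝒢.B ⊗[ℂ] C) : Prop where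
  isAction : IsAction Δ ((incl 𝒢.B C).comp β)
  state : ∀ b, sliceLeft 𝒢.ψ.toLin (β b) = 𝒢.ψ.toLin b • (1 : C)
  adjacency : ∀ b, β (𝒢.A b) = TensorProduct.map 𝒢.A LinearMap.id (β b)

/-- The compact quantum group `(C, Δ)` with its action `β` on `B` is the quantum automorphism group
of the directed quantum graph `𝒢 = (B, ψ, A)`: it is universal among the compact quantum groups
with a `ψ`-preserving action on `B` compatible with `A`. -/
structure IsQuantumAutomorphismGroup (𝒢 : DirectedQuantumGraph.{u}) {C : Type u} [CStarAlgebra C]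
    (Δ : C →⋆ₙₐ[ℂ] MinTensor C C) (β : 𝒢.B →⋆ₙₐ[ℂ] 𝒢.B ⊗[ℂ] C) : Prop where
  isCompactQuantumGroup : IsCompactQuantumGroup Δ
  isGraphAction : IsGraphAction 𝒢 Δ β
  universal : ∀ (C' : Type u) [CStarAlgebra C'] (Δ' : C' →⋆ₙₐ[ℂ] MinTensor C' C')
    (γ : 𝒢.B →⋆ₙₐ[ℂ] 𝒢.B ⊗[ℂ] C'), IsCompactQuantumGroup Δ' → IsGraphAction 𝒢 Δ' γ →
    ∃! π : C →⋆ₐ[ℂ] C', (∀ c, map π.toNonUnitalStarAlgHom π.toNonUnitalStarAlgHom (Δ c) = Δ' (π c)) ∧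
      ∀ b, TensorProduct.map LinearMap.id π.toLinearMap (β b) = γ b

end QuantumGroup

end

/-! Write `u` for the coefficient matrix of β and `*` for the convolution φ * θ = μ(φ ⊗ θ)m*. The
Cuntz–Krieger relations say s * (s* * s) = s and s* * s = (s * s*) ∘ A. Both are equations in the
convolution product, and amplification φ ↦ (φ ⊗ id)β respects everything that occurs in them. Since
m*(b) = Σ e_k ⊗ e_k* b and β is a *-homomorphism, the relation u u* = 1 collapses the convolution of
two amplified maps to the amplification of their convolution (`IsLinking.conv_amplify`).
Amplification also commutes with s ↦ s* and turns A_i into A_j. So (S_j ⊗ id)β is a Cuntz–Krieger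
family for 𝒢_i, and the universal property gives the homomorphism of part (1) (`exists_link_hom`).

The universal algebras are completions of a free *-algebra for the supremum of the C*-seminorms in
whose completions the relations hold. This has the expected universal property once the relations
are detected by jointly faithful families of homomorphisms (`CStarRelations.holds_gen`,
`CStarRelations.exists_lift`).

For part (2), the matrices u ⊗ 1 and 1 ⊗ u have mutually commuting entries, so their product
satisfies the linking relations again (`IsLinking.mul`), and universality gives Δ(u_nm) = Σ u_nk ⊗
u_km. One argument then treats the actions on B and on FO, and Δ itself as an action of the quantum
group on its own algebra. Coassociativity is a closed condition checked on generators. Density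
follows from unitarity, since Σ_m (1 ⊗ u_lm) α(s(e_m*)) = s(e_l*) ⊗ 1 (`IsLinking.isAction`,
`IsLinking.dense_action`).

It remains to see that this quantum group is universal. An arbitrary ψ-preserving action compatible
with A has a coefficient matrix v, and v must be shown to satisfy the linking relations. Invariance
of ψ gives v*v = 1. The density condition gives unitality and v v* = 1: the projection v v* acts as
the identity on a dense subspace (`IsGraphAction.mul_star_self`). Coassociativity gives the
comultiplication of v (`IsGraphAction.comul_coefficients`). Since associativity of minimal tensor
products is encoded only as the closure of a graph, this last step compares slices, and uses that
representations separate points. -/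

noncomputable section

set_option linter.unusedSectionVars false

/-! ### Separating representations of C*-algebras and of minimal tensor products -/

section Representations

/-- The representations of a unital C*-algebra separate its points. -/
theorem eq_zero_of_forall_rep {A : Type u} [CStarAlgebra A] (a : A)
    (h : ∀ (K : Type u) [NormedAddCommGroup K] [InnerProductSpace ℂ K] [CompleteSpace K]
      (ρ : A →⋆ₙₐ[ℂ] (K →L[ℂ] K)), ρ a = 0) : a = 0 := by
  let _ : PartialOrder A := CStarAlgebra.spectralOrder A
  let _ : StarOrderedRing A := CStarAlgebra.spectralOrderedRing A
  by_contra ha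
  -- The positive cone is closed and contains no line, so -(a*a) lies outside it when a ≠ 0.
  -- Hahn–Banach then gives a real functional g that is nonnegative on the cone with g(a*a) > 0.
  have hneg : ¬ (0 ≤ -(star a * a)) := fun h0 => by
    have h1 : star a * a = 0 := le_antisymm (by simpa using h0) (star_mul_self_nonneg a)
    exact ha (CStarRing.star_mul_self_eq_zero_iff a |>.mp h1)
  obtain ⟨g, hg, hg0⟩ := (ProperCone.positive ℝ A).hyperplane_separation_point
    (x₀ := -(star a * a)) hneg
  -- Symmetrising g makes k vanish on ix for self-adjoint x. The complexification x ↦ k(x) - i k(ix)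
  -- is then real on positive elements, with value 2g(x).
  let k : A →ₗ[ℝ] ℝ := (g : A →ₗ[ℝ] ℝ) + (g : A →ₗ[ℝ] ℝ) ∘ₗ (starL' ℝ : A ≃L[ℝ] A).toLinearMap
  have hk (x : A) : k x = g x + g (star x) := rfl
  have hf (x : A) (hx : 0 ≤ x) : Module.Dual.extendRCLike (𝕜 := ℂ) k x = ((2 * g x : ℝ) : ℂ) := by
    have hx' : star x = x := (IsSelfAdjoint.of_nonneg hx).star_eq
    rw [Module.Dual.extendRCLike_apply, hk, hk]
    have h1 : star ((RCLike.I : ℂ) • x) = -((RCLike.I : ℂ) • x) := by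
      rw [star_smul, hx']; simp
    rw [h1, hx', map_neg]
    simp; ring
  let f : A →ₚ[ℂ] ℂ := PositiveLinearMap.mk₀ (Module.Dual.extendRCLike (𝕜 := ℂ) k) fun x hx => by
    rw [hf x hx]
    have := hg x hx
    exact_mod_cast (by linarith : 0 ≤ 2 * g x)
  have h2 := h f.GNS f.gnsNonUnitalStarAlgHom
  -- In the GNS space the vector a·1 has squared norm f(a*a) = 2g(a*a) > 0, so a cannot act as zero.
  have h3 : f.gnsNonUnitalStarAlgHom a ((f.toPreGNS 1 : f.PreGNS) : f.GNS) = 0 := by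
    rw [h2]; rfl
  rw [PositiveLinearMap.gnsNonUnitalStarAlgHom_apply_coe] at h3
  have h4 : ‖f.leftMulMapPreGNS a (f.toPreGNS 1)‖ = 0 := by
    rw [← UniformSpace.Completion.norm_coe, h3, norm_zero]
  have h5 := f.preGNS_norm_sq (f.leftMulMapPreGNS a (f.toPreGNS 1))
  rw [h4] at h5
  simp only [PositiveLinearMap.leftMulMapPreGNS_apply, PositiveLinearMap.ofPreGNS_toPreGNS,
    mul_one] at h5
  have h6 : f (star a * a) = ((2 * g (star a * a) : ℝ) : ℂ) := hf _ (star_mul_self_nonneg a)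
  rw [h6] at h5
  rw [map_neg] at hg0
  have h7 : (0 : ℝ) = 2 * g (star a * a) := by exact_mod_cast (by simpa using h5)
  linarith

section CompletionRep

variable {P : Type v} [NonUnitalRing P] [StarRing P] [Module ℂ P] {V : Type w}
  [NormedAddCommGroup V] [InnerProductSpace ℂ V]

theorem completion_ext {f g : UniformSpace.Completion V →L[ℂ] UniformSpace.Completion V}
    (h : ∀ x : V, f x = g x) : f = g := by
  ext x
  induction x using UniformSpace.Completion.induction_on with
  | hp => exact isClosed_eq (by fun_prop) (by fun_prop)
  | ih x => exact h x

/-- A *-representation by bounded operators on a pre-Hilbert space extends to the completion. -/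
def completionRep (f : P →ₗ[ℂ] (V →L[ℂ] V)) (hmul : ∀ a b, f (a * b) = f a * f b)
    (hstar : ∀ a v w, inner ℂ (f (star a) v) w = inner ℂ v (f a w)) :
    P →⋆ₙₐ[ℂ] (UniformSpace.Completion V →L[ℂ] UniformSpace.Completion V) where
  toFun t := (f t).completion
  map_smul' c t := completion_ext fun x => by simp
  map_zero' := completion_ext fun x => by simp
  map_add' s t := completion_ext fun x => by simp [UniformSpace.Completion.coe_add]
  map_mul' s t := completion_ext fun x => by simp [hmul]
  map_star' t := by
    refine (ContinuousLinearMap.eq_adjoint_iff _ _).mpr fun x y => ?_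
    induction x, y using UniformSpace.Completion.induction_on₂ with
    | hp => exact isClosed_eq (by fun_prop) (by fun_prop)
    | ih x y => simp [hstar]

theorem norm_continuousLinearMap_completion (f : V →L[ℂ] V) : ‖f.completion‖ = ‖f‖ := by
  apply le_antisymm
  · refine ContinuousLinearMap.opNorm_le_bound _ (norm_nonneg _) fun x => ?_
    induction x using UniformSpace.Completion.induction_on with
    | hp => exact isClosed_le (by fun_prop) (by fun_prop)
    | ih x =>
      rw [ContinuousLinearMap.completion_apply_coe, UniformSpace.Completion.norm_coe,
        UniformSpace.Completion.norm_coe]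
      exact ContinuousLinearMap.le_opNorm _ _
  · refine ContinuousLinearMap.opNorm_le_bound _ (norm_nonneg _) fun x => ?_
    have := f.completion.le_opNorm x
    rwa [ContinuousLinearMap.completion_apply_coe, UniformSpace.Completion.norm_coe,
      UniformSpace.Completion.norm_coe] at this

end CompletionRep

variable {A B : Type u} [NonUnitalCStarAlgebra A] [NonUnitalCStarAlgebra B]

/-- The operator `(π ⊗ ρ)(t)` on the Hilbert space tensor product of the representations. -/
def RepPair.completionHom (r : RepPair A B) :
    A ⊗[ℂ] B →⋆ₙₐ[ℂ] (UniformSpace.Completion (r.H ⊗[ℂ] r.K) →L[ℂ]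
      UniformSpace.Completion (r.H ⊗[ℂ] r.K)) :=
  completionRep r.op r.op_mul r.inner_op_star

theorem RepPair.completionHom_coe (r : RepPair A B) (t : A ⊗[ℂ] B) (x : r.H ⊗[ℂ] r.K) :
    r.completionHom t x = (r.op t x : UniformSpace.Completion (r.H ⊗[ℂ] r.K)) :=
  ContinuousLinearMap.completion_apply_coe _ _

theorem RepPair.norm_completionHom (r : RepPair A B) (t : A ⊗[ℂ] B) :
    ‖r.completionHom t‖ = ‖r.op t‖ :=
  norm_continuousLinearMap_completion _

/-- The tensor product of two representations, as a representation of the minimal tensor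
product. -/
def RepPair.rep (r : RepPair A B) :
    MinTensor A B →⋆ₙₐ[ℂ] (UniformSpace.Completion (r.H ⊗[ℂ] r.K) →L[ℂ]
      UniformSpace.Completion (r.H ⊗[ℂ] r.K)) :=
  (minSeminorm A B).lift (E := UniformSpace.Completion (r.H ⊗[ℂ] r.K) →L[ℂ]
      UniformSpace.Completion (r.H ⊗[ℂ] r.K)) r.completionHom fun t => by
    rw [r.norm_completionHom]; exact MinTensor.norm_op_le r t

theorem RepPair.rep_incl (r : RepPair A B) (t : A ⊗[ℂ] B) :
    r.rep (MinTensor.incl A B t) = r.completionHom t :=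
  CStarSeminorm.lift_coe (E := UniformSpace.Completion (r.H ⊗[ℂ] r.K) →L[ℂ]
      UniformSpace.Completion (r.H ⊗[ℂ] r.K)) _ _ _ t

theorem RepPair.continuous_rep (r : RepPair A B) : Continuous r.rep :=
  AddMonoidHomClass.continuous_of_bound r.rep 1 fun x => by
    rw [one_mul]; exact NonUnitalStarAlgHom.norm_apply_le r.rep x

/-- The tensor product of representations of `A` and `B` as a representation of the minimal tensor
product `A ⊗ B`. -/
def tensorRep {H K : Type u} [NormedAddCommGroup H] [InnerProductSpace ℂ H] [CompleteSpace H]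
    [NormedAddCommGroup K] [InnerProductSpace ℂ K] [CompleteSpace K]
    (π : A →⋆ₙₐ[ℂ] (H →L[ℂ] H)) (ρ : B →⋆ₙₐ[ℂ] (K →L[ℂ] K)) :
    MinTensor A B →⋆ₙₐ[ℂ] (UniformSpace.Completion (H ⊗[ℂ] K) →L[ℂ]
      UniformSpace.Completion (H ⊗[ℂ] K)) :=
  RepPair.rep ⟨H, K, π, ρ⟩

section

variable {H K : Type u} [NormedAddCommGroup H] [InnerProductSpace ℂ H] [CompleteSpace H]
  [NormedAddCommGroup K] [InnerProductSpace ℂ K] [CompleteSpace K]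
  (π : A →⋆ₙₐ[ℂ] (H →L[ℂ] H)) (ρ : B →⋆ₙₐ[ℂ] (K →L[ℂ] K))

theorem continuous_tensorRep : Continuous (tensorRep π ρ) :=
  RepPair.continuous_rep ⟨H, K, π, ρ⟩

theorem tensorRep_tmul (a : A) (b : B) (h : H) (k : K) :
    tensorRep π ρ (MinTensor.incl A B (a ⊗ₜ b)) ((h ⊗ₜ k : H ⊗[ℂ] K) :
      UniformSpace.Completion (H ⊗[ℂ] K)) = ((π a h ⊗ₜ ρ b k : H ⊗[ℂ] K) :
      UniformSpace.Completion (H ⊗[ℂ] K)) := by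
  rw [tensorRep, RepPair.rep_incl]
  exact RepPair.completionHom_coe ⟨H, K, π, ρ⟩ _ _

end

theorem MinTensor.norm_incl (t : A ⊗[ℂ] B) : ‖MinTensor.incl A B t‖ = minSeminorm A B t :=
  CStarSeminorm.norm_coe _ t

theorem MinTensor.denseRange_incl : DenseRange (MinTensor.incl A B) :=
  CStarSeminorm.denseRange_coe _

/-- The tensor products of representations separate the points of the minimal tensor product. -/
theorem MinTensor.eq_zero_of_forall_rep (x : MinTensor A B)
    (h : ∀ r : RepPair A B, r.rep x = 0) : x = 0 := by
  rw [← norm_le_zero_iff]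
  refine le_of_forall_pos_le_add fun ε hε => ?_
  obtain ⟨t, ht⟩ := Metric.denseRange_iff.mp (denseRange_incl (A := A) (B := B)) x (ε / 2) (by positivity)
  rw [dist_eq_norm] at ht
  -- The norm of an algebraic tensor t is a supremum over pairs of representations. Each pair kills
  -- x, so it sees t only through t - x.
  have h1 : ‖incl A B t‖ ≤ ‖x - incl A B t‖ := by
    rw [norm_incl]
    refine minSeminorm_le _ (norm_nonneg _) fun r => ?_
    have h2 : r.rep (incl A B t) = r.rep (incl A B t - x) := by
      rw [map_sub, h r, sub_zero]
    rw [← r.norm_completionHom, ← r.rep_incl, h2, norm_sub_rev]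
    exact NonUnitalStarAlgHom.norm_apply_le r.rep _
  calc ‖x‖ = ‖(x - incl A B t) + incl A B t‖ := by rw [sub_add_cancel]
    _ ≤ ‖x - incl A B t‖ + ‖incl A B t‖ := norm_add_le _ _
    _ ≤ 0 + ε := by linarith

end Representations

/-! ### Compressions by T ⊗ 1 on Hilbert space tensor products -/

section HilbertTensor

variable {V W H : Type u} [NormedAddCommGroup V] [InnerProductSpace ℂ V] [CompleteSpace V]
  [NormedAddCommGroup W] [InnerProductSpace ℂ W] [CompleteSpace W]
  [NormedAddCommGroup H] [InnerProductSpace ℂ H] [CompleteSpace H]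

theorem completion_tensor_ext {F : Type*} [NormedAddCommGroup F] [NormedSpace ℂ F]
    {f g : UniformSpace.Completion (V ⊗[ℂ] H) →L[ℂ] F}
    (hfg : ∀ (k : V) (h : H), f ((k ⊗ₜ[ℂ] h : V ⊗[ℂ] H) : UniformSpace.Completion (V ⊗[ℂ] H)) =
      g ((k ⊗ₜ[ℂ] h : V ⊗[ℂ] H) : UniformSpace.Completion (V ⊗[ℂ] H))) : f = g := by
  ext x
  induction x using UniformSpace.Completion.induction_on with
  | hp => exact isClosed_eq (by fun_prop) (by fun_prop)
  | ih x =>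
    induction x using TensorProduct.induction_on with
    | zero => rw [UniformSpace.Completion.coe_zero, map_zero, map_zero]
    | tmul k h => exact hfg k h
    | add x y hx hy => rw [UniformSpace.Completion.coe_add, map_add, map_add, hx, hy]

variable (H) in
/-- The operator `T ⊗ 1` on Hilbert space tensor products. -/
def tensorId (T : V →L[ℂ] W) : UniformSpace.Completion (V ⊗[ℂ] H) →L[ℂ]
    UniformSpace.Completion (W ⊗[ℂ] H) :=
  (TensorProduct.mapL T (ContinuousLinearMap.id ℂ H)).completion

theorem tensorId_tmul (T : V →L[ℂ] W) (v : V) (h : H) :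
    tensorId H T ((v ⊗ₜ[ℂ] h : V ⊗[ℂ] H) : UniformSpace.Completion (V ⊗[ℂ] H)) =
      ((T v ⊗ₜ[ℂ] h : W ⊗[ℂ] H) : UniformSpace.Completion (W ⊗[ℂ] H)) :=
  ContinuousLinearMap.completion_apply_coe _ _

theorem adjoint_tensorId_tmul (T : V →L[ℂ] W) (w : W) (h : H) :
    (ContinuousLinearMap.adjoint (𝕜 := ℂ) (E := UniformSpace.Completion (V ⊗[ℂ] H))
      (F := UniformSpace.Completion (W ⊗[ℂ] H)) (tensorId H T))
      ((w ⊗ₜ[ℂ] h : W ⊗[ℂ] H) : UniformSpace.Completion (W ⊗[ℂ] H)) =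
      ((ContinuousLinearMap.adjoint T w ⊗ₜ[ℂ] h : V ⊗[ℂ] H) :
        UniformSpace.Completion (V ⊗[ℂ] H)) := by
  refine ext_inner_right ℂ fun l => ?_
  -- Read as continuous functionals of `l`, both inner products are determined by their values on
  -- elementary tensors.
  rw [← innerSL_apply_apply ℂ, ← innerSL_apply_apply ℂ]
  refine congrFun (congrArg DFunLike.coe (completion_tensor_ext fun k' h' => ?_)) l
  rw [innerSL_apply_apply, innerSL_apply_apply, ContinuousLinearMap.adjoint_inner_left,
    tensorId_tmul, UniformSpace.Completion.inner_coe, UniformSpace.Completion.inner_coe,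
    TensorProduct.inner_tmul, TensorProduct.inner_tmul, ContinuousLinearMap.adjoint_inner_left]

variable {A E : Type u} [NonUnitalCStarAlgebra A] [NonUnitalCStarAlgebra E]
  (σ : A →⋆ₙₐ[ℂ] (W →L[ℂ] W)) (π : E →⋆ₙₐ[ℂ] (H →L[ℂ] H))

/-- The compression of the representation `σ ⊗ π` of the minimal tensor product by `S ⊗ 1` and
`T ⊗ 1`. -/
def compression (S T : V →L[ℂ] W) : MinTensor A E →ₗ[ℂ]
    (UniformSpace.Completion (V ⊗[ℂ] H) →L[ℂ] UniformSpace.Completion (V ⊗[ℂ] H)) where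
  toFun x := (ContinuousLinearMap.adjoint (𝕜 := ℂ) (E := UniformSpace.Completion (V ⊗[ℂ] H))
      (F := UniformSpace.Completion (W ⊗[ℂ] H)) (tensorId H S)).comp
    ((tensorRep σ π x).comp (tensorId H T))
  map_add' x y := by ext k; simp
  map_smul' c x := by ext k; simp

theorem continuous_compression (S T : V →L[ℂ] W) : Continuous (compression σ π S T) :=
  continuous_const.clm_comp ((continuous_tensorRep _ _).clm_comp continuous_const)

theorem compression_tmul (S T : V →L[ℂ] W) (a : A) (e : E) (v : V) (h : H) :
    compression σ π S T (MinTensor.incl A E (a ⊗ₜ e))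
      ((v ⊗ₜ[ℂ] h : V ⊗[ℂ] H) : UniformSpace.Completion (V ⊗[ℂ] H)) =
      ((ContinuousLinearMap.adjoint S (σ a (T v)) ⊗ₜ[ℂ] π e h : V ⊗[ℂ] H) :
        UniformSpace.Completion (V ⊗[ℂ] H)) := by
  change ContinuousLinearMap.adjoint (𝕜 := ℂ) (E := UniformSpace.Completion (V ⊗[ℂ] H))
      (F := UniformSpace.Completion (W ⊗[ℂ] H)) (tensorId H S) (tensorRep σ π
        (MinTensor.incl A E (a ⊗ₜ e)) (tensorId H T _)) = _
  rw [tensorId_tmul, tensorRep_tmul, adjoint_tensorId_tmul]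

end HilbertTensor

/-! ### Slice maps on minimal tensor products with a finite-dimensional leg -/

section Slice

variable {B : Type u} [CStarAlgebra B] [FiniteDimensional ℂ B] (ψ : FaithfulState B)

/-- The representation of `B` on `L²(B, ψ)` by left multiplication. -/
def FaithfulState.leftRep : B →⋆ₙₐ[ℂ] (ψ.L2 →L[ℂ] ψ.L2) where
  toFun b := LinearMap.toContinuousLinearMap
    (ψ.toL2.toLinearMap ∘ₗ LinearMap.mulLeft ℂ b ∘ₗ ψ.toL2.symm.toLinearMap)
  map_smul' c b := by ext x; simp
  map_zero' := by ext x; simp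
  map_add' b c := by ext x; simp [add_mul]
  map_mul' b c := by ext x; simp
  map_star' b := by
    refine (ContinuousLinearMap.eq_adjoint_iff _ _).mpr fun x y => ?_
    obtain ⟨x, rfl⟩ := ψ.toL2.surjective x
    obtain ⟨y, rfl⟩ := ψ.toL2.surjective y
    simp only [LinearMap.coe_toContinuousLinearMap', LinearMap.comp_apply, LinearEquiv.coe_coe,
      LinearEquiv.symm_apply_apply, LinearMap.mulLeft_apply, FaithfulState.inner_toL2, star_mul,
      star_star, mul_assoc]

theorem FaithfulState.leftRep_toL2 (b c : B) : ψ.leftRep b (ψ.toL2 c) = ψ.toL2 (b * c) := rfl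

variable {D : Type u} [NonUnitalCStarAlgebra D] {K : Type u} [NormedAddCommGroup K]
  [InnerProductSpace ℂ K] [CompleteSpace K] (ρ : D →⋆ₙₐ[ℂ] (K →L[ℂ] K))

variable (K) in
/-- The operator `k ↦ c ⊗ k` from `K` to `L²(B, ψ) ⊗ K`. -/
def FaithfulState.creation (c : B) : K →L[ℂ] UniformSpace.Completion (ψ.L2 ⊗[ℂ] K) :=
  UniformSpace.Completion.toComplL.comp
    ((TensorProduct.mk ℂ ψ.L2 K (ψ.toL2 c)).mkContinuous ‖ψ.toL2 c‖ fun k => by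
      rw [TensorProduct.mk_apply, TensorProduct.norm_tmul])

theorem FaithfulState.creation_apply (c : B) (k : K) :
    ψ.creation K c k = ((ψ.toL2 c ⊗ₜ[ℂ] k : ψ.L2 ⊗[ℂ] K) :
      UniformSpace.Completion (ψ.L2 ⊗[ℂ] K)) := rfl

theorem FaithfulState.adjoint_creation_apply (b c : B) (k : K) :
    ContinuousLinearMap.adjoint (ψ.creation K c)
      ((ψ.toL2 b ⊗ₜ[ℂ] k : ψ.L2 ⊗[ℂ] K) : UniformSpace.Completion (ψ.L2 ⊗[ℂ] K)) =
      ψ.toLin (star c * b) • k := by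
  refine ext_inner_left ℂ fun l => ?_
  rw [ContinuousLinearMap.adjoint_inner_right, creation_apply, UniformSpace.Completion.inner_coe,
    TensorProduct.inner_tmul, inner_toL2, inner_smul_right]

/-- The slice map `b ⊗ d ↦ ψ(c* b) ρ(d)` on the minimal tensor product `B ⊗ D`, for a
representation `ρ` of `D`. -/
def FaithfulState.sliceRep (c : B) : MinTensor B D →ₗ[ℂ] (K →L[ℂ] K) where
  -- Starting from the vector 1, b ⊗ d produces b ⊗ ρ(d)k, and pairing the first leg with c gives
  -- ψ(c*b)ρ(d)k.
  toFun x := (ContinuousLinearMap.adjoint (ψ.creation K c)).comp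
    ((tensorRep ψ.leftRep ρ x).comp (ψ.creation K 1))
  map_add' x y := by ext k; simp
  map_smul' c x := by ext k; simp

theorem FaithfulState.sliceRep_apply (c : B) (x : MinTensor B D) (k : K) :
    ψ.sliceRep ρ c x k = ContinuousLinearMap.adjoint (ψ.creation K c)
      (tensorRep ψ.leftRep ρ x (ψ.creation K 1 k)) := rfl

theorem FaithfulState.continuous_sliceRep (c : B) : Continuous (ψ.sliceRep ρ c) :=
  continuous_const.clm_comp ((continuous_tensorRep _ _).clm_comp continuous_const)

theorem FaithfulState.sliceRep_tmul (c b : B) (d : D) :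
    ψ.sliceRep ρ c (MinTensor.incl B D (b ⊗ₜ d)) = ψ.toLin (star c * b) • ρ d := by
  ext k
  rw [sliceRep_apply, creation_apply, tensorRep_tmul, leftRep_toL2, mul_one,
    adjoint_creation_apply]
  rfl

section TwoStep

variable {E : Type u} [NonUnitalCStarAlgebra E] {H : Type u} [NormedAddCommGroup H]
  [InnerProductSpace ℂ H] [CompleteSpace H] (π : E →⋆ₙₐ[ℂ] (H →L[ℂ] H))

/-- Whether the leg B is bracketed with D alone or with D ⊗ E, slicing it off gives the operator
sending k ⊗ h to ψ(c*b) ρ(d)k ⊗ π(e)h. -/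
theorem FaithfulState.compression_tmul (b c : B) (d : D) (e : E) :
    compression (tensorRep ψ.leftRep ρ) π (ψ.creation K c) (ψ.creation K 1)
      (MinTensor.incl _ _ (MinTensor.incl _ _ (b ⊗ₜ[ℂ] d) ⊗ₜ[ℂ] e)) =
    ψ.sliceRep (tensorRep ρ π) c (MinTensor.incl _ _ (b ⊗ₜ[ℂ] MinTensor.incl _ _ (d ⊗ₜ[ℂ] e))) := by
  refine completion_tensor_ext fun k h => ?_
  rw [_root_.compression_tmul, sliceRep_tmul, creation_apply, tensorRep_tmul, leftRep_toL2,
    mul_one, adjoint_creation_apply, smul_apply, tensorRep_tmul, ← TensorProduct.smul_tmul',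
    UniformSpace.Completion.coe_smul]

/-- Slicing is compatible with the associativity isomorphism of minimal tensor products. -/
theorem FaithfulState.compression_eq (c : B)
    {x : MinTensor (MinTensor B D) E × MinTensor B (MinTensor D E)} (hx : x ∈ assocGraph B D E) :
    compression (tensorRep ψ.leftRep ρ) π (ψ.creation K c) (ψ.creation K 1) x.1 =
      ψ.sliceRep (tensorRep ρ π) c x.2 := by
  -- Both sides are continuous in x, so equality passes from algebraic tensors to the closure of the
  -- graph.
  refine closure_minimal (s := Set.range _)
    (t := {x : MinTensor (MinTensor B D) E × MinTensor B (MinTensor D E) |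
      compression (tensorRep ψ.leftRep ρ) π (ψ.creation K c) (ψ.creation K 1) x.1 =
        ψ.sliceRep (tensorRep ρ π) c x.2}) ?_
    (isClosed_eq ((continuous_compression _ π _ _).comp continuous_fst)
      ((ψ.continuous_sliceRep _ c).comp continuous_snd)) hx
  rintro _ ⟨t, rfl⟩
  rw [Set.mem_ofPred_eq]
  induction t using TensorProduct.induction_on with
  | zero => simp only [map_zero]
  | add s t hs ht => simp only [map_add, hs, ht]
  | tmul t e =>
    induction t using TensorProduct.induction_on with
    | zero => simp only [TensorProduct.zero_tmul, map_zero]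
    | add s t hs ht => simp only [map_add, TensorProduct.add_tmul, hs, ht]
    | tmul b d => exact ψ.compression_tmul ρ π b c d e

end TwoStep

end Slice
end

noncomputable section

/-! ### Universal C*-algebras on generators and relations -/

section UniversalProperty

namespace CStarSeminorm

variable {P : Type u} [Ring P] [StarRing P] [Algebra ℂ P] (p : CStarSeminorm P)

/-- A unital *-homomorphism to a C*-algebra that is dominated by a C*-seminorm extends to a unital
*-homomorphism on the completion. -/
def liftUnital [StarModule ℂ P] {E : Type v} [CStarAlgebra E] (f : P →⋆ₐ[ℂ] E)
    (h : ∀ a, ‖f a‖ ≤ p a) : p.Completion →⋆ₐ[ℂ] E :=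
  let g : p.Completion →⋆ₙₐ[ℂ] E := p.lift (f : P →⋆ₙₐ[ℂ] E) h
  have h1 : g 1 = 1 := (p.lift_coe (f : P →⋆ₙₐ[ℂ] E) h 1).trans (map_one f)
  { g with
    map_one' := h1
    commutes' := fun c => by
      change g (algebraMap ℂ _ c) = _
      rw [Algebra.algebraMap_eq_smul_one, map_smul, h1, Algebra.algebraMap_eq_smul_one] }

theorem liftUnital_coe [StarModule ℂ P] {E : Type v} [CStarAlgebra E] (f : P →⋆ₐ[ℂ] E)
    (h : ∀ a, ‖f a‖ ≤ p a) (a : P) : p.liftUnital f h (p.coe a) = f a :=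
  p.lift_coe (f : P →⋆ₙₐ[ℂ] E) h a

/-- This makes the completion for the seminorm induced by f an isometric copy inside E, as needed in
`CStarRelations.exists_lift`. -/
theorem norm_liftUnital [StarModule ℂ P] {E : Type v} [CStarAlgebra E] (f : P →⋆ₐ[ℂ] E)
    (h : ∀ a, ‖f a‖ = p a) (x : p.Completion) :
    ‖p.liftUnital f (fun a => (h a).le) x‖ = ‖x‖ := by
  have hc : Continuous (p.liftUnital f fun a => (h a).le) :=
    (p.extendL ((f : P →⋆ₙₐ[ℂ] E) : P →ₗ[ℂ] E) 1 (fun a => by simpa using (h a).le)).continuous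
  induction x using p.induction_on with
  | hc => exact isClosed_eq (by fun_prop) (by fun_prop)
  | h a => rw [liftUnital_coe, h, p.norm_coe]

/-- The canonical unital *-homomorphism to the completion. -/
def coeUnital [StarModule ℂ P] : P →⋆ₐ[ℂ] p.Completion where
  __ := p.coeHom
  map_one' := rfl
  commutes' c := by
    change p.coe (algebraMap ℂ _ c) = _
    rw [Algebra.algebraMap_eq_smul_one, map_smul, Algebra.algebraMap_eq_smul_one]
    rfl

end CStarSeminorm

namespace FreeStarAlgebra

variable {X : Type u}

/-- The unital *-homomorphism on the free *-algebra with given values on the generators. -/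
def lift {D : Type v} [CStarAlgebra D] (s : X → D) : FreeStarAlgebra X →⋆ₐ[ℂ] D :=
  let f : FreeStarAlgebra X →ₐ[ℂ] D := FreeAlgebra.lift ℂ (Sum.elim s fun x => star (s x))
  have hg (x : X) : f (gen x) = s x := FreeAlgebra.lift_ι_apply _ _
  have hs (x : X) : f (genStar x) = star (s x) := FreeAlgebra.lift_ι_apply _ _
  { f with
    map_star' := fun a => by
      change f (star a) = star (f a)
      induction a using induction with
      | hc c =>
        rw [Algebra.algebraMap_eq_smul_one, star_smul, star_one, map_smul, map_smul, map_one,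
          star_smul, star_one]
      | hg x => rw [star_gen, hg, hs]
      | hs x => rw [← star_gen, star_star, hg, star_gen, hs, star_star]
      | hm a b ha hb => rw [star_mul, map_mul, map_mul, star_mul, ha, hb]
      | ha a b ha hb => rw [star_add, map_add, map_add, star_add, ha, hb] }

theorem lift_gen {D : Type v} [CStarAlgebra D] (s : X → D) (x : X) : lift s (gen x) = s x :=
  FreeAlgebra.lift_ι_apply _ _

end FreeStarAlgebra

/-- The C*-seminorm induced by a *-homomorphism. -/
def CStarSeminorm.ofHom {P : Type u} [Ring P] [StarRing P] [Algebra ℂ P] {D : Type v}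
    [CStarAlgebra D] (f : P →⋆ₐ[ℂ] D) : CStarSeminorm P where
  __ := (normSeminorm ℂ D).comp (f : P →ₗ[ℂ] D)
  mul_le' a b := by
    change ‖f (a * b)‖ ≤ ‖f a‖ * ‖f b‖
    rw [map_mul]
    exact norm_mul_le _ _
  le_star_mul_self' a := by
    change ‖f a‖ * ‖f a‖ ≤ ‖f (star a * a)‖
    rw [map_mul, map_star, CStarRing.norm_star_mul_self]

theorem continuous_starAlgHom {A : Type u} {D : Type v} [CStarAlgebra A] [CStarAlgebra D]
    (f : A →⋆ₐ[ℂ] D) : Continuous f :=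
  AddMonoidHomClass.continuous_of_bound f 1 fun x => by
    rw [one_mul]; exact NonUnitalStarAlgHom.norm_apply_le f x

theorem continuous_nonUnitalStarAlgHom {A : Type u} {D : Type v} [NonUnitalCStarAlgebra A]
    [NonUnitalCStarAlgebra D] (f : A →⋆ₙₐ[ℂ] D) : Continuous f :=
  AddMonoidHomClass.continuous_of_bound f 1 fun x => by
    rw [one_mul]; exact NonUnitalStarAlgHom.norm_apply_le f x

namespace CStarRelations

variable {X : Type u} (R : CStarRelations X)

/-- The relations hold for a family as soon as they hold for its images under a jointly faithful
family of unital *-homomorphisms. -/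
def IsReflecting : Prop :=
  ∀ (D : Type u) [CStarAlgebra D] (s : X → D) (I : Type u) (E : I → Type u)
    [∀ i, CStarAlgebra (E i)] (f : ∀ i, D →⋆ₐ[ℂ] E i), (∀ x, (∀ i, f i x = 0) → x = 0) →
    (∀ i, R.Holds (E i) fun x => f i (s x)) → R.Holds D s

/-- The canonical unital *-homomorphism from the free *-algebra. -/
def ofFree : FreeStarAlgebra X →⋆ₐ[ℂ] R.Universal := R.seminorm.coeUnital

theorem ofFree_gen (x : X) : R.ofFree (FreeStarAlgebra.gen x) = R.gen x := rfl

theorem denseRange_ofFree : DenseRange R.ofFree := R.seminorm.denseRange_coe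

theorem norm_ofFree (a : FreeStarAlgebra X) : ‖R.ofFree a‖ = R.seminorm a := R.seminorm.norm_coe a

theorem le_seminorm (p : CStarSeminorm (FreeStarAlgebra X))
    (hp : R.Holds p.Completion fun x => p.coe (FreeStarAlgebra.gen x)) (a : FreeStarAlgebra X) :
    p a ≤ R.seminorm a :=
  le_ciSup (R.bddAbove a) ⟨p, hp⟩

/-- The extension of a dominated *-homomorphism on the free *-algebra. -/
def lift {D : Type v} [CStarAlgebra D] (f : FreeStarAlgebra X →⋆ₐ[ℂ] D)
    (h : ∀ a, ‖f a‖ ≤ R.seminorm a) : R.Universal →⋆ₐ[ℂ] D :=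
  R.seminorm.liftUnital f h

theorem lift_ofFree {D : Type v} [CStarAlgebra D] (f : FreeStarAlgebra X →⋆ₐ[ℂ] D)
    (h : ∀ a, ‖f a‖ ≤ R.seminorm a) (a : FreeStarAlgebra X) : R.lift f h (R.ofFree a) = f a :=
  R.seminorm.liftUnital_coe f h a

/-- A closed unital *-subalgebra containing the generators is everything. -/
theorem universal_induction (T : StarSubalgebra ℂ R.Universal)
    (hT : IsClosed (T : Set R.Universal)) (hg : ∀ x, R.gen x ∈ T) (a : R.Universal) : a ∈ T := by
  refine R.denseRange_ofFree.induction_on (p := (· ∈ T)) a hT fun a => ?_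
  induction a using FreeStarAlgebra.induction with
  | hc c => rw [AlgHomClass.commutes]; exact T.algebraMap_mem c
  | hg x => exact hg x
  | hs x => rw [← FreeStarAlgebra.star_gen, map_star]; exact star_mem (hg x)
  | hm a b ha hb => rw [map_mul]; exact mul_mem ha hb
  | ha a b ha hb => rw [map_add]; exact add_mem ha hb

variable {R}

theorem universal_hom_ext {D : Type v} [CStarAlgebra D] {f g : R.Universal →⋆ₐ[ℂ] D}
    (h : ∀ x, f (R.gen x) = g (R.gen x)) : f = g := by
  ext a
  refine R.universal_induction (StarAlgHom.equalizer f g) ?_ h a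
  exact isClosed_eq (continuous_starAlgHom f) (continuous_starAlgHom g)

/-- The universal norm is the supremum of the admissible seminorms, so the maps to their completions
are jointly faithful. The relations hold in each completion by admissibility and are reflected back.
-/
theorem holds_gen (h : R.IsReflecting) : R.Holds R.Universal R.gen := by
  let I := {p : CStarSeminorm (FreeStarAlgebra X) //
    R.Holds p.Completion fun x => p.coe (FreeStarAlgebra.gen x)}
  have hle (p : I) (a : FreeStarAlgebra X) : ‖p.1.coeUnital a‖ ≤ R.seminorm a :=
    (p.1.norm_coe a).trans_le (R.le_seminorm p.1 p.2 a)
  refine h R.Universal R.gen I (fun p => p.1.Completion)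
    (fun p => R.lift p.1.coeUnital (hle p)) (fun x hx => ?_) fun p => ?_
  · rw [← norm_le_zero_iff]
    refine le_of_forall_pos_le_add fun ε hε => ?_
    obtain ⟨t, ht⟩ := Metric.denseRange_iff.mp R.denseRange_ofFree x (ε / 2) (by positivity)
    rw [dist_eq_norm] at ht
    have h1 : ‖R.ofFree t‖ ≤ ‖x - R.ofFree t‖ := by
      rw [norm_ofFree]
      refine Real.iSup_le (fun p => ?_) (norm_nonneg _)
      have h2 : R.lift p.1.coeUnital (hle p) (R.ofFree t - x) = p.1.coe t := by
        rw [map_sub, hx p, sub_zero, lift_ofFree]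
        rfl
      rw [← p.1.norm_coe, ← h2, norm_sub_rev]
      exact NonUnitalStarAlgHom.norm_apply_le _ _
    calc ‖x‖ = ‖(x - R.ofFree t) + R.ofFree t‖ := by rw [sub_add_cancel]
      _ ≤ ‖x - R.ofFree t‖ + ‖R.ofFree t‖ := norm_add_le _ _
      _ ≤ 0 + ε := by linarith
  · convert p.2 using 2 with x
    exact R.lift_ofFree _ _ _

/-- The norm of D pulled back to the free *-algebra is admissible: its completion embeds
isometrically in D, and the relations reflect along that single embedding. The universal seminorm
therefore dominates it, and the map on the free algebra extends. -/
theorem exists_lift (h : R.IsReflecting) {D : Type u} [CStarAlgebra D] (s : X → D)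
    (hs : R.Holds D s) : ∃ f : R.Universal →⋆ₐ[ℂ] D, ∀ x, f (R.gen x) = s x := by
  let φ := FreeStarAlgebra.lift s
  let p := CStarSeminorm.ofHom φ
  have hp : R.Holds p.Completion fun x => p.coe (FreeStarAlgebra.gen x) := by
    refine h _ _ PUnit (fun _ => D) (fun _ => p.liftUnital φ fun a => le_rfl) (fun x hx => ?_)
      fun _ => ?_
    · have h1 := p.norm_liftUnital φ (fun a => rfl) x
      rw [hx PUnit.unit, norm_zero] at h1
      exact norm_eq_zero.mp h1.symm
    · convert hs using 2 with x
      exact (p.liftUnital_coe φ _ _).trans (FreeStarAlgebra.lift_gen s x)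
  have hle : ∀ a, ‖φ a‖ ≤ R.seminorm a := R.le_seminorm p hp
  refine ⟨R.lift φ hle, fun x => ?_⟩
  rw [← ofFree_gen, lift_ofFree, FreeStarAlgebra.lift_gen]

end CStarRelations

end UniversalProperty

/-! ### Convolution of linear maps and the Cuntz–Krieger relations -/

section Convolution

variable {B : Type u} [CStarAlgebra B] [FiniteDimensional ℂ B] (ψ : FaithfulState B)

theorem FaithfulState.comul_eq (b : B) : ψ.comul b = ∑ k, ψ.e k ⊗ₜ[ℂ] (star (ψ.e k) * b) := by
  simpa using ψ.comul_mul 1 b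

theorem FaithfulState.e_orthonormal (k l : Fin (Module.finrank ℂ ψ.L2)) :
    ψ.toLin (star (ψ.e k) * ψ.e l) = if k = l then 1 else 0 :=
  orthonormal_iff_ite.mp ψ.onb.orthonormal k l

/-- The convolution `μ (φ ⊗ θ) m*` of two linear maps from `B` to an algebra. -/
def FaithfulState.conv {E : Type v} [NonUnitalRing E] [Module ℂ E] [IsScalarTower ℂ E E]
    [SMulCommClass ℂ E E] (φ θ : B →ₗ[ℂ] E) : B →ₗ[ℂ] E :=
  LinearMap.mul' ℂ E ∘ₗ TensorProduct.map φ θ ∘ₗ ψ.comul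

variable {E : Type v} [NonUnitalRing E] [Module ℂ E] [IsScalarTower ℂ E E] [SMulCommClass ℂ E E]

theorem FaithfulState.conv_apply (φ θ : B →ₗ[ℂ] E) (b : B) :
    ψ.conv φ θ b = ∑ k, φ (ψ.e k) * θ (star (ψ.e k) * b) := by
  simp [conv, comul_eq]

theorem FaithfulState.comp_conv {F : Type w} [NonUnitalRing F] [Module ℂ F]
    [IsScalarTower ℂ F F] [SMulCommClass ℂ F F] (f : E →ₙₐ[ℂ] F) (φ θ : B →ₗ[ℂ] E) :
    (f : E →ₗ[ℂ] F) ∘ₗ ψ.conv φ θ = ψ.conv ((f : E →ₗ[ℂ] F) ∘ₗ φ) ((f : E →ₗ[ℂ] F) ∘ₗ θ) := by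
  ext b
  simp [conv_apply]

end Convolution

/-- This reduces transport of families to two checks: compatibility with convolution and with
`conjMap`. -/
theorem isCKFamily_iff {𝒢 : DirectedQuantumGraph.{u}} {D : Type u} [NonUnitalCStarAlgebra D]
    (s : 𝒢.B →ₗ[ℂ] D) : IsCKFamily 𝒢 s ↔
      𝒢.ψ.conv s (𝒢.ψ.conv (conjMap s) s) = s ∧
        𝒢.ψ.conv (conjMap s) s = 𝒢.ψ.conv s (conjMap s) ∘ₗ 𝒢.A := by
  have h : LinearMap.mul' ℂ D ∘ₗ TensorProduct.map LinearMap.id (LinearMap.mul' ℂ D) ∘ₗ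
      TensorProduct.map s (TensorProduct.map (conjMap s) s) ∘ₗ
      TensorProduct.map LinearMap.id 𝒢.ψ.comul ∘ₗ 𝒢.ψ.comul =
      𝒢.ψ.conv s (𝒢.ψ.conv (conjMap s) s) := by
    simp only [FaithfulState.conv, ← LinearMap.comp_assoc, ← TensorProduct.map_comp,
      LinearMap.id_comp, LinearMap.comp_id]
  exact ⟨fun ⟨h1, h2⟩ => ⟨h ▸ h1, h2⟩, fun ⟨h1, h2⟩ => ⟨h.trans h1, h2⟩⟩

theorem conjMap_comp {B D E : Type u} [NonUnitalCStarAlgebra B] [NonUnitalCStarAlgebra D]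
    [NonUnitalCStarAlgebra E] (f : D →⋆ₙₐ[ℂ] E) (s : B →ₗ[ℂ] D) :
    conjMap ((f : D →ₗ[ℂ] E) ∘ₗ s) = (f : D →ₗ[ℂ] E) ∘ₗ conjMap s := by
  ext b
  exact (map_star f _).symm

theorem IsCKFamily.comp {𝒢 : DirectedQuantumGraph.{u}} {D E : Type u} [NonUnitalCStarAlgebra D]
    [NonUnitalCStarAlgebra E] {s : 𝒢.B →ₗ[ℂ] D} (hs : IsCKFamily 𝒢 s) (f : D →⋆ₙₐ[ℂ] E) :
    IsCKFamily 𝒢 ((f : D →ₗ[ℂ] E) ∘ₗ s) := by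
  rw [isCKFamily_iff] at hs ⊢
  have hc (φ θ : 𝒢.B →ₗ[ℂ] D) := 𝒢.ψ.comp_conv (f : D →ₙₐ[ℂ] E) φ θ
  change ∀ φ θ, (f : D →ₗ[ℂ] E) ∘ₗ _ = 𝒢.ψ.conv ((f : D →ₗ[ℂ] E) ∘ₗ φ)
    ((f : D →ₗ[ℂ] E) ∘ₗ θ) at hc
  rw [conjMap_comp, ← hc, ← hc, ← hc, hs.1, hs.2]
  exact ⟨rfl, rfl⟩

/-- A family is a quantum Cuntz-Krieger family if its images under a jointly faithful family of
*-homomorphisms are. -/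
theorem isCKFamily_of_comp {𝒢 : DirectedQuantumGraph.{u}} {D : Type u} [NonUnitalCStarAlgebra D]
    {I : Sort*} {E : I → Type u} [∀ i, NonUnitalCStarAlgebra (E i)] (f : ∀ i, D →⋆ₙₐ[ℂ] E i)
    (hf : ∀ x, (∀ i, f i x = 0) → x = 0) {s : 𝒢.B →ₗ[ℂ] D}
    (hs : ∀ i, IsCKFamily 𝒢 ((f i : D →ₗ[ℂ] E i) ∘ₗ s)) : IsCKFamily 𝒢 s := by
  have hc (i) (φ θ : 𝒢.B →ₗ[ℂ] D) := 𝒢.ψ.comp_conv (f i : D →ₙₐ[ℂ] E i) φ θ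
  change ∀ i φ θ, (f i : D →ₗ[ℂ] E i) ∘ₗ _ = 𝒢.ψ.conv ((f i : D →ₗ[ℂ] E i) ∘ₗ φ)
    ((f i : D →ₗ[ℂ] E i) ∘ₗ θ) at hc
  have ext (φ θ : 𝒢.B →ₗ[ℂ] D)
      (h : ∀ i, (f i : D →ₗ[ℂ] E i) ∘ₗ φ = (f i : D →ₗ[ℂ] E i) ∘ₗ θ) : φ = θ := by
    ext b
    refine sub_eq_zero.mp (hf _ fun i => ?_)
    rw [map_sub, sub_eq_zero]
    exact LinearMap.congr_fun (h i) b
  rw [isCKFamily_iff]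
  simp only [isCKFamily_iff, conjMap_comp, ← hc] at hs
  refine ⟨ext _ _ fun i => (hs i).1, ext _ _ fun i => ?_⟩
  rw [(hs i).2]
  rfl

theorem FaithfulState.comp_linExt {B : Type u} [CStarAlgebra B] [FiniteDimensional ℂ B]
    (ψ : FaithfulState B) {E F : Type*} [AddCommGroup E] [Module ℂ E] [AddCommGroup F] [Module ℂ F]
    (f : E →ₗ[ℂ] F) (t : Fin (Module.finrank ℂ ψ.L2) → E) :
    f ∘ₗ ψ.linExt t = ψ.linExt fun k => f (t k) := by
  ext b
  simp [linExt_apply]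

theorem FaithfulState.linExt_apply_e {B : Type u} [CStarAlgebra B] [FiniteDimensional ℂ B]
    (ψ : FaithfulState B) {E : Type*} [AddCommGroup E] [Module ℂ E] (s : B →ₗ[ℂ] E) :
    ψ.linExt (fun k => s (ψ.e k)) = s := by
  ext b
  conv_rhs => rw [← ψ.sum_e b]
  simp [linExt_apply]

/-! ### The universal property of the quantum Cuntz–Krieger algebra -/

section FO

namespace DirectedQuantumGraph

variable (𝒢 : DirectedQuantumGraph.{u})

theorem ckRelations_isReflecting : 𝒢.ckRelations.IsReflecting := by
  intro D _ s I E _ f hf hs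
  refine isCKFamily_of_comp (fun i => ((f i : D →⋆ₐ[ℂ] E i) : D →⋆ₙₐ[ℂ] E i)) hf fun i => ?_
  have := hs i
  rw [𝒢.ψ.comp_linExt]
  exact this

/-- The inclusion of `FO(𝒢)` in the unital universal C*-algebra. -/
def foIncl : 𝒢.FO →⋆ₙₐ[ℂ] 𝒢.ckRelations.Universal :=
  NonUnitalStarSubalgebraClass.subtype 𝒢.foSubalgebra

theorem foIncl_injective : Function.Injective 𝒢.foIncl := Subtype.val_injective

/-- The universal family is a quantum Cuntz-Krieger family. -/
theorem isCKFamily_S : IsCKFamily 𝒢 𝒢.S := by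
  refine isCKFamily_of_comp (I := Unit) (fun _ => 𝒢.foIncl)
    (fun x hx => 𝒢.foIncl_injective ((hx ⟨⟩).trans (map_zero _).symm)) fun _ => ?_
  have := CStarRelations.holds_gen 𝒢.ckRelations_isReflecting
  exact this

/-- A closed *-subalgebra of `FO(𝒢)` containing the universal family is everything. -/
theorem FO_induction (T : NonUnitalStarSubalgebra ℂ 𝒢.FO) (hT : IsClosed (T : Set 𝒢.FO))
    (hS : ∀ b, 𝒢.S b ∈ T) (x : 𝒢.FO) : x ∈ T := by
  have h1 : NonUnitalStarAlgebra.adjoin ℂ (Set.range 𝒢.unitalS) ≤ T.map 𝒢.foIncl :=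
    NonUnitalStarAlgebra.adjoin_le (by rintro _ ⟨b, rfl⟩; exact ⟨𝒢.S b, hS b, rfl⟩)
  have hx : (x.1 : 𝒢.ckRelations.Universal) ∈
      closure (NonUnitalStarAlgebra.adjoin ℂ (Set.range 𝒢.unitalS) :
        Set 𝒢.ckRelations.Universal) := x.2
  have h2 : x ∈ closure (T : Set 𝒢.FO) := by
    have hind : Topology.IsInducing (Subtype.val : 𝒢.FO → 𝒢.ckRelations.Universal) := .subtypeVal
    -- FO carries the subspace topology, so closures in it may be computed in the ambient unital
    -- algebra, where the adjoined *-algebra is dense in FO by construction.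
    have h3 := hind.closure_eq_preimage_closure_image (T : Set 𝒢.FO)
    refine h3.symm.subset ?_
    exact closure_mono (fun y hy => h1 hy) hx
  rwa [hT.closure_eq] at h2

/-- The universal property of `FO(𝒢)`. -/
theorem exists_FO_lift {D : Type u} [NonUnitalCStarAlgebra D] (s : 𝒢.B →ₗ[ℂ] D)
    (hs : IsCKFamily 𝒢 s) : ∃ f : 𝒢.FO →⋆ₙₐ[ℂ] D, ∀ b, f (𝒢.S b) = s b := by
  -- The ambient universal property concerns unital targets, so the family is first moved to the
  -- unitization of D.
  let j : D →⋆ₙₐ[ℂ] Unitization ℂ D := Unitization.inrNonUnitalStarAlgHom ℂ D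
  have h1 := hs.comp j
  have h2 : 𝒢.ckRelations.Holds (Unitization ℂ D) fun k => j (s (𝒢.ψ.e k.down)) := by
    change IsCKFamily 𝒢 _
    rw [← 𝒢.ψ.linExt_apply_e ((j : D →ₗ[ℂ] Unitization ℂ D) ∘ₗ s)] at h1
    exact h1
  obtain ⟨g, hg⟩ := CStarRelations.exists_lift 𝒢.ckRelations_isReflecting _ h2
  have hgS (b : 𝒢.B) : g (𝒢.unitalS b) = j (s b) := by
    have h3 : (g : 𝒢.ckRelations.Universal →ₗ[ℂ] Unitization ℂ D) ∘ₗ 𝒢.unitalS =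
        (j : D →ₗ[ℂ] Unitization ℂ D) ∘ₗ s := by
      rw [← 𝒢.ψ.linExt_apply_e ((j : D →ₗ[ℂ] Unitization ℂ D) ∘ₗ s), unitalS, 𝒢.ψ.comp_linExt]
      congr 1
      funext k
      exact hg ⟨k⟩
    exact LinearMap.congr_fun h3 b
  let g' : 𝒢.FO →⋆ₙₐ[ℂ] Unitization ℂ D := (g : _ →⋆ₙₐ[ℂ] Unitization ℂ D).comp 𝒢.foIncl
  -- Vanishing of the scalar part is a closed *-subalgebra condition that holds on the generators.
  -- On FO the map therefore lands in D itself.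
  have hfst (x : 𝒢.FO) : (g' x).fst = 0 := by
    let T : NonUnitalStarSubalgebra ℂ 𝒢.FO := {
      carrier := {x | (g' x).fst = 0}
      add_mem' := fun {x y} hx hy => by
        change (g' (x + y)).fst = 0
        rw [map_add, Unitization.fst_add, hx, hy, add_zero]
      zero_mem' := by
        change (g' 0).fst = 0
        rw [map_zero, Unitization.fst_zero]
      mul_mem' := fun {x y} hx hy => by
        change (g' (x * y)).fst = 0
        rw [map_mul, Unitization.fst_mul, hx, zero_mul]
      smul_mem' := fun c x hx => by
        change (g' (c • x)).fst = 0
        rw [map_smul, Unitization.fst_smul, hx, smul_zero]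
      star_mem' := fun {x} hx => by
        change (g' (star x)).fst = 0
        rw [map_star, Unitization.fst_star, hx, star_zero] }
    refine 𝒢.FO_induction T ?_ (fun b => ?_) x
    · exact isClosed_eq (Unitization.continuous_fst.comp (continuous_nonUnitalStarAlgHom g'))
        continuous_const
    · change (g (𝒢.unitalS b)).fst = 0
      rw [hgS]
      rfl
  have hj (x : 𝒢.FO) : g' x = j (g' x).snd := by
    refine Unitization.ext (hfst x) rfl
  have hinj : Function.Injective j := Unitization.inr_injective
  exact ⟨{
    toFun := fun x => (g' x).snd
    map_smul' := fun c x => by rw [map_smul]; rfl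
    map_zero' := by rw [map_zero]; rfl
    map_add' := fun x y => by rw [map_add]; rfl
    map_mul' := fun x y => hinj (by rw [← hj, map_mul, map_mul, ← hj, ← hj])
    map_star' := fun x => by rw [map_star]; rfl }, fun b => hinj ((hj _).symm.trans (hgS b))⟩

end DirectedQuantumGraph

end FO
end

noncomputable section

set_option linter.unusedSectionVars false

/-! ### Coordinates in B ⊗ D with respect to an orthonormal basis of B -/

section Coordinates

variable {B D E : Type u} [CStarAlgebra B] [FiniteDimensional ℂ B] (ψ : FaithfulState B)
  [CStarAlgebra D] [CStarAlgebra E]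

/-- The coordinates of an element of `B ⊗ D` with respect to the orthonormal basis of `B`. -/
def FaithfulState.coord (k : Fin (Module.finrank ℂ ψ.L2)) : B ⊗[ℂ] D →ₗ[ℂ] D :=
  sliceLeft (ψ.toLin ∘ₗ LinearMap.mulLeft ℂ (star (ψ.e k)))

theorem FaithfulState.coord_tmul (k : Fin (Module.finrank ℂ ψ.L2)) (b : B) (d : D) :
    ψ.coord k (b ⊗ₜ d) = ψ.toLin (star (ψ.e k) * b) • d := by
  simp [coord, sliceLeft]

theorem FaithfulState.sum_coord (t : B ⊗[ℂ] D) : ∑ k, ψ.e k ⊗ₜ[ℂ] ψ.coord k t = t := by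
  induction t using TensorProduct.induction_on with
  | zero => simp
  | add s t hs ht => simp only [map_add, TensorProduct.tmul_add, Finset.sum_add_distrib, hs, ht]
  | tmul b d =>
    simp only [coord_tmul, ← TensorProduct.smul_tmul, ← TensorProduct.sum_tmul, ψ.sum_e]

theorem FaithfulState.coord_sum (d : Fin (Module.finrank ℂ ψ.L2) → D)
    (k : Fin (Module.finrank ℂ ψ.L2)) : ψ.coord k (∑ l, ψ.e l ⊗ₜ[ℂ] d l) = d k := by
  simp [coord_tmul, e_orthonormal]

/-- The homomorphism `id ⊗ f : B ⊗ D → B ⊗ E`. -/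
def idTensor (B : Type u) [CStarAlgebra B] (f : D →⋆ₐ[ℂ] E) : B ⊗[ℂ] D →ₐ[ℂ] B ⊗[ℂ] E :=
  Algebra.TensorProduct.map (AlgHom.id ℂ B) (f : D →ₐ[ℂ] E)

theorem idTensor_tmul (f : D →⋆ₐ[ℂ] E) (b : B) (d : D) :
    idTensor B f (b ⊗ₜ d) = b ⊗ₜ f d := rfl

theorem idTensor_star (f : D →⋆ₐ[ℂ] E) (t : B ⊗[ℂ] D) :
    idTensor B f (star t) = star (idTensor B f t) := by
  induction t using TensorProduct.induction_on with
  | zero => simp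
  | add s t hs ht => rw [star_add, map_add, map_add, star_add, hs, ht]
  | tmul b d =>
    rw [TensorProduct.star_tmul, idTensor_tmul, idTensor_tmul, TensorProduct.star_tmul, map_star]

theorem sliceLeft_idTensor (f : D →⋆ₐ[ℂ] E) (φ : B →ₗ[ℂ] ℂ) (t : B ⊗[ℂ] D) :
    sliceLeft φ (idTensor B f t) = f (sliceLeft φ t) := by
  induction t using TensorProduct.induction_on with
  | zero => simp
  | add s t hs ht => simp only [map_add, hs, ht]
  | tmul b d => simp [idTensor_tmul, sliceLeft]

theorem map_idTensor (f : D →⋆ₐ[ℂ] E) (A : B →ₗ[ℂ] B) (t : B ⊗[ℂ] D) :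
    TensorProduct.map A LinearMap.id (idTensor B f t) =
      idTensor B f (TensorProduct.map A LinearMap.id t) := by
  induction t using TensorProduct.induction_on with
  | zero => simp
  | add s t hs ht => simp only [map_add, hs, ht]
  | tmul b d => rfl

end Coordinates

/-- A tensor in B ⊗ D is determined by its finitely many coordinates in D, and id ⊗ f applies f to
each of them. Joint faithfulness on D thus passes to B ⊗ D. -/
theorem FaithfulState.eq_of_idTensor_eq {B D : Type u} [CStarAlgebra B] [FiniteDimensional ℂ B]
    (ψ : FaithfulState B) [CStarAlgebra D] {I : Sort*} {E : I → Type u} [∀ i, CStarAlgebra (E i)]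
    (f : ∀ i, D →⋆ₐ[ℂ] E i) (hf : ∀ x, (∀ i, f i x = 0) → x = 0) {s t : B ⊗[ℂ] D}
    (h : ∀ i, idTensor B (f i) s = idTensor B (f i) t) : s = t := by
  rw [← ψ.sum_coord s, ← ψ.sum_coord t]
  refine Finset.sum_congr rfl fun k _ => congrArg _ (sub_eq_zero.mp (hf _ fun i => ?_))
  rw [map_sub, sub_eq_zero, coord, ← sliceLeft_idTensor, h i, sliceLeft_idTensor]

/-! ### Linking relations: naturality, universality and products of matrices -/

section Linking

variable {𝒢' 𝒢 : DirectedQuantumGraph.{u}} {D E : Type u} [CStarAlgebra D] [CStarAlgebra E]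
  {u : Fin (Module.finrank ℂ 𝒢'.ψ.L2) → Fin (Module.finrank ℂ 𝒢.ψ.L2) → D}

theorem coaction_e (m : Fin (Module.finrank ℂ 𝒢.ψ.L2)) :
    coaction 𝒢' 𝒢 u (𝒢.ψ.e m) = ∑ n, 𝒢'.ψ.e n ⊗ₜ[ℂ] u n m :=
  𝒢.ψ.linExt_e _ m

theorem coaction_apply (b : 𝒢.B) :
    coaction 𝒢' 𝒢 u b = ∑ n, 𝒢'.ψ.e n ⊗ₜ[ℂ] 𝒢.ψ.linExt (u n) b := by
  simp only [coaction, FaithfulState.linExt_apply, Finset.smul_sum, TensorProduct.tmul_sum,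
    TensorProduct.tmul_smul]
  exact Finset.sum_comm

theorem FaithfulState.linearMap_ext {B : Type u} [CStarAlgebra B] [FiniteDimensional ℂ B]
    (ψ : FaithfulState B) {F : Type*} [AddCommGroup F] [Module ℂ F] {φ θ : B →ₗ[ℂ] F}
    (h : ∀ k, φ (ψ.e k) = θ (ψ.e k)) : φ = θ := by
  rw [← ψ.linExt_apply_e φ, ← ψ.linExt_apply_e θ]
  congr 1
  exact funext h

/-- Naturality in the coefficient algebra carries the linking relations forwards (`IsLinking.comp`)
and backwards along jointly faithful families (`linkRelations_isReflecting`). -/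
theorem coaction_comp (f : D →⋆ₐ[ℂ] E) (b : 𝒢.B) :
    coaction 𝒢' 𝒢 (fun n m => f (u n m)) b = idTensor 𝒢'.B f (coaction 𝒢' 𝒢 u b) := by
  have h : coaction 𝒢' 𝒢 (fun n m => f (u n m)) =
      (idTensor 𝒢'.B f).toLinearMap ∘ₗ coaction 𝒢' 𝒢 u :=
    𝒢.ψ.linearMap_ext fun k => by
      simp only [LinearMap.comp_apply, coaction_e, AlgHom.toLinearMap_apply, map_sum, idTensor_tmul]
  exact LinearMap.congr_fun h b

/-- The relations of the linking algebra are preserved by unital *-homomorphisms. -/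
theorem IsLinking.comp (h : IsLinking 𝒢' 𝒢 u) (f : D →⋆ₐ[ℂ] E) :
    IsLinking 𝒢' 𝒢 fun n m => f (u n m) where
  map_one := by rw [coaction_comp, h.map_one, idTensor_tmul, _root_.map_one]
  map_mul b c := by simp only [coaction_comp, h.map_mul, _root_.map_mul]
  map_star b := by simp only [coaction_comp, h.map_star, idTensor_star]
  state b := by
    simp only [coaction_comp, sliceLeft_idTensor, h.state, map_smul, _root_.map_one]
  adjacency b := by simp only [coaction_comp, map_idTensor, h.adjacency]
  star_mul_self m m' := by
    have := congrArg f (h.star_mul_self m m')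
    simpa [apply_ite f, StarHomClass.map_star] using this
  mul_star_self n n' := by
    have := congrArg f (h.mul_star_self n n')
    simpa [apply_ite f, StarHomClass.map_star] using this

/-- Every linking relation is an equation in D or in B' ⊗ D, and jointly faithful families detect
equality in both. -/
theorem linkRelations_isReflecting (𝒢' 𝒢 : DirectedQuantumGraph.{u}) :
    (linkRelations 𝒢' 𝒢).IsReflecting := by
  intro D _ s I E _ f hf hs
  have hs' (i : I) : IsLinking 𝒢' 𝒢 fun n m => f i (s ⟨(n, m)⟩) := hs i
  have ext (x y : D) (h : ∀ i, f i x = f i y) : x = y :=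
    sub_eq_zero.mp (hf _ fun i => by rw [map_sub, h i, sub_self])
  change IsLinking 𝒢' 𝒢 fun n m => s ⟨(n, m)⟩
  have hc (i : I) (b : 𝒢.B) := coaction_comp (𝒢' := 𝒢') (u := fun n m => s ⟨(n, m)⟩) (f i) b
  constructor
  · refine 𝒢'.ψ.eq_of_idTensor_eq f hf fun i => ?_
    rw [← hc, (hs' i).map_one, idTensor_tmul, map_one]
  · intro b c
    refine 𝒢'.ψ.eq_of_idTensor_eq f hf fun i => ?_
    rw [map_mul (idTensor 𝒢'.B (f i)), ← hc, ← hc, ← hc, (hs' i).map_mul]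
  · intro b
    refine 𝒢'.ψ.eq_of_idTensor_eq f hf fun i => ?_
    rw [idTensor_star, ← hc, ← hc, (hs' i).map_star]
  · intro b
    refine ext _ _ fun i => ?_
    rw [← sliceLeft_idTensor, ← hc, (hs' i).state, map_smul, map_one]
  · intro b
    refine 𝒢'.ψ.eq_of_idTensor_eq f hf fun i => ?_
    rw [← map_idTensor, ← hc, ← hc, (hs' i).adjacency]
  · intro m m'
    refine ext _ _ fun i => ?_
    simpa [apply_ite (f i), StarHomClass.map_star] using (hs' i).star_mul_self m m'
  · intro n n'
    refine ext _ _ fun i => ?_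
    simpa [apply_ite (f i), StarHomClass.map_star] using (hs' i).mul_star_self n n'

variable (𝒢' 𝒢) in
/-- The matrix of generators of `C(G⁺(𝒢', 𝒢))`. -/
def linkGen (n : Fin (Module.finrank ℂ 𝒢'.ψ.L2)) (m : Fin (Module.finrank ℂ 𝒢.ψ.L2)) :
    CLink 𝒢' 𝒢 := (linkRelations 𝒢' 𝒢).gen ⟨(n, m)⟩

variable (𝒢' 𝒢) in
theorem isLinking_linkGen : IsLinking 𝒢' 𝒢 (linkGen 𝒢' 𝒢) :=
  CStarRelations.holds_gen (linkRelations_isReflecting 𝒢' 𝒢)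

theorem exists_link_lift (h : IsLinking 𝒢' 𝒢 u) :
    ∃ f : CLink 𝒢' 𝒢 →⋆ₐ[ℂ] D, ∀ n m, f (linkGen 𝒢' 𝒢 n m) = u n m := by
  obtain ⟨f, hf⟩ := CStarRelations.exists_lift (linkRelations_isReflecting 𝒢' 𝒢)
    (fun x => u x.down.1 x.down.2) h
  exact ⟨f, fun n m => hf ⟨(n, m)⟩⟩

theorem commute_coaction {d : D} (hd : ∀ n m, Commute (u n m) d) (b : 𝒢.B) :
    Commute (coaction 𝒢' 𝒢 u b) (1 ⊗ₜ d) := by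
  rw [coaction_apply]
  refine Commute.sum_left _ _ _ fun n _ => ?_
  have h : Commute (𝒢.ψ.linExt (u n) b) d := by
    rw [FaithfulState.linExt_apply]
    exact Commute.sum_left _ _ _ fun m _ => (hd n m).smul_left _
  rw [commute_iff_eq, Algebra.TensorProduct.tmul_mul_tmul, Algebra.TensorProduct.tmul_mul_tmul,
    mul_one, one_mul, h.eq]

/-- The linear map `b ⊗ d ↦ β(b) (1 ⊗ d)`. -/
def coactionMul (u : Fin (Module.finrank ℂ 𝒢'.ψ.L2) → Fin (Module.finrank ℂ 𝒢.ψ.L2) → D) :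
    𝒢.B ⊗[ℂ] D →ₗ[ℂ] 𝒢'.B ⊗[ℂ] D :=
  LinearMap.mul' ℂ (𝒢'.B ⊗[ℂ] D) ∘ₗ TensorProduct.map (coaction 𝒢' 𝒢 u)
    (Algebra.TensorProduct.includeRight : D →ₐ[ℂ] 𝒢'.B ⊗[ℂ] D).toLinearMap

theorem coactionMul_tmul (b : 𝒢.B) (d : D) :
    coactionMul u (b ⊗ₜ d) = coaction 𝒢' 𝒢 u b * (1 ⊗ₜ d) := rfl

variable {𝒢'' : DirectedQuantumGraph.{u}}
  {v : Fin (Module.finrank ℂ 𝒢.ψ.L2) → Fin (Module.finrank ℂ 𝒢''.ψ.L2) → D}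

/-- A product of matrices corresponds to the composite (β_u ⊗ id)β_v with the two legs in D
multiplied together. -/
theorem coaction_mul (b : 𝒢''.B) :
    coaction 𝒢' 𝒢'' (fun n m => ∑ k, u n k * v k m) b =
      coactionMul u (coaction 𝒢 𝒢'' v b) := by
  have h : coaction 𝒢' 𝒢'' (fun n m => ∑ k, u n k * v k m) =
      coactionMul u ∘ₗ coaction 𝒢 𝒢'' v :=
    𝒢''.ψ.linearMap_ext fun m => by
      simp only [LinearMap.comp_apply, coaction_e, map_sum, coactionMul_tmul, Finset.sum_mul,
        TensorProduct.tmul_sum, Algebra.TensorProduct.tmul_mul_tmul, mul_one]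
      exact Finset.sum_comm
  exact LinearMap.congr_fun h b

theorem commute_linExt (huv : ∀ n k l m, Commute (u n k) (v l m)) (b : 𝒢''.B) (n k l) :
    Commute (u n k) (𝒢''.ψ.linExt (v l) b) := by
  rw [FaithfulState.linExt_apply]
  exact Commute.sum_right _ _ _ fun m _ => (huv n k l m).smul_right _

/-- The product of two matrices with commuting entries satisfying the relations of the linking
algebra satisfies the relations of the linking algebra. -/
theorem IsLinking.mul (hu : IsLinking 𝒢' 𝒢 u) (hv : IsLinking 𝒢 𝒢'' v)
    (huv : ∀ n k l m, Commute (u n k) (v l m)) :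
    IsLinking 𝒢' 𝒢'' fun n m => ∑ k, u n k * v k m where
  map_one := by
    rw [coaction_mul, hv.map_one, coactionMul_tmul, hu.map_one,
      Algebra.TensorProduct.tmul_mul_tmul, mul_one, mul_one]
  map_mul b c := by
    rw [coaction_mul, coaction_mul, coaction_mul, hv.map_mul, coaction_apply b, coaction_apply c]
    simp only [Finset.sum_mul_sum, map_sum, coactionMul_tmul,
      Algebra.TensorProduct.tmul_mul_tmul]
    refine Finset.sum_congr rfl fun k _ => Finset.sum_congr rfl fun l _ => ?_
    -- Multiplicativity requires moving a coefficient of β_v(b) past β_u(e_l); this is what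
    -- commuting entries provide.
    have h1 := commute_coaction (fun n m => commute_linExt huv b n m k) (𝒢.ψ.e l)
    rw [hu.map_mul, mul_assoc, mul_assoc, ← mul_assoc (1 ⊗ₜ[ℂ] _) (coaction 𝒢' 𝒢 u _), ← h1.eq,
      mul_assoc, Algebra.TensorProduct.tmul_mul_tmul, mul_one]
  map_star b := by
    rw [coaction_mul, coaction_mul, hv.map_star, coaction_apply b]
    simp only [star_sum, map_sum, TensorProduct.star_tmul, coactionMul_tmul]
    refine Finset.sum_congr rfl fun k _ => ?_
    -- The adjoint reverses the order of the two factors, and commutation restores it.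
    have h1 := commute_coaction (fun n m => commute_linExt huv b n m k) (𝒢.ψ.e k)
    rw [h1.eq, star_mul, hu.map_star, TensorProduct.star_tmul, star_one]
  state b := by
    have h (t : 𝒢.B ⊗[ℂ] D) : sliceLeft 𝒢'.ψ.toLin (coactionMul u t) = sliceLeft 𝒢.ψ.toLin t := by
      induction t using TensorProduct.induction_on with
      | zero => simp
      | add s t hs ht => simp only [map_add, hs, ht]
      | tmul b d =>
        have h1 (s : 𝒢'.B ⊗[ℂ] D) : sliceLeft 𝒢'.ψ.toLin (s * (1 ⊗ₜ d)) =
            sliceLeft 𝒢'.ψ.toLin s * d := by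
          induction s using TensorProduct.induction_on with
          | zero => simp
          | add s t hs ht => simp only [map_add, add_mul, hs, ht]
          | tmul c e => simp [sliceLeft]
        rw [coactionMul_tmul, h1, hu.state]
        simp [sliceLeft]
    rw [coaction_mul, h, hv.state]
  adjacency b := by
    have h (t : 𝒢.B ⊗[ℂ] D) : TensorProduct.map 𝒢'.A LinearMap.id (coactionMul u t) =
        coactionMul u (TensorProduct.map 𝒢.A LinearMap.id t) := by
      induction t using TensorProduct.induction_on with
      | zero => simp
      | add s t hs ht => simp only [map_add, hs, ht]
      | tmul b d =>
        have h1 (s : 𝒢'.B ⊗[ℂ] D) : TensorProduct.map 𝒢'.A LinearMap.id (s * (1 ⊗ₜ d)) =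
            TensorProduct.map 𝒢'.A LinearMap.id s * (1 ⊗ₜ d) := by
          induction s using TensorProduct.induction_on with
          | zero => simp
          | add s t hs ht => simp only [map_add, add_mul, hs, ht]
          | tmul c e => simp
        rw [TensorProduct.map_tmul, coactionMul_tmul, coactionMul_tmul, h1, hu.adjacency]
        rfl
    rw [coaction_mul, coaction_mul, h, hv.adjacency]
  star_mul_self m m' := by
    have h1 (k l) : ∑ n, star (v k m) * (star (u n k) * u n l) * v l m' =
        if k = l then star (v k m) * v l m' else 0 := by
      rw [← Finset.sum_mul, ← Finset.mul_sum, hu.star_mul_self k l]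
      split_ifs <;> simp
    rw [← hv.star_mul_self m m']
    simp only [star_sum, star_mul, Finset.sum_mul_sum]
    rw [Finset.sum_comm]
    refine Finset.sum_congr rfl fun k _ => ?_
    rw [Finset.sum_comm]
    have h2 (l n) : star (v k m) * star (u n k) * (u n l * v l m') =
        star (v k m) * (star (u n k) * u n l) * v l m' := by simp only [mul_assoc]
    simp only [h2, h1, Finset.sum_ite_eq, Finset.mem_univ, if_true]
  mul_star_self n n' := by
    have h1 (k l) : ∑ m, u n k * (v k m * star (v l m)) * star (u n' l) =
        if k = l then u n k * star (u n' l) else 0 := by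
      rw [← Finset.sum_mul, ← Finset.mul_sum, hv.mul_star_self k l]
      split_ifs <;> simp
    rw [← hu.mul_star_self n n']
    simp only [star_sum, star_mul, Finset.sum_mul_sum]
    rw [Finset.sum_comm]
    refine Finset.sum_congr rfl fun k _ => ?_
    rw [Finset.sum_comm]
    have h2 (l m) : u n k * v k m * (star (v l m) * star (u n' l)) =
        u n k * (v k m * star (v l m)) * star (u n' l) := by simp only [mul_assoc]
    simp only [h2, h1, Finset.sum_ite_eq, Finset.mem_univ, if_true]

end Linking

/-! ### Amplification of Cuntz–Krieger families along a coaction -/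

section Amplification

variable {𝒢' 𝒢 : DirectedQuantumGraph.{u}} {D E : Type u} [CStarAlgebra D]
  [NonUnitalCStarAlgebra E]
  {u : Fin (Module.finrank ℂ 𝒢'.ψ.L2) → Fin (Module.finrank ℂ 𝒢.ψ.L2) → D}

/-- The linear map `(φ ⊗ id) β`. -/
def amplify (u : Fin (Module.finrank ℂ 𝒢'.ψ.L2) → Fin (Module.finrank ℂ 𝒢.ψ.L2) → D)
    (φ : 𝒢'.B →ₗ[ℂ] E) : 𝒢.B →ₗ[ℂ] E ⊗[ℂ] D :=
  TensorProduct.map φ LinearMap.id ∘ₗ coaction 𝒢' 𝒢 u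

theorem amplify_apply (φ : 𝒢'.B →ₗ[ℂ] E) (b : 𝒢.B) :
    amplify u φ b = ∑ n, φ (𝒢'.ψ.e n) ⊗ₜ[ℂ] 𝒢.ψ.linExt (u n) b := by
  simp [amplify, coaction_apply]

theorem amplify_e (φ : 𝒢'.B →ₗ[ℂ] E) (m : Fin (Module.finrank ℂ 𝒢.ψ.L2)) :
    amplify u φ (𝒢.ψ.e m) = ∑ n, φ (𝒢'.ψ.e n) ⊗ₜ[ℂ] u n m := by
  simp [amplify, coaction_e]

/-- The amplification is compatible with convolutions. -/
theorem IsLinking.conv_amplify (h : IsLinking 𝒢' 𝒢 u) (φ θ : 𝒢'.B →ₗ[ℂ] E) :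
    𝒢.ψ.conv (amplify u φ) (amplify u θ) = amplify u (𝒢'.ψ.conv φ θ) := by
  ext b
  have h1 (k) : amplify u θ (star (𝒢.ψ.e k) * b) =
      ∑ n, ∑ l, θ (star (𝒢'.ψ.e n) * 𝒢'.ψ.e l) ⊗ₜ[ℂ]
        (star (u n k) * 𝒢.ψ.linExt (u l) b) := by
    rw [amplify, LinearMap.comp_apply, h.map_mul, h.map_star, coaction_e, coaction_apply b]
    simp only [star_sum, TensorProduct.star_tmul, Finset.sum_mul_sum, map_sum,
      Algebra.TensorProduct.tmul_mul_tmul, TensorProduct.map_tmul, LinearMap.id_apply]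
  -- Here u u* = 1 enters. Summing over the basis of B forces n = n' and leaves Σ φ(e_n) θ(e_n*
  -- e_l), which is the convolution over B'.
  have h2 (n n' l) : ∑ k, (φ (𝒢'.ψ.e n) * θ (star (𝒢'.ψ.e n') * 𝒢'.ψ.e l)) ⊗ₜ[ℂ]
      (u n k * (star (u n' k) * 𝒢.ψ.linExt (u l) b)) =
      if n = n' then (φ (𝒢'.ψ.e n) * θ (star (𝒢'.ψ.e n') * 𝒢'.ψ.e l)) ⊗ₜ[ℂ]
        𝒢.ψ.linExt (u l) b else 0 := by
    simp only [← mul_assoc, ← TensorProduct.tmul_sum]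
    rw [← Finset.sum_mul, h.mul_star_self n n']
    split_ifs <;> simp
  have h3 (k) : amplify u φ (𝒢.ψ.e k) * amplify u θ (star (𝒢.ψ.e k) * b) =
      ∑ n, ∑ n', ∑ l, (φ (𝒢'.ψ.e n) * θ (star (𝒢'.ψ.e n') * 𝒢'.ψ.e l)) ⊗ₜ[ℂ]
        (u n k * (star (u n' k) * 𝒢.ψ.linExt (u l) b)) := by
    rw [h1, amplify_e, Finset.sum_mul]
    refine Finset.sum_congr rfl fun n _ => ?_
    rw [Finset.mul_sum]
    refine Finset.sum_congr rfl fun n' _ => ?_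
    rw [Finset.mul_sum]
    simp only [Algebra.TensorProduct.tmul_mul_tmul]
  rw [FaithfulState.conv_apply, amplify_apply]
  simp only [h3, FaithfulState.conv_apply, TensorProduct.sum_tmul]
  -- What remains is reordering of finite sums, bringing k innermost so that `h2` applies.
  rw [Finset.sum_comm, Finset.sum_comm (γ := Fin (Module.finrank ℂ 𝒢'.ψ.L2))
    (f := fun l n => (φ (𝒢'.ψ.e n) * θ (star (𝒢'.ψ.e n) * 𝒢'.ψ.e l)) ⊗ₜ[ℂ] 𝒢.ψ.linExt (u l) b)]
  refine Finset.sum_congr rfl fun n _ => ?_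
  rw [Finset.sum_comm]
  simp only [fun n' => Finset.sum_comm (s := Finset.univ)
    (t := (Finset.univ : Finset (Fin (Module.finrank ℂ 𝒢'.ψ.L2))))
    (f := fun k l => (φ (𝒢'.ψ.e n) * θ (star (𝒢'.ψ.e n') * 𝒢'.ψ.e l)) ⊗ₜ[ℂ]
      (u n k * (star (u n' k) * 𝒢.ψ.linExt (u l) b))), h2]
  rw [Finset.sum_comm]
  simp

/-- β preserves adjoints, so the two stars in `conjMap` pass through it and act on φ alone. The
inclusion is composed in because `conjMap` requires a C*-algebra as target. -/
theorem IsLinking.amplify_conjMap (h : IsLinking 𝒢' 𝒢 u) (φ : 𝒢'.B →ₗ[ℂ] E) :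
    conjMap ((MinTensor.incl E D : E ⊗[ℂ] D →ₗ[ℂ] MinTensor E D) ∘ₗ amplify u φ) =
      (MinTensor.incl E D : E ⊗[ℂ] D →ₗ[ℂ] MinTensor E D) ∘ₗ amplify u (conjMap φ) := by
  ext b
  change star (MinTensor.incl E D _) = MinTensor.incl E D _
  rw [← StarHomClass.map_star]
  congr 1
  have hs (t : 𝒢'.B ⊗[ℂ] D) : star (TensorProduct.map φ LinearMap.id (star t)) =
      TensorProduct.map (conjMap φ) LinearMap.id t := by
    induction t using TensorProduct.induction_on with
    | zero => simp
    | add s t hs ht => simp only [star_add, map_add, hs, ht]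
    | tmul b d => simp [conjMap]
  rw [amplify, amplify, LinearMap.comp_apply, LinearMap.comp_apply, h.map_star, hs]

/-- The amplification of a quantum Cuntz-Krieger family is a quantum Cuntz-Krieger family. -/
theorem IsLinking.isCKFamily_amplify (h : IsLinking 𝒢' 𝒢 u) {s : 𝒢'.B →ₗ[ℂ] E}
    (hs : IsCKFamily 𝒢' s) :
    IsCKFamily 𝒢 ((MinTensor.incl E D : E ⊗[ℂ] D →ₗ[ℂ] MinTensor E D) ∘ₗ amplify u s) := by
  have hc (φ θ : 𝒢.B →ₗ[ℂ] E ⊗[ℂ] D) := 𝒢.ψ.comp_conv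
    (MinTensor.incl E D : E ⊗[ℂ] D →ₙₐ[ℂ] MinTensor E D) φ θ
  change ∀ φ θ, (MinTensor.incl E D : E ⊗[ℂ] D →ₗ[ℂ] MinTensor E D) ∘ₗ _ =
    𝒢.ψ.conv ((MinTensor.incl E D : E ⊗[ℂ] D →ₗ[ℂ] MinTensor E D) ∘ₗ φ)
    ((MinTensor.incl E D : E ⊗[ℂ] D →ₗ[ℂ] MinTensor E D) ∘ₗ θ) at hc
  -- Since β intertwines the adjacency maps, A on the source side becomes A' under the
  -- amplification.
  have hA (φ : 𝒢'.B →ₗ[ℂ] E) : amplify u φ ∘ₗ 𝒢.A = amplify u (φ ∘ₗ 𝒢'.A) := by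
    ext b
    rw [LinearMap.comp_apply, amplify, LinearMap.comp_apply, ← h.adjacency, amplify,
      LinearMap.comp_apply, ← LinearMap.comp_apply, ← TensorProduct.map_comp, LinearMap.id_comp]
  rw [isCKFamily_iff] at hs ⊢
  rw [h.amplify_conjMap, ← hc, ← hc, ← hc, h.conv_amplify, h.conv_amplify, h.conv_amplify,
    hs.1, hs.2, ← hA]
  exact ⟨rfl, rfl⟩

end Amplification

theorem exists_link_hom (𝒢' 𝒢 : DirectedQuantumGraph.{u}) :
    ∃ β' : 𝒢.FO →⋆ₙₐ[ℂ] MinTensor 𝒢'.FO (CLink 𝒢' 𝒢),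
      ∀ b, β' (𝒢.S b) = MinTensor.incl 𝒢'.FO (CLink 𝒢' 𝒢)
        (TensorProduct.map 𝒢'.S LinearMap.id (linkingMap 𝒢' 𝒢 b)) :=
  𝒢.exists_FO_lift _ ((isLinking_linkGen 𝒢' 𝒢).isCKFamily_amplify 𝒢'.isCKFamily_S)
end

noncomputable section

/-! ### Calculus in minimal tensor products -/

namespace MinTensor

section NonUnital

variable {A A' B B' : Type u} [NonUnitalCStarAlgebra A] [NonUnitalCStarAlgebra A']
  [NonUnitalCStarAlgebra B] [NonUnitalCStarAlgebra B']

theorem linearMap_ext {F : Type*} [AddCommGroup F] [Module ℂ F] [TopologicalSpace F] [T2Space F]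
    {f g : MinTensor A B →ₗ[ℂ] F} (hf : Continuous f) (hg : Continuous g)
    (h : ∀ a b, f (incl A B (a ⊗ₜ b)) = g (incl A B (a ⊗ₜ b))) : f = g := by
  ext x
  refine denseRange_incl.induction_on (p := fun x => f x = g x) x (isClosed_eq hf hg) fun t => ?_
  induction t using TensorProduct.induction_on with
  | zero => simp only [map_zero]
  | add s t hs ht => simp only [map_add, hs, ht]
  | tmul a b => exact h a b

theorem incl_tmul_mul (a a' : A) (b b' : B) :
    incl A B (a ⊗ₜ b) * incl A B (a' ⊗ₜ b') = incl A B ((a * a') ⊗ₜ (b * b')) := by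
  rw [← map_mul, Algebra.TensorProduct.tmul_mul_tmul]

theorem star_incl_tmul (a : A) (b : B) :
    star (incl A B (a ⊗ₜ b)) = incl A B (star a ⊗ₜ star b) := by
  rw [← map_star, TensorProduct.star_tmul]

theorem map_incl (f : A →⋆ₙₐ[ℂ] A') (g : B →⋆ₙₐ[ℂ] B') (a : A) (b : B) :
    map f g (incl A B (a ⊗ₜ b)) = incl A' B' (f a ⊗ₜ g b) :=
  CStarSeminorm.lift_coe _ _ _ _

theorem mulLeftRight_incl (c b : B) (a : A) :
    mulLeftRight c (incl A B (a ⊗ₜ b)) = incl A B (a ⊗ₜ (c * b)) :=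
  CStarSeminorm.extendL_coe _ _ _ _ _

theorem mulLeftRight_mulLeftRight (c d : B) (x : MinTensor A B) :
    mulLeftRight c (mulLeftRight d x) = mulLeftRight (c * d) x := by
  refine LinearMap.congr_fun (linearMap_ext
    (f := (mulLeftRight c ∘L mulLeftRight d : MinTensor A B →L[ℂ] MinTensor A B).toLinearMap)
    (g := (mulLeftRight (c * d) : MinTensor A B →L[ℂ] MinTensor A B).toLinearMap)
    (ContinuousLinearMap.continuous _) (ContinuousLinearMap.continuous _) fun a b => ?_) x
  change mulLeftRight c (mulLeftRight d _) = mulLeftRight (c * d) _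
  rw [mulLeftRight_incl, mulLeftRight_incl, mulLeftRight_incl, mul_assoc]

/-- As A may lack a unit, `mulLeftRight c` plays the role of the multiplier 1 ⊗ c. The identity is
checked on elementary tensors, first in x and then in y. -/
theorem mulLeftRight_mul (c : B) (x y : MinTensor A B) :
    mulLeftRight c (x * y) = mulLeftRight c x * y := by
  refine LinearMap.congr_fun (linearMap_ext
    (f := (mulLeftRight c : MinTensor A B →L[ℂ] MinTensor A B).toLinearMap ∘ₗ
      LinearMap.mulRight ℂ y)
    (g := LinearMap.mulRight ℂ y ∘ₗ
      (mulLeftRight c : MinTensor A B →L[ℂ] MinTensor A B).toLinearMap)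
    ((mulLeftRight c).continuous.comp (continuous_mul_const y))
    ((continuous_mul_const y).comp (mulLeftRight c).continuous) fun a b => ?_) x
  change mulLeftRight c (_ * y) = mulLeftRight c _ * y
  refine LinearMap.congr_fun (linearMap_ext
    (f := (mulLeftRight c : MinTensor A B →L[ℂ] MinTensor A B).toLinearMap ∘ₗ
      LinearMap.mulLeft ℂ (incl A B (a ⊗ₜ b)))
    (g := LinearMap.mulLeft ℂ (mulLeftRight c (incl A B (a ⊗ₜ b))))
    ((mulLeftRight c).continuous.comp (continuous_const_mul _))
    (continuous_const_mul _) fun a' b' => ?_) y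
  change mulLeftRight c (_ * _) = mulLeftRight c _ * _
  rw [incl_tmul_mul, mulLeftRight_incl, mulLeftRight_incl, incl_tmul_mul, mul_assoc]

end NonUnital

section RightUnital

variable {A B : Type u} [NonUnitalCStarAlgebra A] [CStarAlgebra B]

theorem mul_mulLeftRight (a : A) (c : B) (x : MinTensor A B) :
    incl A B (a ⊗ₜ 1) * mulLeftRight c x = mulLeftRight c (incl A B (a ⊗ₜ 1) * x) := by
  refine LinearMap.congr_fun (linearMap_ext
    (f := LinearMap.mulLeft ℂ (incl A B (a ⊗ₜ 1)) ∘ₗ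
      (mulLeftRight c : MinTensor A B →L[ℂ] MinTensor A B).toLinearMap)
    (g := (mulLeftRight c : MinTensor A B →L[ℂ] MinTensor A B).toLinearMap ∘ₗ
      LinearMap.mulLeft ℂ (incl A B (a ⊗ₜ 1)))
    ((continuous_const_mul _).comp (mulLeftRight c).continuous)
    ((mulLeftRight c).continuous.comp (continuous_const_mul _)) fun a' b' => ?_) x
  change _ * mulLeftRight c _ = mulLeftRight c (_ * _)
  rw [mulLeftRight_incl, incl_tmul_mul, incl_tmul_mul, mulLeftRight_incl, one_mul, one_mul]

end RightUnital

section Unital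

variable {A B : Type u} [CStarAlgebra A] [CStarAlgebra B]

theorem mulLeftRight_eq (c : B) (x : MinTensor A B) :
    mulLeftRight c x = incl A B (1 ⊗ₜ c) * x := by
  refine LinearMap.congr_fun (linearMap_ext
    (f := (mulLeftRight c : MinTensor A B →L[ℂ] MinTensor A B).toLinearMap)
    (g := LinearMap.mulLeft ℂ (incl A B (1 ⊗ₜ c)))
    (mulLeftRight c).continuous (continuous_const_mul _) fun a' b' => ?_) x
  change mulLeftRight c _ = _ * _
  rw [mulLeftRight_incl, incl_tmul_mul, one_mul]

/-- The minimal tensor product of unital C*-algebras is unital. -/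
@[reducible]
def cstarAlgebra (A B : Type u) [CStarAlgebra A] [CStarAlgebra B] : CStarAlgebra (MinTensor A B) :=
  inferInstanceAs (CStarAlgebra (CStarSeminorm.Completion (P := A ⊗[ℂ] B) (minSeminorm A B)))

end Unital

end MinTensor

/-! ### The associativity graph as a closed *-subalgebra -/

section AssocGraph

variable {A B C : Type u} [NonUnitalCStarAlgebra A] [NonUnitalCStarAlgebra B]
  [NonUnitalCStarAlgebra C]

open MinTensor

/-- The linear map whose range is dense in the graph of the associativity isomorphism. -/
def assocLinear (A B C : Type u) [NonUnitalCStarAlgebra A] [NonUnitalCStarAlgebra B]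
    [NonUnitalCStarAlgebra C] : (A ⊗[ℂ] B) ⊗[ℂ] C →ₗ[ℂ]
      MinTensor (MinTensor A B) C × MinTensor A (MinTensor B C) :=
  LinearMap.prod
    ((incl (MinTensor A B) C : MinTensor A B ⊗[ℂ] C →ₗ[ℂ] MinTensor (MinTensor A B) C) ∘ₗ
      TensorProduct.map (incl A B : A ⊗[ℂ] B →ₗ[ℂ] MinTensor A B) LinearMap.id)
    ((incl A (MinTensor B C) : A ⊗[ℂ] MinTensor B C →ₗ[ℂ] MinTensor A (MinTensor B C)) ∘ₗ
      TensorProduct.map LinearMap.id (incl B C : B ⊗[ℂ] C →ₗ[ℂ] MinTensor B C) ∘ₗ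
      (TensorProduct.assoc ℂ A B C).toLinearMap)

theorem assocLinear_tmul (a : A) (b : B) (c : C) : assocLinear A B C ((a ⊗ₜ b) ⊗ₜ c) =
    (incl (MinTensor A B) C (incl A B (a ⊗ₜ b) ⊗ₜ c),
      incl A (MinTensor B C) (a ⊗ₜ incl B C (b ⊗ₜ c))) := rfl

theorem assocLinear_mem (t : (A ⊗[ℂ] B) ⊗[ℂ] C) : assocLinear A B C t ∈ assocGraph A B C :=
  subset_closure ⟨t, rfl⟩

theorem assocLinear_mul (s t : (A ⊗[ℂ] B) ⊗[ℂ] C) :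
    assocLinear A B C (s * t) = assocLinear A B C s * assocLinear A B C t := by
  have h : assocLinear A B C ∘ₗ LinearMap.mulLeft ℂ s =
      LinearMap.mulLeft ℂ (assocLinear A B C s) ∘ₗ assocLinear A B C := by
    refine TensorProduct.ext_threefold fun a b c => ?_
    change assocLinear A B C (s * _) = assocLinear A B C s * _
    have h' : assocLinear A B C ∘ₗ LinearMap.mulRight ℂ ((a ⊗ₜ[ℂ] b) ⊗ₜ[ℂ] c) =
        LinearMap.mulRight ℂ (assocLinear A B C ((a ⊗ₜ[ℂ] b) ⊗ₜ[ℂ] c)) ∘ₗ assocLinear A B C := by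
      refine TensorProduct.ext_threefold fun a' b' c' => ?_
      change assocLinear A B C (_ * _) = _ * _
      rw [Algebra.TensorProduct.tmul_mul_tmul, Algebra.TensorProduct.tmul_mul_tmul,
        assocLinear_tmul, assocLinear_tmul, assocLinear_tmul, Prod.mk_mul_mk, incl_tmul_mul,
        incl_tmul_mul, incl_tmul_mul, incl_tmul_mul]
    exact LinearMap.congr_fun h' s
  exact LinearMap.congr_fun h t

/-- Having some preimage of the adjoint is all that is needed for the closure of the range to be
stable under star. -/
theorem exists_assocLinear_eq_star (t : (A ⊗[ℂ] B) ⊗[ℂ] C) :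
    ∃ s, assocLinear A B C s = star (assocLinear A B C t) := by
  induction t using TensorProduct.induction_on with
  | zero => exact ⟨0, by rw [map_zero, star_zero]⟩
  | add s t hs ht =>
    obtain ⟨s', hs⟩ := hs
    obtain ⟨t', ht⟩ := ht
    exact ⟨s' + t', by rw [map_add, map_add, star_add, hs, ht]⟩
  | tmul t c =>
    induction t using TensorProduct.induction_on with
    | zero => exact ⟨0, by rw [TensorProduct.zero_tmul, map_zero, star_zero]⟩
    | add s t hs ht =>
      obtain ⟨s', hs⟩ := hs
      obtain ⟨t', ht⟩ := ht
      exact ⟨s' + t', by rw [TensorProduct.add_tmul, map_add, map_add, star_add, hs, ht]⟩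
    | tmul a b =>
      refine ⟨(star a ⊗ₜ star b) ⊗ₜ star c, ?_⟩
      rw [assocLinear_tmul, assocLinear_tmul]
      refine Prod.ext ?_ ?_
      · change _ = star (incl _ _ _)
        rw [star_incl_tmul, star_incl_tmul]
      · change _ = star (incl _ _ _)
        rw [star_incl_tmul, star_incl_tmul]

/-- The graph of the associativity isomorphism is a closed *-subalgebra. -/
def assocSubalgebra (A B C : Type u) [NonUnitalCStarAlgebra A] [NonUnitalCStarAlgebra B]
    [NonUnitalCStarAlgebra C] :
    NonUnitalStarSubalgebra ℂ (MinTensor (MinTensor A B) C × MinTensor A (MinTensor B C)) where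
  carrier := assocGraph A B C
  add_mem' {x y} hx hy := map_mem_closure₂ continuous_add hx hy (by
    rintro _ ⟨s, rfl⟩ _ ⟨t, rfl⟩
    exact ⟨s + t, map_add (assocLinear A B C) s t⟩)
  zero_mem' := subset_closure ⟨0, map_zero (assocLinear A B C)⟩
  mul_mem' {x y} hx hy := map_mem_closure₂ continuous_mul hx hy (by
    rintro _ ⟨s, rfl⟩ _ ⟨t, rfl⟩
    exact ⟨s * t, assocLinear_mul s t⟩)
  smul_mem' c x hx := map_mem_closure (continuous_const_smul c) hx (by
    rintro _ ⟨s, rfl⟩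
    exact ⟨c • s, map_smul (assocLinear A B C) c s⟩)
  star_mem' {x} hx := map_mem_closure continuous_star hx (by
    rintro _ ⟨s, rfl⟩
    exact exists_assocLinear_eq_star s)

/-- Coassociativity of a coaction can be checked on generators. -/
theorem assocGraph_of_generators {C E : Type u} [CStarAlgebra C] [NonUnitalCStarAlgebra E]
    (Δ : C →⋆ₙₐ[ℂ] MinTensor C C) (α : E →⋆ₙₐ[ℂ] MinTensor E C) (G : Set E)
    (hG : ∀ T : NonUnitalStarSubalgebra ℂ E, IsClosed (T : Set E) → G ⊆ T → ∀ x, x ∈ T)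
    (h : ∀ x ∈ G, (map α (NonUnitalStarAlgHom.id ℂ C) (α x),
      map (NonUnitalStarAlgHom.id ℂ E) Δ (α x)) ∈ assocGraph E C C) (x : E) :
    (map α (NonUnitalStarAlgHom.id ℂ C) (α x),
      map (NonUnitalStarAlgHom.id ℂ E) Δ (α x)) ∈ assocGraph E C C := by
  -- Bundling the two composites into one *-homomorphism makes the coassociativity locus the
  -- preimage of a closed *-subalgebra.
  let f : E →⋆ₙₐ[ℂ] MinTensor (MinTensor E C) C × MinTensor E (MinTensor C C) :=
    ((map α (NonUnitalStarAlgHom.id ℂ C)).comp α).prod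
      ((map (NonUnitalStarAlgHom.id ℂ E) Δ).comp α)
  have hf : Continuous f :=
    (continuous_nonUnitalStarAlgHom ((map α (NonUnitalStarAlgHom.id ℂ C)).comp α)).prodMk
      (continuous_nonUnitalStarAlgHom ((map (NonUnitalStarAlgHom.id ℂ E) Δ).comp α))
  exact hG ((assocSubalgebra E C C).comap f) (isClosed_closure.preimage hf) h x

end AssocGraph
end

noncomputable section

open MinTensor

theorem MinTensor.norm_incl_tmul_le {A B : Type u} [NonUnitalCStarAlgebra A]
    [NonUnitalCStarAlgebra B] (a : A) (b : B) : ‖incl A B (a ⊗ₜ b)‖ ≤ ‖a‖ * ‖b‖ := by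
  rw [norm_incl]
  exact minSeminorm_le _ (by positivity) fun r => (TensorProduct.norm_mapL_le _ _).trans
    (mul_le_mul (NonUnitalStarAlgHom.norm_apply_le r.left a)
      (NonUnitalStarAlgHom.norm_apply_le r.right b) (norm_nonneg _) (norm_nonneg _))

theorem MinTensor.continuous_incl_left {A B : Type u} [NonUnitalCStarAlgebra A]
    [NonUnitalCStarAlgebra B] (b : B) : Continuous fun a : A => incl A B (a ⊗ₜ b) :=
  AddMonoidHomClass.continuous_of_bound
    ((incl A B : A ⊗[ℂ] B →ₗ[ℂ] MinTensor A B) ∘ₗ (TensorProduct.mk ℂ A B).flip b) ‖b‖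
    fun a => (norm_incl_tmul_le a b).trans_eq (mul_comm _ _)

theorem MinTensor.continuous_incl_right {A B : Type u} [NonUnitalCStarAlgebra A]
    [NonUnitalCStarAlgebra B] (a : A) : Continuous fun b : B => incl A B (a ⊗ₜ b) :=
  AddMonoidHomClass.continuous_of_bound
    ((incl A B : A ⊗[ℂ] B →ₗ[ℂ] MinTensor A B) ∘ₗ TensorProduct.mk ℂ A B a) ‖a‖
    fun b => norm_incl_tmul_le a b

/-! ### Adjoints of the coefficients and generation of the linking algebra -/

section Stars

variable {𝒢' 𝒢 : DirectedQuantumGraph.{u}} {D : Type u} [CStarAlgebra D]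
  {u : Fin (Module.finrank ℂ 𝒢'.ψ.L2) → Fin (Module.finrank ℂ 𝒢.ψ.L2) → D}

/-- The entries of a matrix satisfying the linking relations are linear combinations of the
adjoints of the entries. -/
theorem IsLinking.mem_of_star_mem (h : IsLinking 𝒢' 𝒢 u) (V : Submodule ℂ D)
    (hV : ∀ n m, star (u n m) ∈ V) (n m) : u n m ∈ V := by
  -- Writing e_m as the adjoint of e_m* turns β(e_m) into β(e_m*)*, whose coordinates are
  -- combinations of adjoints of entries.
  have h1 : u n m = 𝒢'.ψ.coord n (coaction 𝒢' 𝒢 u (star (star (𝒢.ψ.e m)))) := by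
    rw [star_star, coaction_e, FaithfulState.coord_sum]
  rw [h1, h.map_star, coaction_apply, star_sum, map_sum]
  refine sum_mem fun k _ => ?_
  rw [TensorProduct.star_tmul, FaithfulState.coord_tmul, FaithfulState.linExt_apply, star_sum]
  refine V.smul_mem _ (sum_mem fun l _ => ?_)
  rw [star_smul]
  exact V.smul_mem _ (hV k l)

/-- Since ψ(1) = 1, the algebra B is nonzero. This supplies the column used in `link_induction`. -/
theorem FaithfulState.nonempty_index {B : Type u} [CStarAlgebra B] [FiniteDimensional ℂ B]
    (ψ : FaithfulState B) : Nonempty (Fin (Module.finrank ℂ ψ.L2)) := by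
  by_contra hn
  rw [not_nonempty_iff] at hn
  have h1 := ψ.sum_e 1
  rw [Finset.univ_eq_empty, Finset.sum_empty] at h1
  have h2 := ψ.map_one
  rw [← h1, map_zero] at h2
  exact zero_ne_one h2

theorem FaithfulState.sum_star_e {B : Type u} [CStarAlgebra B] [FiniteDimensional ℂ B]
    (ψ : FaithfulState B) (b : B) :
    ∑ k, star (ψ.toLin (star (ψ.e k) * star b)) • star (ψ.e k) = b := by
  have h := congrArg star (ψ.sum_e (star b))
  rwa [star_sum, star_star, Finset.sum_congr rfl fun k _ => star_smul _ _] at h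

/-- A closed *-subalgebra containing the generators of `C(G⁺(𝒢', 𝒢))` is everything. -/
theorem link_induction (T : NonUnitalStarSubalgebra ℂ (CLink 𝒢' 𝒢))
    (hT : IsClosed (T : Set (CLink 𝒢' 𝒢))) (hg : ∀ n m, linkGen 𝒢' 𝒢 n m ∈ T)
    (x : CLink 𝒢' 𝒢) : x ∈ T := by
  obtain ⟨m⟩ := 𝒢.ψ.nonempty_index
  -- One column of u already yields 1 = Σ u_nm* u_nm, so closed *-subalgebras not assumed unital
  -- suffice.
  have h1 : (1 : CLink 𝒢' 𝒢) ∈ T := by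
    have h2 := (isLinking_linkGen 𝒢' 𝒢).star_mul_self m m
    rw [if_pos rfl] at h2
    rw [← h2]
    exact sum_mem fun n _ => mul_mem (star_mem (hg n m)) (hg n m)
  let T' : StarSubalgebra ℂ (CLink 𝒢' 𝒢) :=
    { T with
      one_mem' := h1
      algebraMap_mem' := fun c => by
        rw [Algebra.algebraMap_eq_smul_one]; exact SMulMemClass.smul_mem c h1 }
  exact (linkRelations 𝒢' 𝒢).universal_induction T' hT (fun x => hg x.down.1 x.down.2) x

end Stars

/-! ### The comultiplication -/

section Comultiplication

theorem exists_comul (𝒢 : DirectedQuantumGraph.{u}) :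
    ∃ Δ : CLink 𝒢 𝒢 →⋆ₙₐ[ℂ] MinTensor (CLink 𝒢 𝒢) (CLink 𝒢 𝒢), Δ 1 = incl _ _ (1 ⊗ₜ 1) ∧
      ∀ n m, Δ (linkGen 𝒢 𝒢 n m) =
        ∑ k, incl _ _ (linkGen 𝒢 𝒢 n k ⊗ₜ linkGen 𝒢 𝒢 k m) := by
  let _ : CStarAlgebra (MinTensor (CLink 𝒢 𝒢) (CLink 𝒢 𝒢)) := cstarAlgebra _ _
  have hone : (1 : MinTensor (CLink 𝒢 𝒢) (CLink 𝒢 𝒢)) = incl _ _ (1 ⊗ₜ 1) := rfl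
  -- The two leg embeddings have commuting ranges, so `IsLinking.mul` applies to the matrices u ⊗ 1
  -- and 1 ⊗ u, and Δ comes from universality.
  let j₁ : CLink 𝒢 𝒢 →⋆ₐ[ℂ] MinTensor (CLink 𝒢 𝒢) (CLink 𝒢 𝒢) :=
    { toFun := fun c => incl _ _ (c ⊗ₜ 1)
      map_one' := rfl
      map_mul' := fun c d => (by rw [incl_tmul_mul, mul_one] : incl _ _ ((c * d) ⊗ₜ 1) =
        incl _ _ (c ⊗ₜ 1) * incl _ _ (d ⊗ₜ 1))
      map_zero' := by rw [TensorProduct.zero_tmul]; exact map_zero (incl _ _)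
      map_add' := fun c d => by rw [TensorProduct.add_tmul]; exact map_add (incl _ _) _ _
      commutes' := fun c => by
        rw [Algebra.algebraMap_eq_smul_one, Algebra.algebraMap_eq_smul_one, hone,
          ← TensorProduct.smul_tmul']
        exact map_smul (incl _ _) _ _
      map_star' := fun c => (by rw [star_incl_tmul, star_one] : incl _ _ (star c ⊗ₜ 1) =
        star (incl _ _ (c ⊗ₜ 1))) }
  let j₂ : CLink 𝒢 𝒢 →⋆ₐ[ℂ] MinTensor (CLink 𝒢 𝒢) (CLink 𝒢 𝒢) :=
    { toFun := fun c => incl _ _ (1 ⊗ₜ c)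
      map_one' := rfl
      map_mul' := fun c d => (by rw [incl_tmul_mul, mul_one] : incl _ _ (1 ⊗ₜ (c * d)) =
        incl _ _ (1 ⊗ₜ c) * incl _ _ (1 ⊗ₜ d))
      map_zero' := by rw [TensorProduct.tmul_zero]; exact map_zero (incl _ _)
      map_add' := fun c d => by rw [TensorProduct.tmul_add]; exact map_add (incl _ _) _ _
      commutes' := fun c => by
        rw [Algebra.algebraMap_eq_smul_one, Algebra.algebraMap_eq_smul_one, hone,
          TensorProduct.tmul_smul]
        exact map_smul (incl _ _) _ _
      map_star' := fun c => (by rw [star_incl_tmul, star_one] : incl _ _ (1 ⊗ₜ star c) =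
        star (incl _ _ (1 ⊗ₜ c))) }
  have hj (c d : CLink 𝒢 𝒢) : j₁ c * j₂ d = incl _ _ (c ⊗ₜ d) :=
    (incl_tmul_mul _ _ _ _).trans (by rw [mul_one, one_mul])
  have hj' (c d : CLink 𝒢 𝒢) : j₂ d * j₁ c = incl _ _ (c ⊗ₜ d) :=
    (incl_tmul_mul _ _ _ _).trans (by rw [mul_one, one_mul])
  have hu := isLinking_linkGen 𝒢 𝒢
  obtain ⟨Δ, hΔ⟩ := exists_link_lift ((hu.comp j₁).mul (hu.comp j₂)
    fun n k l m => (hj _ _).trans (hj' _ _).symm)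
  refine ⟨(Δ : CLink 𝒢 𝒢 →⋆ₙₐ[ℂ] MinTensor (CLink 𝒢 𝒢) (CLink 𝒢 𝒢)), map_one Δ, fun n m => ?_⟩
  refine (hΔ n m).trans (Finset.sum_congr rfl fun k _ => hj _ _)

end Comultiplication

/-! ### Actions given on generators by a linking matrix -/

section Action

variable {𝒢 : DirectedQuantumGraph.{u}} {C E : Type u} [CStarAlgebra C] [NonUnitalCStarAlgebra E]
  {u : Fin (Module.finrank ℂ 𝒢.ψ.L2) → Fin (Module.finrank ℂ 𝒢.ψ.L2) → C}

/-- The density condition for maps that are given on generators by a matrix satisfying the linking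
relations. -/
theorem IsLinking.dense_action (h : IsLinking 𝒢 𝒢 u) {ι : Type*} (s : ι → 𝒢.B →ₗ[ℂ] E)
    (hs : ∀ T : NonUnitalStarSubalgebra ℂ E, IsClosed (T : Set E) → (∀ i b, s i b ∈ T) →
      ∀ x, x ∈ T)
    (α : E →⋆ₙₐ[ℂ] MinTensor E C) (hα : ∀ i b, α (s i b) = incl E C (amplify u (s i) b)) :
    closure (Submodule.span ℂ (Set.range fun x : C × E => mulLeftRight x.1 (α x.2)) :
      Set (MinTensor E C)) = Set.univ := by
  set L : Submodule ℂ (MinTensor E C) := (Submodule.span ℂ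
    (Set.range fun x : C × E => mulLeftRight x.1 (α x.2))).topologicalClosure with hL
  have hLc : IsClosed (L : Set (MinTensor E C)) := Submodule.isClosed_topologicalClosure _
  have hgen (c : C) (x : E) : mulLeftRight c (α x) ∈ L :=
    Submodule.le_topologicalClosure _ (Submodule.subset_span ⟨(c, x), rfl⟩)
  have hind (f : MinTensor E C →ₗ[ℂ] MinTensor E C) (hf : Continuous f)
      (hfg : ∀ c x, f (mulLeftRight c (α x)) ∈ L) (y : MinTensor E C) (hy : y ∈ L) : f y ∈ L := by
    have h1 : (Submodule.span ℂ (Set.range fun x : C × E => mulLeftRight x.1 (α x.2))) ≤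
        L.comap f := Submodule.span_le.mpr (by rintro _ ⟨⟨c, x⟩, rfl⟩; exact hfg c x)
    exact Submodule.topologicalClosure_minimal _ h1 (hLc.preimage hf) hy
  have hmul (d : C) (y : MinTensor E C) (hy : y ∈ L) : mulLeftRight d y ∈ L :=
    hind (mulLeftRight d : MinTensor E C →L[ℂ] MinTensor E C).toLinearMap
      (ContinuousLinearMap.continuous _) (fun c x => by
        change mulLeftRight d (mulLeftRight c (α x)) ∈ L
        rw [mulLeftRight_mulLeftRight]
        exact hgen _ _) y hy
  have hright (z : E) (y : MinTensor E C) (hy : y ∈ L) : y * α z ∈ L :=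
    hind (LinearMap.mulRight ℂ (α z)) (continuous_mul_const _) (fun c x => by
      change mulLeftRight c (α x) * α z ∈ L
      rw [← mulLeftRight_mul, ← _root_.map_mul]
      exact hgen _ _) y hy
  -- Commuting legs give (x ⊗ 1)(1 ⊗ c)α(z) = (1 ⊗ c)(x ⊗ 1)α(z), and L is stable under α(z) on the
  -- right and 1 ⊗ c on the left.
  have hleft (x : E) (hx : incl E C (x ⊗ₜ 1) ∈ L) (y : MinTensor E C) (hy : y ∈ L) :
      incl E C (x ⊗ₜ 1) * y ∈ L :=
    hind (LinearMap.mulLeft ℂ (incl E C (x ⊗ₜ 1))) (continuous_const_mul _) (fun c z => by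
      change _ * mulLeftRight c (α z) ∈ L
      rw [mul_mulLeftRight]
      exact hmul _ _ (hright _ _ hx)) y hy
  have hstar (i) (b : 𝒢.B) : amplify u (s i) (star b) =
      ∑ n, s i (star (𝒢.ψ.e n)) ⊗ₜ[ℂ] star (𝒢.ψ.linExt (u n) b) := by
    rw [amplify, LinearMap.comp_apply, h.map_star, coaction_apply]
    simp only [star_sum, TensorProduct.star_tmul, map_sum, TensorProduct.map_tmul,
      LinearMap.id_apply]
  -- Multiplying by row l of u inverts the coaction, because Σ_m u_lm u_nm* = δ_ln.
  have hsum (F : Fin (Module.finrank ℂ 𝒢.ψ.L2) → E) (l) :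
      ∑ m, mulLeftRight (u l m) (incl E C (∑ n, F n ⊗ₜ star (u n m))) = incl E C (F l ⊗ₜ 1) := by
    simp only [map_sum, mulLeftRight_incl]
    rw [Finset.sum_comm]
    simp only [← map_sum, ← TensorProduct.tmul_sum, h.mul_star_self]
    congr 1
    rw [Finset.sum_eq_single l]
    · rw [if_pos rfl]
    · intro n _ hn
      rw [if_neg (Ne.symm hn), TensorProduct.tmul_zero]
    · exact fun hl => absurd (Finset.mem_univ l) hl
  -- The vectors e_l* are used because α(s(e_m*)) has the adjoints u_nm* as coefficients, the form
  -- `hsum` needs. They also span B.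
  have hS (i) (b : 𝒢.B) : incl E C (s i b ⊗ₜ 1) ∈ L := by
    have h1 (l) : incl E C (s i (star (𝒢.ψ.e l)) ⊗ₜ 1) ∈ L := by
      rw [← hsum (fun n => s i (star (𝒢.ψ.e n))) l]
      refine sum_mem fun m _ => ?_
      have h2 := hgen (u l m) (s i (star (𝒢.ψ.e m)))
      rw [hα, hstar] at h2
      simpa only [FaithfulState.linExt_e] using h2
    rw [← 𝒢.ψ.sum_star_e b]
    simp only [map_sum, map_smul, TensorProduct.sum_tmul, ← TensorProduct.smul_tmul']
    exact sum_mem fun k _ => L.smul_mem _ (h1 k)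
  have hS' (i) (b : 𝒢.B) : incl E C (star (s i b) ⊗ₜ 1) ∈ L := by
    have h1 (l) : incl E C (star (s i (𝒢.ψ.e l)) ⊗ₜ 1) ∈ L := by
      rw [← hsum (fun n => star (s i (𝒢.ψ.e n))) l]
      refine sum_mem fun m _ => ?_
      have h2 := hgen (u l m) (star (s i (𝒢.ψ.e m)))
      rw [StarHomClass.map_star, hα, ← StarHomClass.map_star, amplify_e, star_sum] at h2
      simpa only [TensorProduct.star_tmul] using h2
    rw [← 𝒢.ψ.sum_e b]
    simp only [map_sum, map_smul, star_sum, star_smul, TensorProduct.sum_tmul,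
      ← TensorProduct.smul_tmul']
    exact sum_mem fun k _ => L.smul_mem _ (h1 k)
  -- L is not known to be self-adjoint, so membership is imposed on both x and x*.
  let T : NonUnitalStarSubalgebra ℂ E := {
    carrier := {x | incl E C (x ⊗ₜ 1) ∈ L ∧ incl E C (star x ⊗ₜ 1) ∈ L}
    add_mem' := fun {x y} hx hy => by
      constructor
      · rw [TensorProduct.add_tmul, map_add]; exact add_mem hx.1 hy.1
      · rw [star_add, TensorProduct.add_tmul, map_add]; exact add_mem hx.2 hy.2
    zero_mem' := by simp
    mul_mem' := fun {x y} hx hy => by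
      constructor
      · rw [← mul_one (1 : C), ← incl_tmul_mul]; exact hleft _ hx.1 _ hy.1
      · rw [← mul_one (1 : C), star_mul, ← incl_tmul_mul]; exact hleft _ hy.2 _ hx.2
    smul_mem' := fun c x hx => by
      constructor
      · rw [← TensorProduct.smul_tmul', map_smul]; exact L.smul_mem _ hx.1
      · rw [star_smul, ← TensorProduct.smul_tmul', map_smul]; exact L.smul_mem _ hx.2
    star_mem' := fun {x} hx => ⟨hx.2, by rw [star_star]; exact hx.1⟩ }
  have hinc : Continuous fun x : E => incl E C (x ⊗ₜ 1) :=
    continuous_incl_left 1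
  have hT (x : E) : x ∈ T :=
    hs T ((hLc.preimage hinc).inter (hLc.preimage (hinc.comp continuous_star)))
      (fun i b => ⟨hS i b, hS' i b⟩) x
  have hall (t : E ⊗[ℂ] C) : incl E C t ∈ L := by
    induction t using TensorProduct.induction_on with
    | zero => rw [map_zero]; exact zero_mem _
    | add s t hs ht => rw [map_add]; exact add_mem hs ht
    | tmul x c =>
      have h1 := hmul c _ (hT x).1
      rwa [mulLeftRight_incl, mul_one] at h1
  exact Set.eq_univ_of_forall fun x => denseRange_incl.induction_on (p := (· ∈ L)) x hLc hall

/-- A map that is given on generators by a matrix satisfying the linking relations is an action. -/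
theorem IsLinking.isAction (h : IsLinking 𝒢 𝒢 u) {Δ : C →⋆ₙₐ[ℂ] MinTensor C C}
    (hΔ : ∀ n m, Δ (u n m) = ∑ k, incl C C (u n k ⊗ₜ u k m)) {ι : Type*} (s : ι → 𝒢.B →ₗ[ℂ] E)
    (hs : ∀ T : NonUnitalStarSubalgebra ℂ E, IsClosed (T : Set E) → (∀ i b, s i b ∈ T) →
      ∀ x, x ∈ T)
    (α : E →⋆ₙₐ[ℂ] MinTensor E C) (hα : ∀ i b, α (s i b) = incl E C (amplify u (s i) b)) :
    IsAction Δ α where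
  coaction := by
    refine assocGraph_of_generators Δ α (Set.range fun x : ι × Fin _ => s x.1 (𝒢.ψ.e x.2)) ?_ ?_
    · refine fun T hT hT' => hs T hT fun i b => ?_
      rw [← 𝒢.ψ.sum_e b, map_sum]
      refine sum_mem fun k _ => ?_
      rw [map_smul]
      exact SMulMemClass.smul_mem _ (hT' ⟨(i, k), rfl⟩)
    · rintro _ ⟨⟨i, m⟩, rfl⟩
      -- Both iterated coactions come from the algebraic tensor Σ s(e_k) ⊗ u_kn ⊗ u_nm, so the pair
      -- lies in the graph before any closure.
      have h1 : (map α (NonUnitalStarAlgHom.id ℂ C) (α (s i (𝒢.ψ.e m))),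
          map (NonUnitalStarAlgHom.id ℂ E) Δ (α (s i (𝒢.ψ.e m)))) =
          assocLinear E C C (∑ n, ∑ k, (s i (𝒢.ψ.e k) ⊗ₜ u k n) ⊗ₜ u n m) := by
        have hC (c : C) : NonUnitalStarAlgHom.id ℂ C c = c := rfl
        have hE (x : E) : NonUnitalStarAlgHom.id ℂ E x = x := rfl
        have h2 (n k) := assocLinear_tmul (s i (𝒢.ψ.e k)) (u k n) (u n m)
        simp only [map_sum, h2]
        simp only [hα, amplify_e, map_sum, map_incl, hC, hE, hΔ,
          TensorProduct.sum_tmul, TensorProduct.tmul_sum]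
        refine Prod.ext ?_ ?_
        · simp only [Prod.fst_sum]
        · simp only [Prod.snd_sum]
          exact Finset.sum_comm
      rw [h1]
      exact assocLinear_mem _
  dense := h.dense_action s hs α hα

end Action
end

noncomputable section

open MinTensor

/-! ### The compact quantum group structure -/

section CompactQuantumGroup

variable {𝒢 : DirectedQuantumGraph.{u}}
  {Δ : CLink 𝒢 𝒢 →⋆ₙₐ[ℂ] MinTensor (CLink 𝒢 𝒢) (CLink 𝒢 𝒢)}

/-- The rows of u, read as linear maps B → C, generate C, and Δ acts on them as the amplification by
u. The general result on actions applies with E = C and yields coassociativity and one of the two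
density conditions. -/
theorem isAction_comul (hΔ : ∀ n m, Δ (linkGen 𝒢 𝒢 n m) =
    ∑ k, incl _ _ (linkGen 𝒢 𝒢 n k ⊗ₜ linkGen 𝒢 𝒢 k m)) : IsAction Δ Δ := by
  refine (isLinking_linkGen 𝒢 𝒢).isAction hΔ (fun n => 𝒢.ψ.linExt (linkGen 𝒢 𝒢 n))
    (fun T hT h => link_induction T hT fun n m => ?_) Δ fun n b => ?_
  · rw [← 𝒢.ψ.linExt_e (linkGen 𝒢 𝒢 n) m]
    exact h n _
  · have h : (Δ : CLink 𝒢 𝒢 →ₗ[ℂ] MinTensor (CLink 𝒢 𝒢) (CLink 𝒢 𝒢)) ∘ₗ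
        𝒢.ψ.linExt (linkGen 𝒢 𝒢 n) =
        (incl (CLink 𝒢 𝒢) (CLink 𝒢 𝒢) : CLink 𝒢 𝒢 ⊗[ℂ] CLink 𝒢 𝒢 →ₗ[ℂ] MinTensor (CLink 𝒢 𝒢) (CLink 𝒢 𝒢)) ∘ₗ
        amplify (linkGen 𝒢 𝒢) (𝒢.ψ.linExt (linkGen 𝒢 𝒢 n)) :=
      𝒢.ψ.linearMap_ext fun m => by
        change Δ _ = incl _ _ _
        rw [FaithfulState.linExt_e, hΔ, amplify_e, map_sum]
        simp only [FaithfulState.linExt_e]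
    exact LinearMap.congr_fun h b

/-- The adjoints of the elements of a dense span have dense span. -/
theorem dense_span_of_star {M : Type u} [NonUnitalCStarAlgebra M] {ι κ : Type*} {f : ι → M}
    {g : κ → M} (hfg : ∀ i, ∃ k, g k = star (f i))
    (hf : closure (Submodule.span ℂ (Set.range f) : Set M) = Set.univ) :
    closure (Submodule.span ℂ (Set.range g) : Set M) = Set.univ := by
  have h1 (x : M) (hx : x ∈ Submodule.span ℂ (Set.range f)) :
      star x ∈ Submodule.span ℂ (Set.range g) := by
    induction hx using Submodule.span_induction with
    | mem x hx =>
      obtain ⟨i, rfl⟩ := hx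
      obtain ⟨k, hk⟩ := hfg i
      exact hk ▸ Submodule.subset_span ⟨k, rfl⟩
    | zero => rw [star_zero]; exact zero_mem _
    | add x y _ _ hx hy => rw [star_add]; exact add_mem hx hy
    | smul c x _ hx => rw [star_smul]; exact Submodule.smul_mem _ _ hx
  refine Set.eq_univ_of_forall fun x => ?_
  have h2 : star x ∈ closure (Submodule.span ℂ (Set.range f) : Set M) := hf ▸ Set.mem_univ _
  have h3 := map_mem_closure continuous_star h2 h1
  rwa [star_star] at h3

/-- This condition uses the other half of unitarity: u*u = 1 gives Σ_n Δ(u_nm*)(u_nl ⊗ 1) = 1 ⊗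
u_lm*. -/
theorem dense_comul_left (hΔ : ∀ n m, Δ (linkGen 𝒢 𝒢 n m) =
    ∑ k, incl _ _ (linkGen 𝒢 𝒢 n k ⊗ₜ linkGen 𝒢 𝒢 k m)) :
    closure (Submodule.span ℂ (Set.range fun x : CLink 𝒢 𝒢 × CLink 𝒢 𝒢 =>
      Δ x.1 * incl _ _ (x.2 ⊗ₜ 1)) : Set (MinTensor (CLink 𝒢 𝒢) (CLink 𝒢 𝒢))) = Set.univ := by
  let C := CLink 𝒢 𝒢
  let u := linkGen 𝒢 𝒢
  set L : Submodule ℂ (MinTensor (CLink 𝒢 𝒢) (CLink 𝒢 𝒢)) := (Submodule.span ℂ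
    (Set.range fun x : CLink 𝒢 𝒢 × CLink 𝒢 𝒢 =>
      Δ x.1 * incl _ _ (x.2 ⊗ₜ 1))).topologicalClosure with hL
  have hLc : IsClosed (L : Set (MinTensor C C)) := Submodule.isClosed_topologicalClosure _
  have hgen (x c : C) : Δ x * incl C C (c ⊗ₜ 1) ∈ L :=
    Submodule.le_topologicalClosure _ (Submodule.subset_span ⟨(x, c), rfl⟩)
  have hind (f : MinTensor C C →ₗ[ℂ] MinTensor C C) (hf : Continuous f)
      (hfg : ∀ x c, f (Δ x * incl C C (c ⊗ₜ 1)) ∈ L) (y : MinTensor C C) (hy : y ∈ L) :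
      f y ∈ L := by
    have h1 : (Submodule.span ℂ (Set.range fun x : C × C => Δ x.1 * incl C C (x.2 ⊗ₜ 1))) ≤
        L.comap f := Submodule.span_le.mpr (by rintro _ ⟨⟨c, x⟩, rfl⟩; exact hfg c x)
    exact Submodule.topologicalClosure_minimal _ h1 (hLc.preimage hf) hy
  have hright (d : C) (y : MinTensor C C) (hy : y ∈ L) : y * incl C C (d ⊗ₜ 1) ∈ L :=
    hind (LinearMap.mulRight ℂ (incl C C (d ⊗ₜ 1))) (continuous_mul_const _) (fun x c => by
      change Δ x * incl C C (c ⊗ₜ 1) * incl C C (d ⊗ₜ 1) ∈ L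
      rw [mul_assoc, incl_tmul_mul, mul_one]
      exact hgen _ _) y hy
  have hleft (z : C) (y : MinTensor C C) (hy : y ∈ L) : Δ z * y ∈ L :=
    hind (LinearMap.mulLeft ℂ (Δ z)) (continuous_const_mul _) (fun x c => by
      change Δ z * (Δ x * incl C C (c ⊗ₜ 1)) ∈ L
      rw [← mul_assoc, ← map_mul]
      exact hgen _ _) y hy
  -- Move 1 ⊗ z past c ⊗ 1; then Δ(x)(1 ⊗ z)(c ⊗ 1) stays in L by stability under Δ(x) on the left
  -- and c ⊗ 1 on the right.
  have hmul (z : C) (hz : incl C C (1 ⊗ₜ z) ∈ L) (y : MinTensor C C) (hy : y ∈ L) :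
      y * incl C C (1 ⊗ₜ z) ∈ L :=
    hind (LinearMap.mulRight ℂ (incl C C (1 ⊗ₜ z))) (continuous_mul_const _) (fun x c => by
      change Δ x * incl C C (c ⊗ₜ 1) * incl C C (1 ⊗ₜ z) ∈ L
      have h1 : incl C C (c ⊗ₜ 1) * incl C C (1 ⊗ₜ z) =
          incl C C (1 ⊗ₜ z) * incl C C (c ⊗ₜ 1) := by
        rw [incl_tmul_mul, incl_tmul_mul, mul_one, mul_one, one_mul, one_mul]
      rw [mul_assoc, h1]
      exact hleft _ _ (hright _ _ hz)) y hy
  have hu := isLinking_linkGen 𝒢 𝒢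
  have hstar (l m) : incl C C (1 ⊗ₜ star (u l m)) ∈ L := by
    have h1 : ∑ n, Δ (star (u n m)) * incl C C (u n l ⊗ₜ 1) =
        incl C C (1 ⊗ₜ star (u l m)) := by
      have h2 (n) : Δ (star (u n m)) * incl C C (u n l ⊗ₜ 1) =
          ∑ k, incl C C ((star (u n k) * u n l) ⊗ₜ star (u k m)) := by
        rw [map_star, hΔ, star_sum, Finset.sum_mul]
        simp only [star_incl_tmul]
        exact Finset.sum_congr rfl fun k _ => by rw [incl_tmul_mul, mul_one]
      simp only [h2]
      rw [Finset.sum_comm]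
      simp only [← map_sum, ← TensorProduct.sum_tmul]
      congr 1
      rw [Finset.sum_eq_single l]
      · rw [hu.star_mul_self, if_pos rfl]
      · intro k _ hk
        rw [hu.star_mul_self, if_neg hk, TensorProduct.zero_tmul]
      · exact fun hl => absurd (Finset.mem_univ l) hl
    rw [← h1]
    exact sum_mem fun n _ => hgen _ _
  have hu' (l m) : incl C C (1 ⊗ₜ u l m) ∈ L :=
    hu.mem_of_star_mem (L.comap ((incl C C : C ⊗[ℂ] C →ₗ[ℂ] MinTensor C C) ∘ₗ
      TensorProduct.mk ℂ C C 1)) hstar l m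
  let T : NonUnitalStarSubalgebra ℂ C := {
    carrier := {x | incl C C (1 ⊗ₜ x) ∈ L ∧ incl C C (1 ⊗ₜ star x) ∈ L}
    add_mem' := fun {x y} hx hy => by
      constructor
      · rw [TensorProduct.tmul_add, map_add]; exact add_mem hx.1 hy.1
      · rw [star_add, TensorProduct.tmul_add, map_add]; exact add_mem hx.2 hy.2
    zero_mem' := by simp
    mul_mem' := fun {x y} hx hy => by
      constructor
      · rw [← mul_one (1 : C), ← incl_tmul_mul]; exact hmul _ hy.1 _ hx.1
      · rw [← mul_one (1 : C), star_mul, ← incl_tmul_mul]; exact hmul _ hx.2 _ hy.2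
    smul_mem' := fun c x hx => by
      constructor
      · rw [TensorProduct.tmul_smul, map_smul]; exact L.smul_mem _ hx.1
      · rw [star_smul, TensorProduct.tmul_smul, map_smul]; exact L.smul_mem _ hx.2
    star_mem' := fun {x} hx => ⟨hx.2, by rw [star_star]; exact hx.1⟩ }
  have hinc : Continuous fun x : C => incl C C (1 ⊗ₜ x) := continuous_incl_right 1
  have hT (x : C) : x ∈ T :=
    link_induction T ((hLc.preimage hinc).inter (hLc.preimage (hinc.comp continuous_star)))
      (fun n m => ⟨hu' n m, hstar n m⟩) x
  have hall (t : C ⊗[ℂ] C) : incl C C t ∈ L := by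
    induction t using TensorProduct.induction_on with
    | zero => rw [map_zero]; exact zero_mem _
    | add s t hs ht => rw [map_add]; exact add_mem hs ht
    | tmul x c =>
      have h1 := hright x _ (hT c).1
      rwa [incl_tmul_mul, mul_one, one_mul] at h1
  exact Set.eq_univ_of_forall fun x => denseRange_incl.induction_on (p := (· ∈ L)) x hLc hall

theorem isCompactQuantumGroup_link (h1 : Δ 1 = incl _ _ (1 ⊗ₜ 1))
    (hΔ : ∀ n m, Δ (linkGen 𝒢 𝒢 n m) =
      ∑ k, incl _ _ (linkGen 𝒢 𝒢 n k ⊗ₜ linkGen 𝒢 𝒢 k m)) : IsCompactQuantumGroup Δ where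
  map_one := h1
  coassoc := (isAction_comul hΔ).coaction
  dense_left := dense_comul_left hΔ
  dense_right := by
    -- The density of (1 ⊗ C)Δ(C), contained in the action property, becomes that of Δ(C)(1 ⊗ C)
    -- under adjoints.
    refine dense_span_of_star (fun x => ⟨(star x.2, star x.1), ?_⟩) (isAction_comul hΔ).dense
    rw [mulLeftRight_eq, star_mul, star_incl_tmul, star_one, map_star]

end CompactQuantumGroup
end

noncomputable section

open MinTensor

/-! ### Injectivity of B ⊗ D into the minimal tensor product -/

section SliceCoordinates

variable {B D : Type u} [CStarAlgebra B] [FiniteDimensional ℂ B] (ψ : FaithfulState B)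
  [CStarAlgebra D]

theorem FaithfulState.sliceRep_incl {K : Type u} [NormedAddCommGroup K] [InnerProductSpace ℂ K]
    [CompleteSpace K] (ρ : D →⋆ₙₐ[ℂ] (K →L[ℂ] K)) (k : Fin (Module.finrank ℂ ψ.L2))
    (t : B ⊗[ℂ] D) : ψ.sliceRep ρ (ψ.e k) (incl B D t) = ρ (ψ.coord k t) := by
  induction t using TensorProduct.induction_on with
  | zero => simp only [map_zero]
  | add s t hs ht => simp only [map_add, hs, ht]
  | tmul b d => rw [sliceRep_tmul, coord_tmul, map_smul]

end SliceCoordinates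

/-- The algebraic tensor product with a finite-dimensional algebra embeds in the minimal one. -/
theorem FaithfulState.incl_injective {B D : Type u} [CStarAlgebra B] [FiniteDimensional ℂ B]
    (ψ : FaithfulState B) [CStarAlgebra D] : Function.Injective (incl B D) := by
  refine (injective_iff_map_eq_zero (incl B D)).mpr fun t ht => ?_
  rw [← ψ.sum_coord t]
  refine Finset.sum_eq_zero fun k _ => ?_
  -- Each ρ(coordinate of t) is a slice of the image of t in the minimal tensor product, so it
  -- vanishes with that image.
  rw [eq_zero_of_forall_rep (ψ.coord k t), TensorProduct.tmul_zero]
  intro K _ _ _ ρ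
  rw [← ψ.sliceRep_incl, ht, map_zero]

theorem linearMap_eq_of_dense_span {M F ι : Type*} [AddCommGroup M] [Module ℂ M]
    [TopologicalSpace M] [AddCommGroup F] [Module ℂ F] [TopologicalSpace F] [T2Space F]
    {g : ι → M} (hg : closure (Submodule.span ℂ (Set.range g) : Set M) = Set.univ)
    {f f' : M →ₗ[ℂ] F} (hf : Continuous f) (hf' : Continuous f') (h : ∀ i, f (g i) = f' (g i)) :
    f = f' := by
  have h1 : Submodule.span ℂ (Set.range g) ≤ LinearMap.eqLocus f f' :=
    Submodule.span_le.mpr (by rintro _ ⟨i, rfl⟩; exact h i)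
  have h2 := closure_minimal h1 (isClosed_eq hf hf')
  rw [hg] at h2
  exact LinearMap.ext fun x => h2 (Set.mem_univ x)

/-! ### Coefficients of an arbitrary action satisfy the linking relations -/

section GraphAction

variable {𝒢 : DirectedQuantumGraph.{u}} {C : Type u} [CStarAlgebra C]
  {Δ : C →⋆ₙₐ[ℂ] MinTensor C C} {γ : 𝒢.B →⋆ₙₐ[ℂ] 𝒢.B ⊗[ℂ] C}

/-- The matrix of coefficients of a coaction. -/
def coefficients (γ : 𝒢.B →⋆ₙₐ[ℂ] 𝒢.B ⊗[ℂ] C) (n m : Fin (Module.finrank ℂ 𝒢.ψ.L2)) : C :=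
  𝒢.ψ.coord n (γ (𝒢.ψ.e m))

theorem coaction_coefficients (b : 𝒢.B) : coaction 𝒢 𝒢 (coefficients γ) b = γ b := by
  have h : coaction 𝒢 𝒢 (coefficients γ) = (γ : 𝒢.B →ₗ[ℂ] 𝒢.B ⊗[ℂ] C) :=
    𝒢.ψ.linearMap_ext fun m => by
      rw [coaction_e]
      exact 𝒢.ψ.sum_coord _
  exact LinearMap.congr_fun h b

/-- γ(1) is a right unit for γ(B), hence for (1 ⊗ C)γ(B), hence for everything by density;
multiplying the unit by it gives the claim. -/
theorem IsGraphAction.map_one (h : IsGraphAction 𝒢 Δ γ) : γ 1 = 1 ⊗ₜ 1 := by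
  have h1 : LinearMap.mulRight ℂ (incl 𝒢.B C (γ 1)) = LinearMap.id := by
    refine linearMap_eq_of_dense_span h.isAction.dense (continuous_mul_const _) continuous_id ?_
    rintro ⟨c, b⟩
    change mulLeftRight c (incl 𝒢.B C (γ b)) * incl 𝒢.B C (γ 1) =
      mulLeftRight c (incl 𝒢.B C (γ b))
    rw [← mulLeftRight_mul, ← _root_.map_mul, ← _root_.map_mul, mul_one]
  have h2 := LinearMap.congr_fun h1 (incl 𝒢.B C (1 ⊗ₜ 1))
  change incl 𝒢.B C (1 ⊗ₜ 1) * incl 𝒢.B C (γ 1) = incl 𝒢.B C (1 ⊗ₜ 1) at h2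
  rw [← _root_.map_mul, ← Algebra.TensorProduct.one_def, one_mul] at h2
  exact 𝒢.ψ.incl_injective h2

/-- Invariance of ψ, evaluated at e_m* e_m', expresses that the matrix is an isometry. -/
theorem IsGraphAction.star_mul_self (h : IsGraphAction 𝒢 Δ γ) (m m') :
    ∑ n, star (coefficients γ n m) * coefficients γ n m' = if m = m' then 1 else 0 := by
  have h1 := h.state (star (𝒢.ψ.e m) * 𝒢.ψ.e m')
  rw [map_mul, map_star, ← coaction_coefficients, ← coaction_coefficients, coaction_e, coaction_e,
    star_sum, Finset.sum_mul_sum, FaithfulState.e_orthonormal] at h1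
  simpa [sliceLeft, FaithfulState.e_orthonormal] using h1

/-- By v*v = 1 the matrix p = v v* fixes the coordinate vectors of γ(B)(1 ⊗ C). These are dense by
the density axiom, so p fixes every vector and equals 1. -/
theorem IsGraphAction.mul_star_self (h : IsGraphAction 𝒢 Δ γ) (n n') :
    ∑ m, coefficients γ n m * star (coefficients γ n' m) = if n = n' then 1 else 0 := by
  set v := coefficients γ with hv
  -- Row n of v v*, with n fixed.
  let p (k) : C := ∑ m, v n m * star (v k m)
  have hp (m) : ∑ k, p k * v k m = v n m := by
    simp only [p, Finset.sum_mul, mul_assoc]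
    rw [Finset.sum_comm]
    simp only [← Finset.mul_sum, hv, h.star_mul_self]
    simp
  have hp' (b) : ∑ k, p k * 𝒢.ψ.linExt (v k) b = 𝒢.ψ.linExt (v n) b := by
    simp only [FaithfulState.linExt_apply, Finset.mul_sum, mul_smul_comm]
    rw [Finset.sum_comm]
    simp only [← Finset.smul_sum, hp]
  rw [← sub_eq_zero]
  refine eq_zero_of_forall_rep _ fun K _ _ _ ρ => ?_
  have hd : closure (Submodule.span ℂ (Set.range fun x : C × 𝒢.B =>
      incl 𝒢.B C (γ x.2 * (1 ⊗ₜ x.1))) : Set (MinTensor 𝒢.B C)) = Set.univ := by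
    refine dense_span_of_star (fun x => ⟨(star x.1, star x.2), ?_⟩) h.isAction.dense
    change _ = star (mulLeftRight x.1 (incl 𝒢.B C (γ x.2)))
    rw [mulLeftRight_eq, star_mul, star_incl_tmul, star_one, _root_.map_mul, map_star, map_star]
  -- Coordinates are defined only on the algebraic tensor product. Slices through a representation
  -- replace them by continuous maps on the completion, where density can be used.
  have h1 : (∑ k, LinearMap.mulLeft ℂ (ρ (p k)) ∘ₗ 𝒢.ψ.sliceRep ρ (𝒢.ψ.e k)) =
      𝒢.ψ.sliceRep ρ (𝒢.ψ.e n) := by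
    refine linearMap_eq_of_dense_span hd ?_ (𝒢.ψ.continuous_sliceRep ρ _) ?_
    · have hc : Continuous fun x : MinTensor 𝒢.B C =>
          ∑ k, ρ (p k) * 𝒢.ψ.sliceRep ρ (𝒢.ψ.e k) x :=
        continuous_finsetSum _ fun k _ =>
          continuous_const.mul (𝒢.ψ.continuous_sliceRep ρ (𝒢.ψ.e k))
      refine hc.congr fun x => ?_
      rw [LinearMap.sum_apply]
      rfl
    · rintro ⟨c, b⟩
      have h2 (k) : 𝒢.ψ.coord k (γ b * (1 ⊗ₜ c)) = 𝒢.ψ.linExt (v k) b * c := by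
        rw [← coaction_coefficients, coaction_apply, Finset.sum_mul]
        simp only [Algebra.TensorProduct.tmul_mul_tmul, mul_one, FaithfulState.coord_sum, hv]
      rw [LinearMap.sum_apply]
      simp only [LinearMap.comp_apply, LinearMap.mulLeft_apply, FaithfulState.sliceRep_incl, h2]
      simp only [← _root_.map_mul, ← mul_assoc, ← map_sum]
      rw [← Finset.sum_mul, hp']
  have h3 := LinearMap.congr_fun h1 (incl 𝒢.B C (𝒢.ψ.e n' ⊗ₜ 1))
  rw [LinearMap.sum_apply] at h3
  simp only [LinearMap.comp_apply, LinearMap.mulLeft_apply, FaithfulState.sliceRep_tmul,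
    FaithfulState.e_orthonormal] at h3
  rw [Finset.sum_eq_single n' (fun k _ hk => by rw [if_neg hk, zero_smul, mul_zero])
    (fun hn => absurd (Finset.mem_univ _) hn), if_pos rfl, one_smul, ← _root_.map_mul, mul_one] at h3
  rw [map_sub, h3, sub_eq_zero]
  split_ifs <;> simp

theorem IsGraphAction.isLinking (h : IsGraphAction 𝒢 Δ γ) :
    IsLinking 𝒢 𝒢 (coefficients γ) where
  map_one := by rw [coaction_coefficients, h.map_one]
  map_mul b c := by simp only [coaction_coefficients, _root_.map_mul]
  map_star b := by simp only [coaction_coefficients, map_star]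
  state b := by rw [coaction_coefficients, h.state]
  adjacency b := by rw [coaction_coefficients, coaction_coefficients, h.adjacency]
  star_mul_self := h.star_mul_self
  mul_star_self := h.mul_star_self

/-- Coassociativity at e_m, sliced in the first leg against e_l. The pair from the axiom and the
algebraic one built from `t` lie in the graph with the same first component, so slices of their
second components agree in every representation. These slices represent Δ(v_lm) and Σ v_ln ⊗ v_nm.
-/
theorem IsGraphAction.comul_coefficients (h : IsGraphAction 𝒢 Δ γ) (l m) :
    Δ (coefficients γ l m) =
      ∑ n, incl C C (coefficients γ l n ⊗ₜ coefficients γ n m) := by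
  set v := coefficients γ with hv
  have hγ (m) : γ (𝒢.ψ.e m) = ∑ n, 𝒢.ψ.e n ⊗ₜ v n m := by
    rw [← coaction_coefficients, coaction_e]
  let t : (𝒢.B ⊗[ℂ] C) ⊗[ℂ] C := ∑ n, ∑ k, (𝒢.ψ.e k ⊗ₜ v k n) ⊗ₜ v n m
  have h1 := h.isAction.coaction (𝒢.ψ.e m)
  have hC (c : C) : NonUnitalStarAlgHom.id ℂ C c = c := rfl
  have hB (x : 𝒢.B) : NonUnitalStarAlgHom.id ℂ 𝒢.B x = x := rfl
  have hα (m) : (incl 𝒢.B C).comp γ (𝒢.ψ.e m) = ∑ n, incl 𝒢.B C (𝒢.ψ.e n ⊗ₜ v n m) := by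
    rw [← map_sum, ← hγ]
    rfl
  have ht : assocLinear 𝒢.B C C t = ∑ n, ∑ k,
      (incl (MinTensor 𝒢.B C) C (incl 𝒢.B C (𝒢.ψ.e k ⊗ₜ v k n) ⊗ₜ v n m),
      incl 𝒢.B (MinTensor C C) (𝒢.ψ.e k ⊗ₜ incl C C (v k n ⊗ₜ v n m))) := by
    simp only [t, map_sum, assocLinear_tmul]
  have h2 : MinTensor.map ((incl 𝒢.B C).comp γ) (NonUnitalStarAlgHom.id ℂ C)
      ((incl 𝒢.B C).comp γ (𝒢.ψ.e m)) = (assocLinear 𝒢.B C C t).1 := by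
    rw [ht]
    simp only [hα, map_sum, map_incl, hC, TensorProduct.sum_tmul, Prod.fst_sum]
  have h3 : MinTensor.map (NonUnitalStarAlgHom.id ℂ 𝒢.B) Δ
      ((incl 𝒢.B C).comp γ (𝒢.ψ.e m)) = ∑ n, incl 𝒢.B (MinTensor C C) (𝒢.ψ.e n ⊗ₜ Δ (v n m)) := by
    simp only [hα, map_sum, map_incl, hB]
  rw [← sub_eq_zero]
  refine MinTensor.eq_zero_of_forall_rep _ fun r => ?_
  change tensorRep r.left r.right _ = 0
  have h4 := 𝒢.ψ.compression_eq r.left r.right (𝒢.ψ.e l) h1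
  have h5 := 𝒢.ψ.compression_eq r.left r.right (𝒢.ψ.e l) (assocLinear_mem t)
  simp only [h2, h3] at h4
  rw [h5, ht] at h4
  simp only [Prod.snd_sum, map_sum, FaithfulState.sliceRep_tmul, FaithfulState.e_orthonormal,
    ite_smul, one_smul, zero_smul, Finset.sum_ite_eq, Finset.mem_univ, if_true] at h4
  rw [map_sub, map_sum, h4, sub_self]

end GraphAction

/-! ### Identification with the quantum automorphism group -/

section QuantumAutomorphismGroup

variable (𝒢 : DirectedQuantumGraph.{u})

/-- The canonical map `β : B → B ⊗ C(G⁺(𝒢))` as a *-homomorphism. -/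
def linkingHom : 𝒢.B →⋆ₙₐ[ℂ] 𝒢.B ⊗[ℂ] CLink 𝒢 𝒢 where
  __ := coaction 𝒢 𝒢 (linkGen 𝒢 𝒢)
  map_zero' := map_zero (coaction 𝒢 𝒢 (linkGen 𝒢 𝒢))
  map_mul' := (isLinking_linkGen 𝒢 𝒢).map_mul
  map_star' := (isLinking_linkGen 𝒢 𝒢).map_star

theorem linkingHom_apply (b : 𝒢.B) : linkingHom 𝒢 b = coaction 𝒢 𝒢 (linkGen 𝒢 𝒢) b := rfl

variable {𝒢}
variable {Δ : CLink 𝒢 𝒢 →⋆ₙₐ[ℂ] MinTensor (CLink 𝒢 𝒢) (CLink 𝒢 𝒢)}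

theorem isGraphAction_linkingHom (hΔ : ∀ n m, Δ (linkGen 𝒢 𝒢 n m) =
      ∑ k, incl _ _ (linkGen 𝒢 𝒢 n k ⊗ₜ linkGen 𝒢 𝒢 k m)) :
    IsGraphAction 𝒢 Δ (linkingHom 𝒢) where
  -- Here E = B with the identity as its only generating map.
  isAction := (isLinking_linkGen 𝒢 𝒢).isAction hΔ (fun _ : Unit => LinearMap.id)
    (fun _ _ h x => h () x) _ fun _ b => by
      change incl _ _ (linkingHom 𝒢 b) = _
      rw [linkingHom_apply, amplify, TensorProduct.map_id, LinearMap.id_comp]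
  state := (isLinking_linkGen 𝒢 𝒢).state
  adjacency b := ((isLinking_linkGen 𝒢 𝒢).adjacency b).symm

/-- Any competing action has coefficients satisfying the linking relations, so the linking algebra
maps to its function algebra. This map respects comultiplications because both have the matrix form
on coefficients. -/
theorem isQuantumAutomorphismGroup_link (h1 : Δ 1 = incl _ _ (1 ⊗ₜ 1))
    (hΔ : ∀ n m, Δ (linkGen 𝒢 𝒢 n m) =
      ∑ k, incl _ _ (linkGen 𝒢 𝒢 n k ⊗ₜ linkGen 𝒢 𝒢 k m)) :
    IsQuantumAutomorphismGroup 𝒢 Δ (linkingHom 𝒢) where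
  isCompactQuantumGroup := isCompactQuantumGroup_link h1 hΔ
  isGraphAction := isGraphAction_linkingHom hΔ
  universal C' _ Δ' γ hΔ' hγ := by
    obtain ⟨π, hπ⟩ := exists_link_lift hγ.isLinking
    have hmap (σ : CLink 𝒢 𝒢 →⋆ₐ[ℂ] C') (b : 𝒢.B) :
        TensorProduct.map LinearMap.id σ.toLinearMap (linkingHom 𝒢 b) =
          coaction 𝒢 𝒢 (fun n m => σ (linkGen 𝒢 𝒢 n m)) b := (coaction_comp σ b).symm
    refine ⟨π, ⟨fun c => ?_, fun b => ?_⟩, fun σ hσ => ?_⟩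
    · let f : CLink 𝒢 𝒢 →⋆ₙₐ[ℂ] MinTensor C' C' :=
        (MinTensor.map π.toNonUnitalStarAlgHom π.toNonUnitalStarAlgHom).comp Δ
      let g : CLink 𝒢 𝒢 →⋆ₙₐ[ℂ] MinTensor C' C' := Δ'.comp π.toNonUnitalStarAlgHom
      refine link_induction (NonUnitalStarAlgHom.equalizer f g)
        (isClosed_eq (continuous_nonUnitalStarAlgHom f) (continuous_nonUnitalStarAlgHom g))
        (fun n m => ?_) c
      change MinTensor.map π.toNonUnitalStarAlgHom π.toNonUnitalStarAlgHom (Δ _) = Δ' (π _)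
      have hπ' (n m) : π.toNonUnitalStarAlgHom (linkGen 𝒢 𝒢 n m) = coefficients γ n m := hπ n m
      rw [hπ, hγ.comul_coefficients, hΔ, map_sum]
      simp only [map_incl, hπ']
    · rw [hmap]
      simp only [hπ]
      exact coaction_coefficients b
    · refine CStarRelations.universal_hom_ext fun x => ?_
      obtain ⟨n, m⟩ := x
      -- Uniqueness uses only the intertwining of the actions: the coordinates of (id ⊗ σ)β(e_m) are
      -- the σ(u_nm).
      have h2 := congrArg (𝒢.ψ.coord n) (hσ.2 (𝒢.ψ.e m))
      rw [hmap, coaction_e, FaithfulState.coord_sum] at h2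
      exact h2.trans (hπ n m).symm

end QuantumAutomorphismGroup
end

/-- Let `𝒢 0` and `𝒢 1` be directed quantum graphs.  For all `i`, `j` the linking map
`β : B_i → B_j ⊗ C(G⁺(𝒢_j, 𝒢_i))` lifts to a *-homomorphism
`β̂ : FO(𝒢_i) → FO(𝒢_j) ⊗ C(G⁺(𝒢_j, 𝒢_i))` with `β̂ (S_i b) = (S_j ⊗ id) (β b)`.  For `i = j` the
linking map is the canonical action of the quantum automorphism group of `𝒢_i`, and `β̂` is an
action of the quantum automorphism group on `FO(𝒢_i)`. -/
theorem mainTheorem6 (𝒢 : Fin 2 → DirectedQuantumGraph.{u}) :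
    (∀ i j, ∃ β' : (𝒢 i).FO →⋆ₙₐ[ℂ] MinTensor (𝒢 j).FO (CLink (𝒢 j) (𝒢 i)),
      ∀ b, β' ((𝒢 i).S b) = MinTensor.incl (𝒢 j).FO (CLink (𝒢 j) (𝒢 i))
        (TensorProduct.map (𝒢 j).S LinearMap.id (linkingMap (𝒢 j) (𝒢 i) b))) ∧
    ∀ i, ∃ (Δ : CLink (𝒢 i) (𝒢 i) →⋆ₙₐ[ℂ] MinTensor (CLink (𝒢 i) (𝒢 i)) (CLink (𝒢 i) (𝒢 i)))
      (β : (𝒢 i).B →⋆ₙₐ[ℂ] (𝒢 i).B ⊗[ℂ] CLink (𝒢 i) (𝒢 i)),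
      (∀ b, β b = linkingMap (𝒢 i) (𝒢 i) b) ∧ IsQuantumAutomorphismGroup (𝒢 i) Δ β ∧
      ∃ β' : (𝒢 i).FO →⋆ₙₐ[ℂ] MinTensor (𝒢 i).FO (CLink (𝒢 i) (𝒢 i)), IsAction Δ β' ∧
        ∀ b, β' ((𝒢 i).S b) = MinTensor.incl (𝒢 i).FO (CLink (𝒢 i) (𝒢 i))
          (TensorProduct.map (𝒢 i).S LinearMap.id (β b)) := by
  refine ⟨fun i j => exists_link_hom (𝒢 j) (𝒢 i), fun i => ?_⟩
  obtain ⟨Δ, h1, hΔ⟩ := exists_comul (𝒢 i)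
  obtain ⟨β', hβ'⟩ := exists_link_hom (𝒢 i) (𝒢 i)
  refine ⟨Δ, linkingHom (𝒢 i), fun b => rfl, isQuantumAutomorphismGroup_link h1 hΔ, β', ?_, hβ'⟩
  -- Now E = FO, generated by the single map S, with α the homomorphism of part (1) for j = i.
  exact (isLinking_linkGen (𝒢 i) (𝒢 i)).isAction hΔ (fun _ : Unit => (𝒢 i).S)
    (fun T hT h x => (𝒢 i).FO_induction T hT (h ()) x) β' fun _ b => hβ' b
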